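/- Let $f=(f_1,f_2)$ be germs of holomorphic maps $\mathbb{C}\to\mathbb{C}^2$ with strict $4$-jet $j^4f=(f_1',f_2',\dots,f_1'''',f_2'''')$. For $m\ge 0$ let $\mathcal{DS}^4_{2,m}$ be the space of complex polynomials $P(j^4f)$ with $P(j^4(f\circ\phi))=(\phi')^m\,P((j^4f)\circ\phi)$ for all local biholomorphisms $\phi$ of $\mathbb{C}$. The group $GL_2(\mathbb{C})$ acts on it by $(W\cdot P)(j^4f)=P(W\cdot j^4f)$, where $W\cdot j^4 f$ is obtained by applying $W$ to $(f_1^{(\lambda)},f_2^{(\lambda)})$ for each $1\le\lambda\le4$. A bi-invariant of weight $m$ is a $P\in\mathcal{DS}^4_{2,m}$ fixed by all matrices $\begin{pmatrix}1&0\\u&1\end{pmatrix}$, $u\in\mathbb{C}$. Put $\Delta^{\alpha,\beta}=f_1^{(\alpha)}f_2^{(\beta)}-f_2^{(\alpha)}f_1^{(\beta)}$ and $$\Lambda^3=\Delta^{1,2},\qquad \Lambda^5_1=\Delta^{1,3}f_1'-3\Delta^{1,2}f_1'',$$ $$\Lambda^7_{1,1}=(\Delta^{1,4}+4\Delta^{2,3})f_1'f_1'-10\Delta^{1,3}f_1'f_1''+15\Delta^{1,2}f_1''f_1'',$$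 $$M^8=3\Delta^{1,4}\Delta^{1,2}+12\Delta^{2,3}\Delta^{1,2}-5\Delta^{1,3}\Delta^{1,3}.$$ For a two-dimensional complex vector space $V$ and integers $l_1\ge l_2\ge0$ let $\Gamma^{(l_1,l_2)}V^*=S^{l_1-l_2}V^*\otimes(\Lambda^2V^*)^{\otimes l_2}$, and for a complex surface $X$ let $\Gamma^{(l_1,l_2)}T_X^*$ be the corresponding bundle. (1) Every bi-invariant $P$ of weight $m$ is written, for a unique pair of polynomials $(\mathcal P,\mathcal Q)$ in four variables, as $$P=\mathcal P(f_1',\Lambda^3,\Lambda^5_1,M^8)+\Lambda^7_{1,1}\,\mathcal Q(f_1',\Lambda^5_1,\Lambda^7_{1,1},M^8).$$ Such an expression is a bi-invariant of weight $m$ if and only if the only monomials occurring in $\mathcal P$ are $(f_1')^a(\Lambda^3)^b(\Lambda^5_1)^c(M^8)^e$ with $a+3b+5c+8e=m$, and the only ones occurring in $\mathcal Q$ are $(f_1')^a(\Lambda^5_1)^c(\Lambda^7_{1,1})^d(M^8)^e$ with $7+a+5c+7d+8e=m$. (2) As a representation of $GL_2(\mathbb{C})$, with $V=\mathbb{C}^2$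 and $GL_2(\mathbb C)$ acting on $\Gamma^{(l_1,l_2)}V^*$ by pull-back, $$\mathcal{DS}^4_{2,m}\;\cong\;\bigoplus_{a+3b+5c+8e=m}\Gamma^{(a+b+2c+2e,\;b+c+2e)}V^*\;\oplus\bigoplus_{7+a+5c+7d+8e=m}\Gamma^{(3+a+2c+3d+2e,\;1+c+d+2e)}V^*.$$ (3) Let $X$ be a complex surface (Hausdorff and $\sigma$-compact; for instance a smooth projective surface in $P_3(\mathbb{C})$) and let $\mathcal{DS}^4_{2,m}T_X^*$ be the Demailly-Semple bundle, whose fiber at $x$ consists of the functions on the $4$-jets at $0$ of holomorphic curves $\gamma$ in $X$ with $\gamma(0)=x$ which in local coordinates are given by elements of $\mathcal{DS}^4_{2,m}$. As $C^\infty$ complex vector bundles on $X$, $$\mathcal{DS}^4_{2,m}T_X^*\;\cong\;\bigoplus_{a+3b+5c+8e=m}\Gamma^{(a+b+2c+2e,\;b+c+2e)}T_X^*\;\oplus\bigoplus_{7+a+5c+7d+8e=m}\Gamma^{(3+a+2c+3d+2e,\;1+c+d+2e)}T_X^*.$$ Moreover, let $F^p$ be the holomorphic subbundle of $\mathcal{DS}^4_{2,m}T_X^*$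 given in local coordinates by the invariants all of whose monomials have degree at least $p$ in the jet variables. Then for each $p\ge0$ the graded piece $F^p/F^{p+1}$ is isomorphic, as a holomorphic vector bundle, to the direct sum of those bundles $\Gamma^{(l_1,l_2)}T_X^*$ of the two families above for which $l_1+l_2=p$. -/

import Mathlib

open scoped Manifold ContDiff DirectSum

universe u

noncomputable section

namespace DemaillySemple

/-! ### Invariant jet polynomials in dimension two -/

/-- The affine plane `ℂ²`, which is also the model space of complex surfaces. -/
abbrev C2 : Type := Fin 2 → ℂ

/-- Polynomials in the strict jet of order `κ` of `f = (f₁, f₂)`. The variable `(i, l)` stands for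
the derivative of order `l + 1` of the component of index `i` (both indices start at `0`). -/
abbrev JetPoly (κ : ℕ) : Type := MvPolynomial (Fin 2 × Fin κ) ℂ

/-- The strict jet of order `κ` of `f` at `t`: the derivatives of orders `1, …, κ`. -/
def jet (κ : ℕ) (f : ℂ → C2) (t : ℂ) : Fin 2 × Fin κ → ℂ :=
  fun p => iteratedDeriv (p.2.val + 1) (fun s => f s p.1) t

/-- `P(j^κ (f ∘ φ)) = (φ')^m P((j^κ f) ∘ φ)` for all germs of biholomorphisms `φ` of `ℂ` and all
germs of holomorphic maps `f` to `ℂ²`. -/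
def IsReparamInvariant (κ m : ℕ) (P : JetPoly κ) : Prop :=
  ∀ (f : ℂ → C2) (φ : ℂ → ℂ) (t : ℂ), AnalyticAt ℂ φ t → deriv φ t ≠ 0 → AnalyticAt ℂ f (φ t) →
    MvPolynomial.eval (jet κ (f ∘ φ) t) P
      = deriv φ t ^ m * MvPolynomial.eval (jet κ f (φ t)) P

/-- The vector space `DS^κ_{2,m}` of jet polynomials of order `κ` and weight `m` which are
invariant under reparametrization. -/
def invariants (κ m : ℕ) : Submodule ℂ (JetPoly κ) where
  carrier := {P | IsReparamInvariant κ m P}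
  zero_mem' := by
    intro f φ t _ _ _
    simp
  add_mem' := by
    intro P Q hP hQ f φ t h1 h2 h3
    rw [map_add, map_add, hP f φ t h1 h2 h3, hQ f φ t h1 h2 h3, mul_add]
  smul_mem' := by
    intro c P hP f φ t h1 h2 h3
    rw [MvPolynomial.smul_eval, MvPolynomial.smul_eval, hP f φ t h1 h2 h3]
    ring

/-- The diagonal action of a `2 × 2` matrix on jets, as a substitution in jet polynomials: with
`W = (t v; u w)`, on each level `f₁ ↦ t f₁ + v f₂` and `f₂ ↦ u f₁ + w f₂`. -/
def act {κ : ℕ} (W : Matrix (Fin 2) (Fin 2) ℂ) : JetPoly κ →ₐ[ℂ] JetPoly κ :=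
  MvPolynomial.aeval fun p => ∑ j : Fin 2, MvPolynomial.C (W p.1 j) * MvPolynomial.X (j, p.2)

theorem eval_act {κ : ℕ} (W : Matrix (Fin 2) (Fin 2) ℂ) (P : JetPoly κ) (f : ℂ → C2) (t : ℂ)
    (hf : AnalyticAt ℂ f t) :
    MvPolynomial.eval (jet κ f t) (act W P)
      = MvPolynomial.eval (jet κ (fun s => W.mulVec (f s)) t) P := by
  have hcomp : ∀ j : Fin 2, AnalyticAt ℂ (fun s => f s j) t := fun j =>
    (ContinuousLinearMap.proj (R := ℂ) (φ := fun _ : Fin 2 => ℂ) j).analyticAt (f t) |>.comp hf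
  have hjet : jet κ (fun s => W.mulVec (f s)) t
      = fun p => ∑ j : Fin 2, W p.1 j * jet κ f t (j, p.2) := by
    funext p
    simp only [jet, Matrix.mulVec, dotProduct, Fin.sum_univ_two]
    have h0 : ∀ j : Fin 2, ContDiffAt ℂ ((p.2.val + 1 : ℕ) : WithTop ℕ∞) (fun s => f s j) t :=
      fun j => (hcomp j).contDiffAt
    rw [iteratedDeriv_fun_add (contDiffAt_const.mul (h0 0)) (contDiffAt_const.mul (h0 1)),
      iteratedDeriv_const_mul _ (h0 0), iteratedDeriv_const_mul _ (h0 1)]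
  rw [hjet, act, MvPolynomial.aeval_def, MvPolynomial.eval_eval₂, MvPolynomial.eval,
    MvPolynomial.coe_eval₂Hom]
  congr 1
  · ext x
    simp
  · funext p
    simp

/-- The invariants of weight `m` are stable under the action of matrices. -/
theorem act_mem {κ m : ℕ} (W : Matrix (Fin 2) (Fin 2) ℂ) {P : JetPoly κ}
    (hP : P ∈ invariants κ m) : act W P ∈ invariants κ m := by
  intro f φ t h1 h2 h3
  have hlin : AnalyticAt ℂ (fun s => W.mulVec (f s)) (φ t) :=
    (LinearMap.toContinuousLinearMap (Matrix.mulVecLin W)).analyticAt (f (φ t)) |>.comp h3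
  rw [eval_act W P (f ∘ φ) t (h3.comp h1), eval_act W P f (φ t) h3]
  exact hP (fun s => W.mulVec (f s)) φ t h1 h2 hlin

/-- The bi-invariants of weight `m`: the reparametrization invariants which are also invariant
under the unipotent matrices `(1 0; u 1)`. -/
def IsBiInvariant (κ m : ℕ) (P : JetPoly κ) : Prop :=
  P ∈ invariants κ m ∧ ∀ u : ℂ, act !![1, 0; u, 1] P = P

/-! ### The five fundamental bi-invariants of order four -/

/-- The variable `f₁^{(l + 1)}`. -/
def d1 (l : Fin 4) : JetPoly 4 := MvPolynomial.X (0, l)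

/-- The variable `f₂^{(l + 1)}`. -/
def d2 (l : Fin 4) : JetPoly 4 := MvPolynomial.X (1, l)

/-- The determinant `Δ^{α+1, β+1} = f₁^{(α+1)} f₂^{(β+1)} - f₂^{(α+1)} f₁^{(β+1)}`. -/
def jetDet (α β : Fin 4) : JetPoly 4 := d1 α * d2 β - d2 α * d1 β

/-- `Λ³ = Δ^{1,2}`. -/
def L3 : JetPoly 4 := jetDet 0 1

/-- `Λ⁵₁ = Δ^{1,3} f₁' - 3 Δ^{1,2} f₁''`. -/
def L5 : JetPoly 4 := jetDet 0 2 * d1 0 - 3 * jetDet 0 1 * d1 1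

/-- `Λ⁷₁₁ = (Δ^{1,4} + 4 Δ^{2,3}) f₁' f₁' - 10 Δ^{1,3} f₁' f₁'' + 15 Δ^{1,2} f₁'' f₁''`. -/
def L7 : JetPoly 4 :=
  (jetDet 0 3 + 4 * jetDet 1 2) * d1 0 * d1 0 - 10 * jetDet 0 2 * d1 0 * d1 1
    + 15 * jetDet 0 1 * d1 1 * d1 1

/-- `M⁸ = 3 Δ^{1,4} Δ^{1,2} + 12 Δ^{2,3} Δ^{1,2} - 5 Δ^{1,3} Δ^{1,3}`. -/
def M8 : JetPoly 4 :=
  3 * jetDet 0 3 * jetDet 0 1 + 12 * jetDet 1 2 * jetDet 0 1 - 5 * jetDet 0 2 * jetDet 0 2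

/-- `p(f₁', Λ³, Λ⁵₁, M⁸) + Λ⁷₁₁ q(f₁', Λ⁵₁, Λ⁷₁₁, M⁸)`. -/
def normalForm (p q : MvPolynomial (Fin 4) ℂ) : JetPoly 4 :=
  MvPolynomial.aeval ![d1 0, L3, L5, M8] p + L7 * MvPolynomial.aeval ![d1 0, L5, L7, M8] q

/-! ### Schur powers and the index set of the decomposition -/

/-- The Schur power `Γ^{(l₁, l₂)} V* = S^{l₁ - l₂} V* ⊗ (Λ² V*)^{⊗ l₂}` of the dual of a
two-dimensional space `V` (for `l₁ ≥ l₂`), realized as the space of functions on `V × V × V`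
spanned by the products `α₁(v) ⋯ α_{l₁ - l₂}(v) η₁(u₁, u₂) ⋯ η_{l₂}(u₁, u₂)` with linear forms
`α_i` and alternating bilinear forms `η_j` on `V`. -/
def Schur (V : Type*) [AddCommGroup V] [Module ℂ V] (l : ℕ × ℕ) : Submodule ℂ (V → V → V → ℂ) :=
  Submodule.span ℂ
    {F | ∃ (α : Fin (l.1 - l.2) → V →ₗ[ℂ] ℂ) (η : Fin l.2 → V [⋀^Fin 2]→ₗ[ℂ] ℂ),
      F = fun v u₁ u₂ => (∏ i, α i v) * ∏ j, η j ![u₁, u₂]}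

/-- The exponents `(a, b, c, e)` with `a + 3b + 5c + 8e = m`. -/
abbrev IndexA (m : ℕ) : Type := {k : Fin 4 → ℕ // k 0 + 3 * k 1 + 5 * k 2 + 8 * k 3 = m}

/-- The exponents `(a, c, d, e)` with `7 + a + 5c + 7d + 8e = m`. -/
abbrev IndexB (m : ℕ) : Type := {k : Fin 4 → ℕ // 7 + k 0 + 5 * k 1 + 7 * k 2 + 8 * k 3 = m}

/-- The pair `(l₁, l₂)` attached to an index: `(a + b + 2c + 2e, b + c + 2e)` in the first family,
`(3 + a + 2c + 3d + 2e, 1 + c + d + 2e)` in the second one. -/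
def shape {m : ℕ} : IndexA m ⊕ IndexB m → ℕ × ℕ
  | Sum.inl k => (k.1 0 + k.1 1 + 2 * k.1 2 + 2 * k.1 3, k.1 1 + k.1 2 + 2 * k.1 3)
  | Sum.inr k =>
      (3 + k.1 0 + 2 * k.1 1 + 3 * k.1 2 + 2 * k.1 3, 1 + k.1 1 + k.1 2 + 2 * k.1 3)

/-! ### Bundles on a complex surface -/

/-- The invariants of weight `m` all of whose monomials have degree at least `p`. -/
def invariantsOfOrder (κ m p : ℕ) : Submodule ℂ (JetPoly κ) where
  carrier := {P | P ∈ invariants κ m ∧ ∀ d ∈ P.support, p ≤ d.degree}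
  zero_mem' := ⟨Submodule.zero_mem _, by simp⟩
  add_mem' := by
    rintro P Q ⟨hP, hP'⟩ ⟨hQ, hQ'⟩
    refine ⟨Submodule.add_mem _ hP hQ, fun d hd => ?_⟩
    classical
    rcases Finset.mem_union.1 (MvPolynomial.support_add hd) with h | h
    · exact hP' d h
    · exact hQ' d h
  smul_mem' := by
    rintro c P ⟨hP, hP'⟩
    exact ⟨Submodule.smul_mem _ c hP, fun d hd => hP' d (MvPolynomial.support_smul hd)⟩

section Surface

variable {X : Type*} [TopologicalSpace X] [ChartedSpace C2 X]

/-- Holomorphic curve germs in `X` through the point `x`. -/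
structure Curve (x : X) where
  toFun : ℂ → X
  base : toFun 0 = x
  holo : ContMDiffAt 𝓘(ℂ, ℂ) 𝓘(ℂ, C2) ω toFun 0

/-- The function on curve germs through `x` which a jet polynomial defines in the chart `e`. -/
def pull {κ : ℕ} {x : X} (e : OpenPartialHomeomorph X C2) (P : JetPoly κ) (γ : Curve x) : ℂ :=
  MvPolynomial.eval (jet κ (fun t => e (γ.toFun t)) 0) P

/-- The functions on curve germs through `x` which are given, in each chart of the atlas around
`x`, by a jet polynomial from `S`. -/
def jetFiber {κ : ℕ} (S : Submodule ℂ (JetPoly κ)) (x : X) : Submodule ℂ (Curve x → ℂ) where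
  carrier := {Q | ∀ e ∈ atlas C2 X, x ∈ e.source → ∃ P ∈ S, Q = pull e P}
  zero_mem' := by
    intro e _ _
    exact ⟨0, S.zero_mem, by funext γ; simp [pull]⟩
  add_mem' := by
    intro Q R hQ hR e he hx
    obtain ⟨P, hP, rfl⟩ := hQ e he hx
    obtain ⟨P', hP', rfl⟩ := hR e he hx
    exact ⟨P + P', S.add_mem hP hP', by funext γ; simp [pull]⟩
  smul_mem' := by
    intro c Q hQ e he hx
    obtain ⟨P, hP, rfl⟩ := hQ e he hx
    exact ⟨c • P, S.smul_mem c hP, by funext γ; simp [pull]⟩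

/-- The fiber at `x` of the Demailly-Semple bundle `DS^κ_{2,m} T_X^*`. -/
abbrev dsFiber (κ m : ℕ) (x : X) : Submodule ℂ (Curve x → ℂ) := jetFiber (invariants κ m) x

/-- The fiber at `x` of the subbundle `F^p` of `DS^κ_{2,m} T_X^*` formed by the invariants which
vanish to order at least `p` along the zero jet. -/
abbrev dsFil (κ m p : ℕ) (x : X) : Submodule ℂ (Curve x → ℂ) :=
  jetFiber (invariantsOfOrder κ m p) x

/-- The fiber at `x` of the graded piece `F^p / F^{p+1}`. -/
def dsGr (κ m p : ℕ) (x : X) : Type _ :=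
  dsFil κ m p x ⧸ (dsFil κ m (p + 1) x).submoduleOf (dsFil κ m p x)

instance (κ m p : ℕ) (x : X) : AddCommGroup (dsGr κ m p x) :=
  Submodule.Quotient.addCommGroup _

instance (κ m p : ℕ) (x : X) : Module ℂ (dsGr κ m p x) :=
  Submodule.Quotient.module _

/-- The fiber at `x` of the Schur bundle `Γ^{(l₁, l₂)} T_X^*`. -/
abbrev schurFiber (l : ℕ × ℕ) (x : X) :
    Submodule ℂ (TangentSpace 𝓘(ℂ, C2) x → TangentSpace 𝓘(ℂ, C2) x →
      TangentSpace 𝓘(ℂ, C2) x → ℂ) :=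
  Schur (TangentSpace 𝓘(ℂ, C2) x) l

/-- The class in `F^p / F^{p+1}` of an element of `F^p`. -/
def grMk {κ m p : ℕ} {x : X} : dsFil κ m p x →ₗ[ℂ] dsGr κ m p x :=
  ((dsFil κ m (p + 1) x).submoduleOf (dsFil κ m p x)).mkQ

variable (𝕜 : Type) [NontriviallyNormedField 𝕜] [NormedSpace 𝕜 ℂ]

/-- The section `s` of the bundle with fibers `jetFiber S x` is smooth (`𝕜 = ℝ`), resp.
holomorphic (`𝕜 = ℂ`), over the open set `U`: in each chart it is a jet polynomial from `S` whose
coefficients are smooth, resp. holomorphic, functions of the point. -/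
def IsJetSection {κ : ℕ} (S : Submodule ℂ (JetPoly κ)) (U : Set X)
    (s : ∀ x : X, jetFiber S x) : Prop :=
  ∀ e ∈ atlas C2 X, ∃ c : C2 → JetPoly κ,
    (∀ y ∈ e.target ∩ e.symm ⁻¹' U,
      c y ∈ S ∧ (s (e.symm y) : Curve (e.symm y) → ℂ) = pull e (c y)) ∧
    ∀ d, ContDiffOn 𝕜 ∞ (fun y => MvPolynomial.coeff d (c y)) (e.target ∩ e.symm ⁻¹' U)

/-- The section `σ` of the Schur bundle `Γ^{(l₁, l₂)} T_X^*` is smooth (`𝕜 = ℝ`), resp. holomorphic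
(`𝕜 = ℂ`), over the open set `U`: in each chart, its values on the constant vector fields of
`ℂ²`, transported to `X`, are smooth, resp. holomorphic. -/
def IsSchurSection (l : ℕ × ℕ) (U : Set X) (σ : ∀ x : X, schurFiber l x) : Prop :=
  ∀ e ∈ atlas C2 X, ∀ v u₁ u₂ : C2,
    ContDiffOn 𝕜 ∞
      (fun y => (σ (e.symm y)).1 (mfderiv 𝓘(ℂ, C2) 𝓘(ℂ, C2) e.symm y v)
        (mfderiv 𝓘(ℂ, C2) 𝓘(ℂ, C2) e.symm y u₁) (mfderiv 𝓘(ℂ, C2) 𝓘(ℂ, C2) e.symm y u₂))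
      (e.target ∩ e.symm ⁻¹' U)

end Surface

end DemaillySemple

end

noncomputable section

namespace DemaillySemple

/-! ### Jets of reparametrized curves -/

/-! Normal form. Where `f₁' ≠ 0`, a curve can be parametrized by its first component, and a shear
removes the slope at the base point. It becomes a graph whose derivatives of orders 2, 3, 4 are
`Λ³/f₁'³`, `Λ⁵₁/f₁'⁵`, `Λ⁷₁₁/f₁'⁷`. A bi-invariant is thus a polynomial in `f₁'`, `Λ³`, `Λ⁵₁`,
`Λ⁷₁₁`, divided by a power of `f₁'` (`eval_eq_of_ne_zero`). The syzygy `3 Λ³ Λ⁷₁₁ = 5 (Λ⁵₁)² + f₁'²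
M⁸` replaces every product `Λ³ Λ⁷₁₁`, so the numerator has a normal form. On a suitable slice of
`f₁' = 0` the normal-form monomials without `f₁'` become nonzero multiples of distinct monomials.
Hence a normal form divisible by `f₁'` is divisible term by term (`normalForm_of_restr_eq_zero`);
this clears the denominator and also gives uniqueness. The reparametrization `t ↦ 2t` then separates
the weights.

Representation. Each basic bi-invariant is the value at `(1, 0)` of a covariant: a form in `v ∈ ℂ²`,
of degree `l₁ - l₂`, with jet polynomials as coefficients, on which a matrix acts through `v` and a
power of its determinant. The apolar pairing, for which the adjoint of `W` is its transpose, sends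
an invariant `P` to the functions `⟨covariant(v), P⟩ · area^{l₂}`, which lie in the Schur powers. An
invariant orthogonal to all covariants would produce a nonzero orthogonal bi-invariant. That
bi-invariant lies in the span of the leading coefficients, and positivity of the Hermitian form
forces it to vanish (`eq_zero_of_apolar_covCoeff`). The coefficients of the covariants are
invariants and are independent, so counting dimensions makes the pairing bijective
(`pairing_bijective`). No complete reducibility theorem is needed.

Bundles. A holomorphic change of chart acts on jet polynomials as its Jacobian matrix, up to terms
of higher degree (`exists_transition`). The fiberwise isomorphisms attached to two charts therefore
differ by a unipotent map for the degree filtration. On a graded piece they coincide, which gives a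
canonical holomorphic isomorphism. On the whole bundle they are averaged with a partition of unity:
an average of unipotent maps is unipotent, because degrees are bounded by the weight, and hence
invertible (`bijective_globalMap`). -/

/-- The jet of order four of `f ∘ φ` in terms of the jets `X` of `f` and `a` of `φ`. -/
def rep (a : Fin 4 → ℂ) (X : Fin 2 × Fin 4 → ℂ) : Fin 2 × Fin 4 → ℂ := fun p =>
  ![a 0 * X (p.1, 0),
    a 0 ^ 2 * X (p.1, 1) + a 1 * X (p.1, 0),
    a 0 ^ 3 * X (p.1, 2) + 3 * a 0 * a 1 * X (p.1, 1) + a 2 * X (p.1, 0),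
    a 0 ^ 4 * X (p.1, 3) + 6 * a 0 ^ 2 * a 1 * X (p.1, 2)
      + (3 * a 1 ^ 2 + 4 * a 0 * a 2) * X (p.1, 1) + a 3 * X (p.1, 0)] p.2

/-- Leibniz rule for `(g' ∘ φ) φ'`. Applied repeatedly to `g`, `g'`, `g''`, `g'''` it yields the
formula of Faà di Bruno through order four. -/
theorem iteratedDeriv_succ_comp {g φ : ℂ → ℂ} {t : ℂ} (hg : AnalyticAt ℂ g (φ t))
    (hφ : AnalyticAt ℂ φ t) (n : ℕ) :
    iteratedDeriv (n + 1) (g ∘ φ) t = ∑ k ∈ Finset.range (n + 1),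
      n.choose k * iteratedDeriv k (deriv g ∘ φ) t * iteratedDeriv (n - k + 1) φ t := by
  have h : deriv (g ∘ φ) =ᶠ[nhds t] (deriv g ∘ φ) * deriv φ := by
    filter_upwards [hφ.continuousAt.eventually hg.eventually_analyticAt,
      hφ.eventually_analyticAt] with s hs hs'
    exact deriv_comp s hs.differentiableAt hs'.differentiableAt
  rw [iteratedDeriv_succ', h.iteratedDeriv_eq,
    iteratedDeriv_mul (hg.deriv.comp hφ).contDiffAt hφ.deriv.contDiffAt]
  simp_rw [← iteratedDeriv_succ']

theorem jet_comp {f : ℂ → C2} {φ : ℂ → ℂ} {t : ℂ} (hf : AnalyticAt ℂ f (φ t))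
    (hφ : AnalyticAt ℂ φ t) :
    jet 4 (f ∘ φ) t = rep (fun l => iteratedDeriv (l.val + 1) φ t) (jet 4 f (φ t)) := by
  funext ⟨i, l⟩
  have hg : AnalyticAt ℂ (fun s => f s i) (φ t) :=
    (ContinuousLinearMap.proj (R := ℂ) (φ := fun _ : Fin 2 => ℂ) i).analyticAt (f (φ t)) |>.comp hf
  change iteratedDeriv (l.val + 1) ((fun s => f s i) ∘ φ) t = _
  have hg1 := hg.deriv
  have hg2 := hg1.deriv
  have hg3 := hg2.deriv
  fin_cases l <;>
    simp [rep, jet, iteratedDeriv_succ_comp hg hφ, iteratedDeriv_succ_comp hg1 hφ,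
      iteratedDeriv_succ_comp hg2 hφ, iteratedDeriv_succ_comp hg3 hφ, Finset.sum_range_succ,
      iteratedDeriv_succ', Nat.choose] <;> ring

/-- A polynomial function with value `y` and derivatives `a` at the origin. -/
def taylorPoly {n : ℕ} (y : ℂ) (a : Fin n → ℂ) (t : ℂ) : ℂ :=
  y + ∑ l : Fin n, a l / (l.val + 1).factorial * t ^ (l.val + 1)

theorem taylorPoly_zero {n : ℕ} (y : ℂ) (a : Fin n → ℂ) : taylorPoly y a 0 = y := by
  simp [taylorPoly]

theorem analyticAt_taylorPoly {n : ℕ} (y : ℂ) (a : Fin n → ℂ) (t : ℂ) :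
    AnalyticAt ℂ (taylorPoly y a) t := by
  unfold taylorPoly
  fun_prop

theorem iteratedDeriv_taylorPoly {n : ℕ} (y : ℂ) (a : Fin n → ℂ) (l : Fin n) :
    iteratedDeriv (l.val + 1) (taylorPoly y a) 0 = a l := by
  unfold taylorPoly
  rw [iteratedDeriv_const_add (Nat.succ_pos _), iteratedDeriv_fun_sum (fun i _ => by fun_prop)]
  simp only [iteratedDeriv_const_mul_field, iteratedDeriv_fun_pow_zero]
  rw [Finset.sum_eq_single l (fun b _ hb => ?_) (by simp)]
  swap
  · rw [if_neg fun h => hb (Fin.ext (Nat.succ_injective h).symm), Nat.cast_zero, mul_zero]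
  have : ((l.val + 1).factorial : ℂ) ≠ 0 := by exact_mod_cast Nat.factorial_ne_zero _
  simp [this]

/-- A polynomial curve through `y` with jet `X` at the origin. -/
def polyCurve {κ : ℕ} (y : C2) (X : Fin 2 × Fin κ → ℂ) (t : ℂ) : C2 :=
  fun i => taylorPoly (y i) (fun l => X (i, l)) t

theorem polyCurve_zero {κ : ℕ} (y : C2) (X : Fin 2 × Fin κ → ℂ) : polyCurve y X 0 = y := by
  funext i
  simp [polyCurve, taylorPoly_zero]

theorem analyticAt_polyCurve {κ : ℕ} (y : C2) (X : Fin 2 × Fin κ → ℂ) (t : ℂ) :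
    AnalyticAt ℂ (polyCurve y X) t :=
  AnalyticAt.pi fun _ => analyticAt_taylorPoly _ _ _

theorem jet_polyCurve {κ : ℕ} (y : C2) (X : Fin 2 × Fin κ → ℂ) : jet κ (polyCurve y X) 0 = X := by
  funext ⟨i, l⟩
  exact iteratedDeriv_taylorPoly (y i) (fun l => X (i, l)) l

theorem deriv_taylorPoly {n : ℕ} (y : ℂ) (a : Fin (n + 1) → ℂ) :
    deriv (taylorPoly y a) 0 = a 0 := by
  simpa [iteratedDeriv_one] using iteratedDeriv_taylorPoly y a 0

/-- Strict jets do not record the base point, and every jet is realized by a polynomial curve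
through any prescribed point. Testing on curves through a single point `y` thus already gives the
algebraic identity in all jets. A free `y` matters later, where coordinate changes are only
controlled at one point. -/
theorem isReparamInvariant_of_centered {m : ℕ} {P : JetPoly 4} (y : C2)
    (h : ∀ (f : ℂ → C2) (φ : ℂ → ℂ), AnalyticAt ℂ φ 0 → φ 0 = 0 → deriv φ 0 ≠ 0 →
      AnalyticAt ℂ f 0 → f 0 = y → MvPolynomial.eval (jet 4 (f ∘ φ) 0) P
        = deriv φ 0 ^ m * MvPolynomial.eval (jet 4 f 0) P) :
    ∀ (a : Fin 4 → ℂ) (X : Fin 2 × Fin 4 → ℂ), a 0 ≠ 0 →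
      MvPolynomial.eval (rep a X) P = a 0 ^ m * MvPolynomial.eval X P := by
  intro a X ha
  have := h (polyCurve y X) (taylorPoly 0 a) (analyticAt_taylorPoly _ _ _) (taylorPoly_zero _ _)
    (by rwa [deriv_taylorPoly]) (analyticAt_polyCurve _ _ _) (polyCurve_zero _ _)
  rw [jet_comp (by exact analyticAt_polyCurve _ _ _) (analyticAt_taylorPoly _ _ _),
    taylorPoly_zero, jet_polyCurve, deriv_taylorPoly] at this
  simpa only [iteratedDeriv_taylorPoly] using this

theorem mem_invariants_iff {m : ℕ} {P : JetPoly 4} :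
    P ∈ invariants 4 m ↔ ∀ (a : Fin 4 → ℂ) (X : Fin 2 × Fin 4 → ℂ), a 0 ≠ 0 →
      MvPolynomial.eval (rep a X) P = a 0 ^ m * MvPolynomial.eval X P := by
  constructor
  · intro h
    refine isReparamInvariant_of_centered 0 fun f φ h1 h2 h3 h4 _ => ?_
    have := h f φ 0 h1 h3 (by rwa [h2])
    rwa [h2] at this
  · intro h f φ t h1 h2 h3
    rw [jet_comp h3 h1, h _ _ (by simpa [iteratedDeriv_one] using h2)]
    simp [iteratedDeriv_one]

theorem mul_mem_invariants {m n : ℕ} {P Q : JetPoly 4} (hP : P ∈ invariants 4 m)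
    (hQ : Q ∈ invariants 4 n) : P * Q ∈ invariants 4 (m + n) := by
  rw [mem_invariants_iff] at *
  intro a X ha
  rw [map_mul, map_mul, hP a X ha, hQ a X ha]
  ring

theorem one_mem_invariants : (1 : JetPoly 4) ∈ invariants 4 0 := by
  rw [mem_invariants_iff]
  simp

theorem pow_mem_invariants {m : ℕ} {P : JetPoly 4} (hP : P ∈ invariants 4 m) (n : ℕ) :
    P ^ n ∈ invariants 4 (n * m) := by
  induction n with
  | zero => simpa using one_mem_invariants
  | succ n ih => simpa [pow_succ, Nat.succ_mul] using mul_mem_invariants ih hP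

/-! ### Homogeneity -/

/-- The substitution multiplying each variable `X i` with `t ^ w i`. -/
def rescale {σ : Type*} (t : ℂ) (w : σ → ℕ) : MvPolynomial σ ℂ →ₐ[ℂ] MvPolynomial σ ℂ :=
  MvPolynomial.aeval fun i => MvPolynomial.C (t ^ w i) * MvPolynomial.X i

theorem coeff_rescale {σ : Type*} (t : ℂ) (w : σ → ℕ) (P : MvPolynomial σ ℂ) (d : σ →₀ ℕ) :
    MvPolynomial.coeff d (rescale t w P) = t ^ Finsupp.weight w d * MvPolynomial.coeff d P := by
  classical
  induction P using MvPolynomial.induction_on' with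
  | monomial e c =>
    have : rescale t w (MvPolynomial.monomial e c)
        = MvPolynomial.monomial e (t ^ Finsupp.weight w e * c) := by
      rw [rescale, MvPolynomial.aeval_monomial]
      simp only [mul_pow, Finsupp.prod_mul, ← map_pow]
      rw [MvPolynomial.monomial_eq, map_mul, mul_comm (MvPolynomial.C _) (MvPolynomial.C c),
        mul_assoc]
      congr 2
      rw [Finsupp.prod, ← map_prod, Finsupp.weight_apply, Finsupp.sum,
        ← Finset.prod_pow_eq_pow_sum]
      congr 1
      refine Finset.prod_congr rfl fun p _ => ?_
      rw [← pow_mul, mul_comm, smul_eq_mul]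
    rw [this, MvPolynomial.coeff_monomial, MvPolynomial.coeff_monomial]
    split_ifs with h <;> simp [h]
  | add p q hp hq => rw [map_add, MvPolynomial.coeff_add, MvPolynomial.coeff_add, hp, hq, mul_add]

/-- The weight of a monomial in the jet variables. -/
def wt {κ : ℕ} (d : Fin 2 × Fin κ →₀ ℕ) : ℕ := Finsupp.weight (fun p => p.2.val + 1) d

theorem degree_le_wt {κ : ℕ} (d : Fin 2 × Fin κ →₀ ℕ) : d.degree ≤ wt d := by
  rw [Finsupp.degree_apply, wt, Finsupp.weight_apply, Finsupp.sum]
  exact Finset.sum_le_sum fun p _ => Nat.le_mul_of_pos_right _ (Nat.succ_pos _)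

/-- The substitution multiplying each variable of order `l` with `2 ^ l`. -/
def doubling : JetPoly 4 →ₐ[ℂ] JetPoly 4 := rescale 2 fun p => p.2.val + 1

/-- This is the reparametrization `t ↦ 2t`. Since the powers of 2 are distinct, its eigenvalue
recovers the weight. -/
theorem doubling_eq {m : ℕ} {P : JetPoly 4} (hP : P ∈ invariants 4 m) :
    doubling P = (2 : ℂ) ^ m • P := by
  refine MvPolynomial.funext fun X => ?_
  rw [mem_invariants_iff] at hP
  have h := hP ![2, 0, 0, 0] X (by simp)
  rw [MvPolynomial.smul_eval]
  simp only [Matrix.cons_val_zero] at h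
  rw [← h, doubling, rescale, MvPolynomial.aeval_def, MvPolynomial.eval_eval₂, MvPolynomial.eval,
    MvPolynomial.coe_eval₂Hom]
  congr 1
  · ext x
    simp
  · funext ⟨i, l⟩
    fin_cases l <;> simp [rep]

theorem two_pow_injective {m n : ℕ} (h : (2 : ℂ) ^ m = 2 ^ n) : m = n := by
  have : (2 : ℕ) ^ m = 2 ^ n := by exact_mod_cast h
  exact Nat.pow_right_injective le_rfl this

theorem wt_eq_of_mem_support {m : ℕ} {P : JetPoly 4} (hP : P ∈ invariants 4 m)
    {d : Fin 2 × Fin 4 →₀ ℕ} (hd : d ∈ P.support) : wt d = m := by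
  have h := congrArg (MvPolynomial.coeff d) (doubling_eq hP)
  rw [doubling, coeff_rescale, MvPolynomial.coeff_smul, smul_eq_mul] at h
  exact two_pow_injective (mul_right_cancel₀ (MvPolynomial.mem_support_iff.1 hd) h)

/-! ### The fundamental bi-invariants -/

/-- The diagonal action of a matrix on jets. -/
def actPt {κ : ℕ} (W : Matrix (Fin 2) (Fin 2) ℂ) (X : Fin 2 × Fin κ → ℂ) : Fin 2 × Fin κ → ℂ :=
  fun p => ∑ j : Fin 2, W p.1 j * X (j, p.2)

theorem eval_act_eq {κ : ℕ} (W : Matrix (Fin 2) (Fin 2) ℂ) (P : JetPoly κ)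
    (X : Fin 2 × Fin κ → ℂ) :
    MvPolynomial.eval X (act W P) = MvPolynomial.eval (actPt W X) P := by
  rw [act, MvPolynomial.aeval_def, MvPolynomial.eval_eval₂, MvPolynomial.eval,
    MvPolynomial.coe_eval₂Hom]
  congr 1
  · ext x
    simp
  · funext p
    simp [actPt]

theorem isBiInvariant_mul {m n : ℕ} {P Q : JetPoly 4} (hP : IsBiInvariant 4 m P)
    (hQ : IsBiInvariant 4 n Q) : IsBiInvariant 4 (m + n) (P * Q) :=
  ⟨mul_mem_invariants hP.1 hQ.1, fun u => by rw [map_mul, hP.2, hQ.2]⟩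

theorem isBiInvariant_pow {m : ℕ} {P : JetPoly 4} (hP : IsBiInvariant 4 m P) (n : ℕ) :
    IsBiInvariant 4 (n * m) (P ^ n) :=
  ⟨pow_mem_invariants hP.1 n, fun u => by rw [map_pow, hP.2]⟩

theorem isBiInvariant_d1 : IsBiInvariant 4 1 (d1 0) := by
  refine ⟨mem_invariants_iff.2 fun a X _ => by simp [d1, rep], fun u => ?_⟩
  simp [d1, act]

theorem isBiInvariant_L3 : IsBiInvariant 4 3 L3 := by
  refine ⟨mem_invariants_iff.2 fun a X _ => ?_, fun u => ?_⟩
  · simp [L3, jetDet, d1, d2, rep]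
    ring
  · refine MvPolynomial.funext fun X => ?_
    simp [eval_act_eq, actPt, L3, jetDet, d1, d2]
    ring

theorem isBiInvariant_L5 : IsBiInvariant 4 5 L5 := by
  refine ⟨mem_invariants_iff.2 fun a X _ => ?_, fun u => ?_⟩
  · simp [L5, jetDet, d1, d2, rep]
    ring
  · refine MvPolynomial.funext fun X => ?_
    simp [eval_act_eq, actPt, L5, jetDet, d1, d2]
    ring

theorem isBiInvariant_L7 : IsBiInvariant 4 7 L7 := by
  refine ⟨mem_invariants_iff.2 fun a X _ => ?_, fun u => ?_⟩
  · simp [L7, jetDet, d1, d2, rep]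
    ring
  · refine MvPolynomial.funext fun X => ?_
    simp [eval_act_eq, actPt, L7, jetDet, d1, d2]
    ring

theorem isBiInvariant_M8 : IsBiInvariant 4 8 M8 := by
  refine ⟨mem_invariants_iff.2 fun a X _ => ?_, fun u => ?_⟩
  · simp [M8, jetDet, d1, d2, rep]
    ring
  · refine MvPolynomial.funext fun X => ?_
    simp [eval_act_eq, actPt, M8, jetDet, d1, d2]
    ring

/-- The syzygy behind the shape of the normal form: `Λ³` and `Λ⁷₁₁` never need to occur in the same
monomial. -/
theorem L3_mul_L7 : 3 * (L3 * L7) = 5 * L5 ^ 2 + d1 0 ^ 2 * M8 := by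
  simp only [L3, L5, L7, M8, jetDet]
  ring

/-- The monomials of the first kind in the fundamental bi-invariants. -/
def monA (k : Fin 4 → ℕ) : JetPoly 4 := d1 0 ^ k 0 * L3 ^ k 1 * L5 ^ k 2 * M8 ^ k 3

/-- The monomials of the second kind in the fundamental bi-invariants. -/
def monB (k : Fin 4 → ℕ) : JetPoly 4 := L7 * (d1 0 ^ k 0 * L5 ^ k 1 * L7 ^ k 2 * M8 ^ k 3)

theorem isBiInvariant_monA (k : Fin 4 → ℕ) :
    IsBiInvariant 4 (k 0 + 3 * k 1 + 5 * k 2 + 8 * k 3) (monA k) := by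
  have := isBiInvariant_mul (isBiInvariant_mul (isBiInvariant_mul
    (isBiInvariant_pow isBiInvariant_d1 (k 0)) (isBiInvariant_pow isBiInvariant_L3 (k 1)))
    (isBiInvariant_pow isBiInvariant_L5 (k 2))) (isBiInvariant_pow isBiInvariant_M8 (k 3))
  rw [monA]
  convert this using 1
  ring

theorem isBiInvariant_monB (k : Fin 4 → ℕ) :
    IsBiInvariant 4 (7 + k 0 + 5 * k 1 + 7 * k 2 + 8 * k 3) (monB k) := by
  have := isBiInvariant_mul isBiInvariant_L7 (isBiInvariant_mul (isBiInvariant_mul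
    (isBiInvariant_mul
    (isBiInvariant_pow isBiInvariant_d1 (k 0)) (isBiInvariant_pow isBiInvariant_L5 (k 1)))
    (isBiInvariant_pow isBiInvariant_L7 (k 2))) (isBiInvariant_pow isBiInvariant_M8 (k 3)))
  rw [monB]
  convert this using 1
  ring

theorem normalForm_eq_sum (p q : MvPolynomial (Fin 4) ℂ) :
    normalForm p q = ∑ k ∈ p.support, MvPolynomial.coeff k p • monA k
      + ∑ k ∈ q.support, MvPolynomial.coeff k q • monB k := by
  rw [normalForm, MvPolynomial.aeval_def, MvPolynomial.aeval_def, MvPolynomial.eval₂_eq',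
    MvPolynomial.eval₂_eq', Finset.mul_sum]
  congr 1 <;> refine Finset.sum_congr rfl fun k _ => ?_
  · rw [Algebra.smul_def]
    simp [Fin.prod_univ_four, monA]
  · rw [Algebra.smul_def, mul_left_comm]
    simp [Fin.prod_univ_four, monB]

/-- The normal form as a linear map. -/
def normalFormLin : MvPolynomial (Fin 4) ℂ × MvPolynomial (Fin 4) ℂ →ₗ[ℂ] JetPoly 4 :=
  LinearMap.coprod (MvPolynomial.aeval ![d1 0, L3, L5, M8]).toLinearMap
    (LinearMap.mulLeft ℂ L7 ∘ₗ (MvPolynomial.aeval ![d1 0, L5, L7, M8]).toLinearMap)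

theorem normalFormLin_apply (p q : MvPolynomial (Fin 4) ℂ) :
    normalFormLin (p, q) = normalForm p q := rfl

theorem normalForm_X_mul (p q : MvPolynomial (Fin 4) ℂ) :
    normalForm (MvPolynomial.X 0 * p) (MvPolynomial.X 0 * q) = d1 0 * normalForm p q := by
  simp only [normalForm, map_mul, MvPolynomial.aeval_X, Matrix.cons_val_zero]
  ring

/-! ### Uniqueness of the normal form -/

/-- The restriction to the jets with `f₁' = f₁''' = 0` and `f₂'' = f₂''' = f₂'''' = 0`. -/
def restr : JetPoly 4 →ₐ[ℂ] MvPolynomial (Fin 3) ℂ :=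
  MvPolynomial.aeval fun p =>
    ![![0, MvPolynomial.X 0, 0, MvPolynomial.X 1], ![MvPolynomial.X 2, 0, 0, 0]] p.1 p.2

/-- A finitely supported exponent with the given values. -/
def expo (x w z : ℕ) : Fin 3 →₀ ℕ := Finsupp.equivFunOnFinite.symm ![x, w, z]

theorem monomial_expo (x w z : ℕ) (c : ℂ) :
    MvPolynomial.monomial (expo x w z) c = MvPolynomial.C c * (MvPolynomial.X 0 ^ x
      * MvPolynomial.X 1 ^ w * MvPolynomial.X 2 ^ z : MvPolynomial (Fin 3) ℂ) := by
  rw [MvPolynomial.monomial_eq, Finsupp.prod_fintype _ _ (by simp)]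
  simp [Fin.prod_univ_three, expo]

theorem expo_inj {x w z x' w' z' : ℕ} (h : expo x w z = expo x' w' z') :
    x = x' ∧ w = w' ∧ z = z' := by
  have := Finsupp.equivFunOnFinite.symm.injective h
  exact ⟨congrFun this 0, congrFun this 1, congrFun this 2⟩

theorem restr_monA (k : Fin 4 → ℕ) : restr (monA k) = if k 0 = 0 then
    MvPolynomial.monomial (expo (k 1 + 2 * k 2 + k 3) (k 3) (k 1 + k 2 + 2 * k 3))
      ((-1) ^ k 1 * 3 ^ k 2 * 3 ^ k 3) else 0 := by
  have h1 : restr (d1 0) = 0 := by simp [restr, d1]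
  have h2 : restr L3 = MvPolynomial.C (-1) * (MvPolynomial.X 0 * MvPolynomial.X 2) := by
    simp [restr, L3, jetDet, d1, d2]
    ring
  have h3 : restr L5 = MvPolynomial.C 3 * (MvPolynomial.X 0 ^ 2 * MvPolynomial.X 2) := by
    simp only [L5, jetDet, map_sub, map_mul, map_ofNat]
    simp [restr, d1, d2]
    ring
  have h4 : restr M8 =
      MvPolynomial.C 3 * (MvPolynomial.X 0 * MvPolynomial.X 1 * MvPolynomial.X 2 ^ 2) := by
    simp only [M8, jetDet, map_sub, map_add, map_mul, map_ofNat]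
    simp [restr, d1, d2]
    ring
  split_ifs with h
  · rw [monA, map_mul, map_mul, map_mul, map_pow, map_pow, map_pow, map_pow, h1, h2, h3, h4, h,
      monomial_expo]
    simp only [mul_pow, map_mul, map_pow]
    ring
  · rw [monA, map_mul, map_mul, map_mul, map_pow, h1, zero_pow h]
    simp

theorem restr_monB (k : Fin 4 → ℕ) : restr (monB k) = if k 0 = 0 then
    MvPolynomial.monomial (expo (3 + 2 * k 1 + 3 * k 2 + k 3) (k 3) (1 + k 1 + k 2 + 2 * k 3))
      (-15 * (3 ^ k 1 * (-15) ^ k 2 * 3 ^ k 3)) else 0 := by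
  have h1 : restr (d1 0) = 0 := by simp [restr, d1]
  have h2 : restr L7 = MvPolynomial.C (-15) * (MvPolynomial.X 0 ^ 3 * MvPolynomial.X 2) := by
    have h15 : (MvPolynomial.C 15 : MvPolynomial (Fin 3) ℂ) = 15 := map_ofNat _ _
    simp only [L7, jetDet, map_sub, map_add, map_mul, map_ofNat]
    simp [restr, d1, d2, h15]
    ring
  have h3 : restr L5 = MvPolynomial.C 3 * (MvPolynomial.X 0 ^ 2 * MvPolynomial.X 2) := by
    simp only [L5, jetDet, map_sub, map_mul, map_ofNat]
    simp [restr, d1, d2]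
    ring
  have h4 : restr M8 =
      MvPolynomial.C 3 * (MvPolynomial.X 0 * MvPolynomial.X 1 * MvPolynomial.X 2 ^ 2) := by
    simp only [M8, jetDet, map_sub, map_add, map_mul, map_ofNat]
    simp [restr, d1, d2]
    ring
  split_ifs with h
  · rw [monB, map_mul, map_mul, map_mul, map_mul, map_pow, map_pow, map_pow, map_pow, h1, h2, h3,
      h4, h, monomial_expo]
    simp only [mul_pow, map_mul, map_pow]
    ring
  · rw [monB, map_mul, map_mul, map_mul, map_mul, map_pow, h1, zero_pow h]
    simp

/-- Monomials without `f₁'` restrict to distinct monomials `x^α w^e z^γ`. The exponent of `w` gives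
`e`. The first family satisfies `α - e ≤ 2 (γ - 2e)` and the second `α - e > 2 (γ - 2e)`, so the two
families do not meet. Within each family the two remaining exponents are recovered linearly from `α`
and `γ`. -/
theorem coeff_eq_zero_of_restr {p q : MvPolynomial (Fin 4) ℂ} (h : restr (normalForm p q) = 0)
    (k : Fin 4 →₀ ℕ) (hk : k 0 = 0) :
    MvPolynomial.coeff k p = 0 ∧ MvPolynomial.coeff k q = 0 := by
  rw [normalForm_eq_sum, map_add, map_sum, map_sum] at h
  simp only [map_smul, restr_monA, restr_monB] at h
  have ext4 : ∀ l : Fin 4 →₀ ℕ, l 0 = k 0 → l 1 = k 1 → l 2 = k 2 → l 3 = k 3 → l = k := by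
    intro l h0 h1 h2 h3
    ext i
    fin_cases i <;> assumption
  constructor
  · have hc := congrArg (MvPolynomial.coeff
      (expo (k 1 + 2 * k 2 + k 3) (k 3) (k 1 + k 2 + 2 * k 3))) h
    rw [MvPolynomial.coeff_add, MvPolynomial.coeff_sum, MvPolynomial.coeff_sum,
      Finset.sum_eq_single k, Finset.sum_eq_zero] at hc
    · simpa [hk] using hc
    · intro l _
      split_ifs with hl
      · rw [MvPolynomial.coeff_smul, MvPolynomial.coeff_monomial, if_neg, smul_zero]
        intro he
        obtain ⟨h1, h2, h3⟩ := expo_inj he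
        omega
      · simp
    · intro l _ hne
      split_ifs with hl
      · rw [MvPolynomial.coeff_smul, MvPolynomial.coeff_monomial, if_neg, smul_zero]
        intro he
        obtain ⟨h1, h2, h3⟩ := expo_inj he
        exact hne (ext4 l (by omega) (by omega) (by omega) (by omega))
      · simp
    · intro hk'
      rw [MvPolynomial.notMem_support_iff.1 hk']
      simp
  · have hc := congrArg (MvPolynomial.coeff
      (expo (3 + 2 * k 1 + 3 * k 2 + k 3) (k 3) (1 + k 1 + k 2 + 2 * k 3))) h
    rw [MvPolynomial.coeff_add, MvPolynomial.coeff_sum, MvPolynomial.coeff_sum, add_comm,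
      Finset.sum_eq_single k, Finset.sum_eq_zero] at hc
    · simpa [hk] using hc
    · intro l _
      split_ifs with hl
      · rw [MvPolynomial.coeff_smul, MvPolynomial.coeff_monomial, if_neg, smul_zero]
        intro he
        obtain ⟨h1, h2, h3⟩ := expo_inj he
        omega
      · simp
    · intro l _ hne
      split_ifs with hl
      · rw [MvPolynomial.coeff_smul, MvPolynomial.coeff_monomial, if_neg, smul_zero]
        intro he
        obtain ⟨h1, h2, h3⟩ := expo_inj he
        exact hne (ext4 l (by omega) (by omega) (by omega) (by omega))
      · simp
    · intro hk'
      rw [MvPolynomial.notMem_support_iff.1 hk']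
      simp

theorem X_dvd_of_coeff {σ R : Type*} [CommRing R] {p : MvPolynomial σ R} {i : σ}
    (h : ∀ k : σ →₀ ℕ, k i = 0 → MvPolynomial.coeff k p = 0) : MvPolynomial.X i ∣ p := by
  rw [MvPolynomial.X_dvd_iff_modMonomial_eq_zero]
  ext k
  rw [MvPolynomial.coeff_zero]
  by_cases hk : Finsupp.single i 1 ≤ k
  · exact MvPolynomial.coeff_modMonomial_of_le _ hk
  · rw [MvPolynomial.coeff_modMonomial_of_not_le _ hk]
    refine h k ?_
    by_contra hne
    exact hk (Finsupp.single_le_iff.2 (Nat.one_le_iff_ne_zero.2 hne))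

theorem d1_ne_zero (l : Fin 4) : d1 l ≠ 0 := MvPolynomial.X_ne_zero _

theorem normalForm_of_restr_eq_zero {p q : MvPolynomial (Fin 4) ℂ}
    (h : restr (normalForm p q) = 0) : ∃ p' q' : MvPolynomial (Fin 4) ℂ,
      p = MvPolynomial.X 0 * p' ∧ q = MvPolynomial.X 0 * q' ∧
      normalForm p q = d1 0 * normalForm p' q' := by
  obtain ⟨p', rfl⟩ := X_dvd_of_coeff fun k hk => (coeff_eq_zero_of_restr h k hk).1
  obtain ⟨q', rfl⟩ := X_dvd_of_coeff fun k hk => (coeff_eq_zero_of_restr h k hk).2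
  exact ⟨p', q', rfl, rfl, normalForm_X_mul p' q'⟩

/-- Normal forms are saturated with respect to `f₁'`; this is the step that clears denominators. -/
theorem exists_normalForm_of_d1_mul {P : JetPoly 4} {p q : MvPolynomial (Fin 4) ℂ}
    (h : d1 0 * P = normalForm p q) : ∃ p' q', P = normalForm p' q' := by
  obtain ⟨p', q', -, -, h'⟩ := normalForm_of_restr_eq_zero (p := p) (q := q) (by
    rw [← h, map_mul]
    simp [restr, d1])
  exact ⟨p', q', mul_left_cancel₀ (d1_ne_zero 0) (h.trans h')⟩

theorem eq_zero_of_forall_X_pow_dvd {σ : Type*} {p : MvPolynomial σ ℂ} {i : σ}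
    (h : ∀ n : ℕ, MvPolynomial.X i ^ n ∣ p) : p = 0 := by
  by_contra hp
  obtain ⟨r, hr⟩ := h (p.totalDegree + 1)
  have hr0 : r ≠ 0 := by
    rintro rfl
    exact hp (by simpa using hr)
  have := congrArg MvPolynomial.totalDegree hr
  rw [MvPolynomial.totalDegree_mul_of_isDomain (pow_ne_zero _ (MvPolynomial.X_ne_zero i)) hr0,
    MvPolynomial.totalDegree_X_pow] at this
  omega

theorem normalForm_eq_zero {p q : MvPolynomial (Fin 4) ℂ} (h : normalForm p q = 0) :
    p = 0 ∧ q = 0 := by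
  -- Dividing by `f₁'` gives another relation, so the coefficients of a relation are divisible by
  -- arbitrarily high powers of the first variable.
  have key : ∀ (n : ℕ) (p q : MvPolynomial (Fin 4) ℂ), normalForm p q = 0 →
      MvPolynomial.X 0 ^ n ∣ p ∧ MvPolynomial.X 0 ^ n ∣ q := by
    intro n
    induction n with
    | zero => simp
    | succ n ih =>
      intro p q h
      obtain ⟨p', q', rfl, rfl, h'⟩ := normalForm_of_restr_eq_zero (by rw [h, map_zero])
      obtain ⟨h1, h2⟩ := ih p' q'
        ((mul_eq_zero.1 (h'.symm.trans h)).resolve_left (d1_ne_zero 0))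
      rw [pow_succ']
      exact ⟨mul_dvd_mul_left _ h1, mul_dvd_mul_left _ h2⟩
  exact ⟨eq_zero_of_forall_X_pow_dvd fun n => (key n p q h).1,
    eq_zero_of_forall_X_pow_dvd fun n => (key n p q h).2⟩

theorem normalFormLin_injective : Function.Injective normalFormLin := by
  rw [injective_iff_map_eq_zero]
  rintro ⟨p, q⟩ h
  exact Prod.ext (normalForm_eq_zero h).1 (normalForm_eq_zero h).2

/-! ### Existence of the normal form -/

theorem monA_mem_range (k : Fin 4 → ℕ) : monA k ∈ LinearMap.range normalFormLin := by
  refine ⟨(MvPolynomial.X 0 ^ k 0 * MvPolynomial.X 1 ^ k 1 * MvPolynomial.X 2 ^ k 2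
    * MvPolynomial.X 3 ^ k 3, 0), ?_⟩
  rw [normalFormLin_apply]
  simp [normalForm, monA]

theorem monB_mem_range (k : Fin 4 → ℕ) : monB k ∈ LinearMap.range normalFormLin := by
  refine ⟨(0, MvPolynomial.X 0 ^ k 0 * MvPolynomial.X 1 ^ k 1 * MvPolynomial.X 2 ^ k 2
    * MvPolynomial.X 3 ^ k 3), ?_⟩
  rw [normalFormLin_apply]
  simp [normalForm, monB]

/-- Each use of the syzygy lowers the exponents of `L3` and `L7` by one, until one of them is zero.
-/
theorem monomial_mem_range (a b c d e : ℕ) :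
    d1 0 ^ a * L3 ^ b * L5 ^ c * L7 ^ d * M8 ^ e ∈ LinearMap.range normalFormLin := by
  induction d generalizing a b c e with
  | zero => simpa [monA] using monA_mem_range ![a, b, c, e]
  | succ d ih =>
    cases b with
    | zero =>
      convert monB_mem_range ![a, c, d, e] using 1
      simp [monB]
      ring
    | succ b =>
      have h1 := ih a b (c + 2) e
      have h2 := ih (a + 2) b c (e + 1)
      have : d1 0 ^ a * L3 ^ (b + 1) * L5 ^ c * L7 ^ (d + 1) * M8 ^ e
          = (5 / 3 : ℂ) • (d1 0 ^ a * L3 ^ b * L5 ^ (c + 2) * L7 ^ d * M8 ^ e)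
            + (1 / 3 : ℂ) • (d1 0 ^ (a + 2) * L3 ^ b * L5 ^ c * L7 ^ d * M8 ^ (e + 1)) := by
        have h3 : (3 : ℂ) • (L3 * L7) = (5 : ℂ) • L5 ^ 2 + d1 0 ^ 2 * M8 := by
          rw [MvPolynomial.smul_eq_C_mul, MvPolynomial.smul_eq_C_mul]
          exact L3_mul_L7
        have h4 : L3 * L7 = (5 / 3 : ℂ) • L5 ^ 2 + (1 / 3 : ℂ) • (d1 0 ^ 2 * M8) := by
          have := congrArg (fun z => (1 / 3 : ℂ) • z) h3
          simp only [smul_add, smul_smul] at this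
          norm_num at this ⊢
          exact this
        calc _ = d1 0 ^ a * L3 ^ b * L5 ^ c * L7 ^ d * M8 ^ e * (L3 * L7) := by ring
          _ = _ := by
            rw [h4]
            simp only [MvPolynomial.smul_eq_C_mul]
            ring
      rw [this]
      exact Submodule.add_mem _ (Submodule.smul_mem _ _ h1) (Submodule.smul_mem _ _ h2)

/-- The jet of the graph `(t, g₂ t² / 2! + g₃ t³ / 3! + g₄ t⁴ / 4!)`. -/
def graphJet (g : Fin 3 → ℂ) : Fin 2 × Fin 4 → ℂ := fun p =>
  ![![1, 0, 0, 0], ![0, g 0, g 1, g 2]] p.1 p.2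

/-- The restriction of a jet polynomial to the jets of graphs. -/
def restrGraph : JetPoly 4 →ₐ[ℂ] MvPolynomial (Fin 3) ℂ :=
  MvPolynomial.aeval fun p =>
    ![![1, 0, 0, 0], ![0, MvPolynomial.X 0, MvPolynomial.X 1, MvPolynomial.X 2]] p.1 p.2

theorem eval_restrGraph (g : Fin 3 → ℂ) (P : JetPoly 4) :
    MvPolynomial.eval g (restrGraph P) = MvPolynomial.eval (graphJet g) P := by
  rw [restrGraph, MvPolynomial.aeval_def, MvPolynomial.eval_eval₂, MvPolynomial.eval,
    MvPolynomial.coe_eval₂Hom]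
  congr 1
  · ext x
    simp
  · funext ⟨i, l⟩
    fin_cases i <;> fin_cases l <;> simp [graphJet]

/-- The curve `(f₁, f₂)` is obtained from a graph with zero slope by reparametrizing with `f₁` and
then shearing with slope `f₂' / f₁'`. Neither operation affects a bi-invariant beyond the factor
`f₁'^m`, and the three remaining derivatives of the graph are the quotients displayed. -/
theorem eval_eq_of_ne_zero {m : ℕ} {P : JetPoly 4} (hP : IsBiInvariant 4 m P)
    (X : Fin 2 × Fin 4 → ℂ) (hX : X (0, 0) ≠ 0) :
    MvPolynomial.eval X P = X (0, 0) ^ m * MvPolynomial.eval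
      ![MvPolynomial.eval X L3 / X (0, 0) ^ 3, MvPolynomial.eval X L5 / X (0, 0) ^ 5,
        MvPolynomial.eval X L7 / X (0, 0) ^ 7] (restrGraph P) := by
  rw [eval_restrGraph, ← mem_invariants_iff.1 hP.1 (fun l => X (0, l)) _ hX]
  conv_rhs => rw [← hP.2 (X (1, 0) / X (0, 0)), eval_act_eq]
  congr 2
  funext ⟨i, l⟩
  fin_cases i <;> fin_cases l <;>
    simp [actPt, rep, graphJet, L3, L5, L7, jetDet, d1, d2] <;> field_simp <;> ring

theorem exists_normalForm {m : ℕ} {P : JetPoly 4} (hP : IsBiInvariant 4 m P) :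
    ∃ p q, P = normalForm p q := by
  have descend : ∀ (N : ℕ) (P : JetPoly 4), d1 0 ^ N * P ∈ LinearMap.range normalFormLin →
      ∃ p q, P = normalForm p q := by
    intro N
    induction N with
    | zero =>
      rintro P ⟨⟨p, q⟩, h⟩
      exact ⟨p, q, by simpa [normalFormLin_apply] using h.symm⟩
    | succ N ih =>
      rintro P ⟨⟨p, q⟩, h⟩
      rw [pow_succ', mul_assoc, normalFormLin_apply] at h
      obtain ⟨p', q', h'⟩ := exists_normalForm_of_d1_mul h.symm
      exact ih P ⟨(p', q'), h'.symm⟩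
  set R := restrGraph P with hR
  -- Any common bound for the orders of the poles along `f₁' = 0` would do; the sum is the simplest
  -- one.
  let N := ∑ k ∈ R.support, (3 * k 0 + 5 * k 1 + 7 * k 2)
  have hN : ∀ k ∈ R.support, 3 * k 0 + 5 * k 1 + 7 * k 2 ≤ N := fun k hk =>
    Finset.single_le_sum (f := fun k : Fin 3 →₀ ℕ => 3 * k 0 + 5 * k 1 + 7 * k 2)
      (fun _ _ => Nat.zero_le _) hk
  let Q : JetPoly 4 := ∑ k ∈ R.support, MvPolynomial.coeff k R •
    (d1 0 ^ (N + m - (3 * k 0 + 5 * k 1 + 7 * k 2)) * L3 ^ k 0 * L5 ^ k 1 * L7 ^ k 2 * M8 ^ 0)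
  refine descend N P ?_
  have hQ : d1 0 ^ N * P = Q := by
    -- The additional factor `f₁'` makes both sides vanish where `f₁' = 0`, so the identity only has
    -- to be checked where the quotients make sense.
    refine mul_left_cancel₀ (d1_ne_zero 0) (MvPolynomial.funext fun X => ?_)
    by_cases hX : X (0, 0) = 0
    · simp [d1, hX]
    · have hd : MvPolynomial.eval X (d1 0) = X (0, 0) := by simp [d1]
      rw [map_mul, map_mul, map_mul, map_pow, hd, eval_eq_of_ne_zero hP X hX, ← hR,
        MvPolynomial.eval_eq', map_sum, Finset.mul_sum, Finset.mul_sum]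
      congr 1
      refine Finset.sum_congr rfl fun k hk => ?_
      obtain ⟨r, hr⟩ := Nat.exists_eq_add_of_le (hN k hk)
      have : N + m - (3 * k 0 + 5 * k 1 + 7 * k 2) = r + m := by omega
      rw [this, hr, MvPolynomial.smul_eval]
      simp only [map_mul, map_pow, hd, Fin.prod_univ_three, Matrix.cons_val_zero,
        Matrix.cons_val_one, Matrix.cons_val, div_pow, pow_zero, pow_add, pow_mul, map_one]
      field_simp
  rw [hQ]
  exact Submodule.sum_mem _ fun k _ => Submodule.smul_mem _ _ (monomial_mem_range _ _ _ _ _)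

theorem existsUnique_normalForm {m : ℕ} {P : JetPoly 4} (hP : IsBiInvariant 4 m P) :
    ∃! pq : MvPolynomial (Fin 4) ℂ × MvPolynomial (Fin 4) ℂ, P = normalForm pq.1 pq.2 := by
  obtain ⟨p, q, h⟩ := exists_normalForm hP
  exact ⟨(p, q), h, fun pq h' => normalFormLin_injective (h'.symm.trans h)⟩

/-! ### Weights of the normal form -/

/-- Rescaling the jet variables rescales the generators by their weights. The factor `2 ^ 7` comes
from the isolated `L7` in front of the second polynomial. -/
theorem doubling_normalForm (p q : MvPolynomial (Fin 4) ℂ) : doubling (normalForm p q)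
    = normalForm (rescale 2 ![1, 3, 5, 8] p) ((2 : ℂ) ^ 7 • rescale 2 ![1, 5, 7, 8] q) := by
  have h1 := doubling_eq isBiInvariant_d1.1
  have h3 := doubling_eq isBiInvariant_L3.1
  have h5 := doubling_eq isBiInvariant_L5.1
  have h7 := doubling_eq isBiInvariant_L7.1
  have h8 := doubling_eq isBiInvariant_M8.1
  have e1 : doubling.comp (MvPolynomial.aeval ![d1 0, L3, L5, M8])
      = (MvPolynomial.aeval ![d1 0, L3, L5, M8]).comp (rescale 2 ![1, 3, 5, 8]) := by
    ext1 i
    fin_cases i <;> simp [rescale, h1, h3, h5, h8, MvPolynomial.smul_eq_C_mul]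
  have e2 : doubling.comp (MvPolynomial.aeval ![d1 0, L5, L7, M8])
      = (MvPolynomial.aeval ![d1 0, L5, L7, M8]).comp (rescale 2 ![1, 5, 7, 8]) := by
    ext1 i
    fin_cases i <;> simp [rescale, h1, h5, h7, h8, MvPolynomial.smul_eq_C_mul]
  have e1' := DFunLike.congr_fun e1 p
  have e2' := DFunLike.congr_fun e2 q
  simp only [AlgHom.comp_apply] at e1' e2'
  rw [normalForm, normalForm, map_add, map_mul, e1', e2', h7, map_smul, smul_mul_assoc,
    mul_smul_comm]

theorem isBiInvariant_normalForm_iff {m : ℕ} (p q : MvPolynomial (Fin 4) ℂ) :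
    IsBiInvariant 4 m (normalForm p q) ↔
      (∀ k ∈ p.support, k 0 + 3 * k 1 + 5 * k 2 + 8 * k 3 = m) ∧
      (∀ k ∈ q.support, 7 + k 0 + 5 * k 1 + 7 * k 2 + 8 * k 3 = m) := by
  constructor
  · intro h
    -- By uniqueness of the normal form, the eigenvalue equation for doubling can be compared
    -- coefficient by coefficient.
    have h2 := doubling_eq h.1
    rw [doubling_normalForm, ← normalFormLin_apply, ← normalFormLin_apply,
      ← normalFormLin.map_smul] at h2
    have h3 := normalFormLin_injective h2
    have hp := congrArg Prod.fst h3
    have hq := congrArg Prod.snd h3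
    simp only [Prod.smul_mk] at hp hq
    constructor
    · intro k hk
      have := congrArg (MvPolynomial.coeff k) hp
      rw [coeff_rescale, MvPolynomial.coeff_smul, smul_eq_mul] at this
      have := two_pow_injective (mul_right_cancel₀ (MvPolynomial.mem_support_iff.1 hk) this)
      simp [Finsupp.weight_apply, Finsupp.sum_fintype, Fin.sum_univ_four] at this
      omega
    · intro k hk
      have := congrArg (MvPolynomial.coeff k) hq
      rw [MvPolynomial.coeff_smul, coeff_rescale, MvPolynomial.coeff_smul, smul_eq_mul,
        smul_eq_mul, ← mul_assoc, ← pow_add] at this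
      have := two_pow_injective (mul_right_cancel₀ (MvPolynomial.mem_support_iff.1 hk) this)
      simp [Finsupp.weight_apply, Finsupp.sum_fintype, Fin.sum_univ_four] at this
      omega
  · rintro ⟨hp, hq⟩
    rw [normalForm_eq_sum]
    have hA : ∀ k ∈ p.support, IsBiInvariant 4 m (monA k) := fun k hk =>
      hp k hk ▸ isBiInvariant_monA k
    have hB : ∀ k ∈ q.support, IsBiInvariant 4 m (monB k) := fun k hk =>
      hq k hk ▸ isBiInvariant_monB k
    refine ⟨Submodule.add_mem _ (Submodule.sum_mem _ fun k hk => Submodule.smul_mem _ _ (hA k hk).1)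
      (Submodule.sum_mem _ fun k hk => Submodule.smul_mem _ _ (hB k hk).1), fun u => ?_⟩
    rw [map_add, map_sum, map_sum]
    congr 1 <;> refine Finset.sum_congr rfl fun k hk => ?_
    · rw [map_smul, (hA k hk).2]
    · rw [map_smul, (hB k hk).2]

/-! ### The apolar bilinear form -/

section Apolar

variable {κ : ℕ}

/-- The product of the factorials of the exponents. -/
def multiFactorial (d : Fin 2 × Fin κ →₀ ℕ) : ℂ := d.prod fun _ n => (n.factorial : ℂ)

theorem multiFactorial_add_single (d : Fin 2 × Fin κ →₀ ℕ) (p : Fin 2 × Fin κ) :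
    multiFactorial (d + Finsupp.single p 1) = (d p + 1) * multiFactorial d := by
  classical
  unfold multiFactorial
  rw [Finsupp.prod_fintype _ _ (by simp), Finsupp.prod_fintype _ _ (by simp),
    ← Finset.mul_prod_erase _ _ (Finset.mem_univ p), ← Finset.mul_prod_erase _ (fun _ => _)
    (Finset.mem_univ p), ← mul_assoc]
  congr 1
  · simp [Nat.factorial_succ]
  · refine Finset.prod_congr rfl fun q hq => ?_
    simp [(Finset.ne_of_mem_erase hq).symm]

/-- The bilinear form for which the monomials are orthogonal and multiplication by a variable is
adjoint to the derivation with respect to it. -/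
def apolar : JetPoly κ →ₗ[ℂ] JetPoly κ →ₗ[ℂ] ℂ :=
  (MvPolynomial.basisMonomials (Fin 2 × Fin κ) ℂ).constr ℂ fun d =>
    multiFactorial d • MvPolynomial.lcoeff ℂ d

theorem apolar_monomial (d : Fin 2 × Fin κ →₀ ℕ) (c : ℂ) (Q : JetPoly κ) :
    apolar (MvPolynomial.monomial d c) Q = c * (multiFactorial d * MvPolynomial.coeff d Q) := by
  have h : MvPolynomial.monomial d c = c • MvPolynomial.basisMonomials (Fin 2 × Fin κ) ℂ d := by
    simp [MvPolynomial.smul_monomial]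
  rw [h, map_smul, apolar, Module.Basis.constr_basis]
  simp

theorem apolar_eq_sum (P Q : JetPoly κ) : apolar P Q = ∑ d ∈ P.support,
    MvPolynomial.coeff d P * (multiFactorial d * MvPolynomial.coeff d Q) := by
  conv_lhs => rw [P.as_sum, map_sum, LinearMap.sum_apply]
  simp_rw [apolar_monomial]

theorem apolar_mul_X (P Q : JetPoly κ) (p : Fin 2 × Fin κ) :
    apolar (P * MvPolynomial.X p) Q = apolar P (MvPolynomial.pderiv p Q) := by
  induction P using MvPolynomial.induction_on' with
  | monomial d c =>
    rw [MvPolynomial.X, MvPolynomial.monomial_mul, apolar_monomial, apolar_monomial,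
      MvPolynomial.coeff_pderiv, multiFactorial_add_single]
    ring
  | add P P' h h' => rw [add_mul, map_add, map_add, LinearMap.add_apply, LinearMap.add_apply, h, h']

theorem act_X (W : Matrix (Fin 2) (Fin 2) ℂ) (p : Fin 2 × Fin κ) :
    act W (MvPolynomial.X p)
      = MvPolynomial.C (W p.1 0) * MvPolynomial.X (0, p.2)
        + MvPolynomial.C (W p.1 1) * MvPolynomial.X (1, p.2) := by
  simp [act]

theorem act_C (W : Matrix (Fin 2) (Fin 2) ℂ) (c : ℂ) :
    act (κ := κ) W (MvPolynomial.C c) = MvPolynomial.C c := by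
  simp [act]

theorem pderiv_act (W : Matrix (Fin 2) (Fin 2) ℂ) (P : JetPoly κ) (p : Fin 2 × Fin κ) :
    MvPolynomial.pderiv p (act W P)
      = MvPolynomial.C (W 0 p.1) * act W (MvPolynomial.pderiv (0, p.2) P)
        + MvPolynomial.C (W 1 p.1) * act W (MvPolynomial.pderiv (1, p.2) P) := by
  classical
  induction P using MvPolynomial.induction_on with
  | C c => simp
  | add P Q hP hQ => rw [map_add, map_add, hP, hQ]; simp only [map_add]; ring
  | mul_X P q hP =>
    rw [map_mul, Derivation.leibniz, Derivation.leibniz, Derivation.leibniz, hP]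
    simp only [smul_eq_mul, map_add, map_mul]
    have h : MvPolynomial.pderiv p (act W (MvPolynomial.X q))
        = MvPolynomial.C (W 0 p.1) * act W (MvPolynomial.pderiv (0, p.2) (MvPolynomial.X q))
        + MvPolynomial.C (W 1 p.1) * act W (MvPolynomial.pderiv (1, p.2) (MvPolynomial.X q)) := by
      obtain ⟨i, l⟩ := p
      obtain ⟨j, l'⟩ := q
      rw [act_X, map_add, MvPolynomial.pderiv_C_mul, MvPolynomial.pderiv_C_mul]
      simp only [MvPolynomial.pderiv_X, Pi.single_apply, Prod.mk.injEq]
      by_cases hl : l' = l <;> fin_cases i <;> fin_cases j <;> simp [hl]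
    rw [h]
    ring

theorem coeff_zero_act (W : Matrix (Fin 2) (Fin 2) ℂ) (P : JetPoly κ) :
    MvPolynomial.coeff 0 (act W P) = MvPolynomial.coeff 0 P := by
  simp only [← MvPolynomial.constantCoeff_eq]
  induction P using MvPolynomial.induction_on with
  | C c => simp
  | add P Q hP hQ => simp only [map_add, hP, hQ]
  | mul_X P q hP => simp [act_X]

/-- A variable and the corresponding derivation are adjoint. By the chain rule `pderiv_act` the
derivations transform by the transposed matrix, so induction on the degree of `P` gives the adjoint.
-/
theorem apolar_act (W : Matrix (Fin 2) (Fin 2) ℂ) (P Q : JetPoly κ) :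
    apolar P (act W Q) = apolar (act W.transpose P) Q := by
  induction P using MvPolynomial.induction_on generalizing Q with
  | C c =>
    rw [act_C, ← MvPolynomial.monomial_zero', apolar_monomial, apolar_monomial, coeff_zero_act]
  | add P P' h h' => simp only [map_add, LinearMap.add_apply, h, h']
  | mul_X P p h =>
    rw [apolar_mul_X, pderiv_act, ← MvPolynomial.smul_eq_C_mul, ← MvPolynomial.smul_eq_C_mul,
      map_add, map_smul, map_smul, h, h, map_mul, act_X, mul_add, mul_left_comm, mul_left_comm _
      (MvPolynomial.C _), ← MvPolynomial.smul_eq_C_mul, ← MvPolynomial.smul_eq_C_mul, map_add,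
      map_smul, map_smul, LinearMap.add_apply, LinearMap.smul_apply, LinearMap.smul_apply,
      apolar_mul_X, apolar_mul_X]
    rfl

/-- Complex conjugation of the coefficients. -/
def conjPoly : JetPoly κ →+* JetPoly κ := MvPolynomial.map (starRingEnd ℂ)

/-- Conjugating one argument turns the form into a sum of squared absolute values with positive
weights, the products of factorials. -/
theorem eq_zero_of_apolar_conj {P : JetPoly κ} (h : apolar (conjPoly P) P = 0) : P = 0 := by
  have hpos : ∀ d : Fin 2 × Fin κ →₀ ℕ, 0 < d.prod fun _ n => (n.factorial : ℝ) := fun d =>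
    Finset.prod_pos fun p _ => by positivity
  have hsum : apolar (conjPoly P) P = ((∑ d ∈ (conjPoly P).support,
      (d.prod fun _ n => (n.factorial : ℝ)) * ‖MvPolynomial.coeff d P‖ ^ 2 : ℝ) : ℂ) := by
    rw [apolar_eq_sum]
    push_cast
    refine Finset.sum_congr rfl fun d _ => ?_
    rw [conjPoly, MvPolynomial.coeff_map, ← Complex.conj_mul', multiFactorial, Finsupp.prod,
      Finsupp.prod]
    push_cast
    ring
  rw [hsum, Complex.ofReal_eq_zero, Finset.sum_eq_zero_iff_of_nonneg fun d _ =>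
    mul_nonneg (hpos d).le (sq_nonneg _)] at h
  ext d
  rw [MvPolynomial.coeff_zero]
  by_contra hd
  have hd' : d ∈ (conjPoly P).support := by
    rw [MvPolynomial.mem_support_iff, conjPoly, MvPolynomial.coeff_map]
    simpa using hd
  have := (mul_eq_zero.1 (h d hd')).resolve_left (hpos d).ne'
  exact hd (by simpa using this)

end Apolar

/-! ### Fixed vectors of unipotent groups -/

section Unipotent

variable {κ : ℕ}

theorem actPt_mul (W W' : Matrix (Fin 2) (Fin 2) ℂ) (X : Fin 2 × Fin κ → ℂ) :
    actPt (W * W') X = actPt W (actPt W' X) := by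
  funext p
  simp [actPt, Matrix.mul_apply]
  ring

theorem act_act (W W' : Matrix (Fin 2) (Fin 2) ℂ) (P : JetPoly κ) :
    act W (act W' P) = act (W' * W) P :=
  MvPolynomial.funext fun X => by simp only [eval_act_eq, actPt_mul]

theorem act_one (P : JetPoly κ) : act 1 P = P := by
  refine MvPolynomial.funext fun X => ?_
  rw [eval_act_eq]
  congr 2
  funext p
  simp only [actPt, Matrix.one_apply, ite_mul, one_mul, zero_mul, Finset.sum_ite_eq,
    Finset.mem_univ, if_true, Prod.mk.eta]

theorem act_unipotent_act_unipotent (s u : ℂ) (P : JetPoly κ) :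
    act !![1, 0; s, 1] (act !![1, 0; u, 1] P) = act !![1, 0; u + s, 1] P := by
  have h : (!![1, 0; u, 1] * !![1, 0; s, 1] : Matrix (Fin 2) (Fin 2) ℂ) = !![1, 0; u + s, 1] := by
    ext i j
    fin_cases i <;> fin_cases j <;> simp [Matrix.mul_apply]
  rw [act_act, h]

/-- A linear functional that kills `N` turns `p` into a complex polynomial function that is
identically zero. Its coefficients therefore vanish, and functionals separate points from `N`. This
substitutes for differentiating the group action. -/
theorem coeff_mem_of_forall_eval_mem {A : Type*} [CommRing A] [Algebra ℂ A] {p : Polynomial A}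
    {N : Submodule ℂ A} (h : ∀ u : ℂ, p.eval (algebraMap ℂ A u) ∈ N) (k : ℕ) : p.coeff k ∈ N := by
  by_contra hk
  obtain ⟨f, hf, hN⟩ := Submodule.exists_le_ker_of_notMem hk
  let q : Polynomial ℂ := ∑ j ∈ p.support, Polynomial.monomial j (f (p.coeff j))
  have hq : q = 0 := by
    refine Polynomial.funext fun u => ?_
    have h0 : f (p.eval (algebraMap ℂ A u)) = 0 := hN (h u)
    rw [Polynomial.eval_eq_sum, Polynomial.sum, map_sum] at h0
    rw [Polynomial.eval_zero, ← h0, Polynomial.eval_finsetSum]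
    refine Finset.sum_congr rfl fun j _ => ?_
    rw [Polynomial.eval_monomial, ← map_pow, mul_comm (p.coeff j), ← Algebra.smul_def, map_smul,
      smul_eq_mul, mul_comm]
  have hc : q.coeff k = f (p.coeff k) := by
    simp only [q, Polynomial.finsetSum_coeff, Polynomial.coeff_monomial]
    rw [Finset.sum_ite_eq']
    split_ifs with hks
    · rfl
    · rw [Polynomial.notMem_support_iff.1 hks, map_zero]
  exact hf (by rw [← hc, hq, Polynomial.coeff_zero])

theorem polynomial_eq_of_forall_eval {A : Type*} [CommRing A] [Algebra ℂ A] {p q : Polynomial A}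
    (h : ∀ u : ℂ, p.eval (algebraMap ℂ A u) = q.eval (algebraMap ℂ A u)) : p = q := by
  ext k
  have := coeff_mem_of_forall_eval_mem (p := p - q) (N := ⊥) (fun u => by simp [h u]) k
  rwa [Submodule.mem_bot, Polynomial.coeff_sub, sub_eq_zero] at this

/-- The action of the unipotent matrices `(1 0; u 1)` as a polynomial in `u`. -/
def unipotentPoly : JetPoly κ →ₐ[ℂ] Polynomial (JetPoly κ) :=
  MvPolynomial.aeval fun p => ![Polynomial.C (MvPolynomial.X (0, p.2)),
    Polynomial.C (MvPolynomial.X (1, p.2)) + Polynomial.X * Polynomial.C (MvPolynomial.X (0, p.2))]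
    p.1

theorem eval_unipotentPoly (u : ℂ) (P : JetPoly κ) :
    (unipotentPoly P).eval (MvPolynomial.C u) = act !![1, 0; u, 1] P := by
  induction P using MvPolynomial.induction_on with
  | C c =>
    have : unipotentPoly (κ := κ) (MvPolynomial.C c) = Polynomial.C (MvPolynomial.C c) := by
      simp [unipotentPoly]
    rw [this, Polynomial.eval_C, act_C]
  | add P Q hP hQ => rw [map_add, Polynomial.eval_add, hP, hQ, map_add]
  | mul_X P p hP =>
    rw [map_mul, Polynomial.eval_mul, hP, map_mul]
    congr 1
    obtain ⟨i, l⟩ := p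
    fin_cases i
    · simp [unipotentPoly, act_X]
    · simp [unipotentPoly, act_X]
      ring

/-- The orbit of `P` under the unipotent group is a polynomial in `u` with coefficients in `N`.
Acting once more by `s` shifts `u` to `u + s`, which does not change the leading coefficient; so
that coefficient is a nonzero fixed vector. -/
theorem exists_fixed_mem {N : Submodule ℂ (JetPoly κ)} (hN : N ≠ ⊥)
    (h : ∀ (u : ℂ), ∀ P ∈ N, act !![1, 0; u, 1] P ∈ N) :
    ∃ P ∈ N, P ≠ 0 ∧ ∀ u : ℂ, act !![1, 0; u, 1] P = P := by
  obtain ⟨P, hP, hP0⟩ := Submodule.exists_mem_ne_zero_of_ne_bot hN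
  set q := unipotentPoly P with hq
  have hq0 : q ≠ 0 := by
    intro h0
    have := eval_unipotentPoly 0 P
    rw [← hq, h0, Polynomial.eval_zero, ← Matrix.one_fin_two, act_one] at this
    exact hP0 this.symm
  refine ⟨q.leadingCoeff, coeff_mem_of_forall_eval_mem (p := q) (N := N) (fun u => ?_) _,
    Polynomial.leadingCoeff_ne_zero.2 hq0, fun s => ?_⟩
  · exact (eval_unipotentPoly u P) ▸ h u P hP
  · have key : q.map (act !![1, 0; s, 1]).toRingHom
        = Polynomial.taylor (MvPolynomial.C s) q := by
      refine polynomial_eq_of_forall_eval fun u => ?_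
      have h1 : (algebraMap ℂ (JetPoly κ)) u
          = (act !![1, 0; s, 1]).toRingHom (MvPolynomial.C u) := (act_C _ _).symm
      have h2 : (q.map (act !![1, 0; s, 1]).toRingHom).eval (algebraMap ℂ (JetPoly κ) u)
          = act !![1, 0; s, 1] (q.eval (MvPolynomial.C u)) := by
        rw [h1, Polynomial.eval_map_apply]
        rfl
      rw [h2, Polynomial.taylor_eval, MvPolynomial.algebraMap_eq, ← MvPolynomial.C_add,
        eval_unipotentPoly, eval_unipotentPoly, act_unipotent_act_unipotent]
    have := congrArg (fun r => Polynomial.coeff r q.natDegree) key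
    rw [Polynomial.coeff_taylor_natDegree, Polynomial.coeff_map] at this
    exact this

end Unipotent

/-! ### Covariants -/

/-- The generic linear combination `v₁ f₁^{(l + 1)} + v₂ f₂^{(l + 1)}`. -/
def covD (l : Fin 4) : MvPolynomial (Fin 2) (JetPoly 4) :=
  MvPolynomial.C (d1 l) * MvPolynomial.X 0 + MvPolynomial.C (d2 l) * MvPolynomial.X 1

/-- The covariant with leading coefficient `Λ⁵₁`. -/
def covL5 : MvPolynomial (Fin 2) (JetPoly 4) :=
  MvPolynomial.C (jetDet 0 2) * covD 0 + MvPolynomial.C (-3 * jetDet 0 1) * covD 1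

/-- The covariant with leading coefficient `Λ⁷₁₁`. -/
def covL7 : MvPolynomial (Fin 2) (JetPoly 4) :=
  MvPolynomial.C (jetDet 0 3 + 4 * jetDet 1 2) * (covD 0 * covD 0)
    + MvPolynomial.C (-10 * jetDet 0 2) * (covD 0 * covD 1)
    + MvPolynomial.C (15 * jetDet 0 1) * (covD 1 * covD 1)

/-- The bi-invariants attached to the indices. -/
def leading {m : ℕ} : IndexA m ⊕ IndexB m → JetPoly 4 :=
  Sum.elim (fun k => monA k.1) (fun k => monB k.1)

/-- The covariants attached to the indices. -/
def covariant {m : ℕ} : IndexA m ⊕ IndexB m → MvPolynomial (Fin 2) (JetPoly 4) :=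
  Sum.elim
    (fun k => covD 0 ^ k.1 0 * MvPolynomial.C (L3 ^ k.1 1) * covL5 ^ k.1 2
      * MvPolynomial.C (M8 ^ k.1 3))
    (fun k => covL7 * (covD 0 ^ k.1 0 * covL5 ^ k.1 1 * covL7 ^ k.1 2
      * MvPolynomial.C (M8 ^ k.1 3)))

/-- The degree `l₁ - l₂` attached to an index. -/
abbrev deg {m : ℕ} (i : IndexA m ⊕ IndexB m) : ℕ := (shape i).1 - (shape i).2

theorem isHomogeneous_covD (l : Fin 4) : (covD l).IsHomogeneous 1 := by
  simpa only [zero_add, covD] using (((MvPolynomial.isHomogeneous_C (Fin 2) (d1 l)).mul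
    (MvPolynomial.isHomogeneous_X (JetPoly 4) 0)).add ((MvPolynomial.isHomogeneous_C _ (d2 l)).mul
    (MvPolynomial.isHomogeneous_X _ 1)))

theorem isHomogeneous_covL5 : covL5.IsHomogeneous 1 := by
  simpa only [zero_add, covL5] using (((MvPolynomial.isHomogeneous_C (Fin 2) (jetDet 0 2)).mul
    (isHomogeneous_covD 0)).add ((MvPolynomial.isHomogeneous_C _ (-3 * jetDet 0 1)).mul
    (isHomogeneous_covD 1)))

theorem isHomogeneous_covL7 : covL7.IsHomogeneous 2 := by
  have h := fun i j => (isHomogeneous_covD i).mul (isHomogeneous_covD j)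
  simpa only [zero_add, covL7] using (((MvPolynomial.isHomogeneous_C (Fin 2) (jetDet 0 3 + 4 * jetDet 1 2)).mul
    (h 0 0)).add ((MvPolynomial.isHomogeneous_C _ (-10 * jetDet 0 2)).mul (h 0 1))).add
    ((MvPolynomial.isHomogeneous_C _ (15 * jetDet 0 1)).mul (h 1 1))

theorem isHomogeneous_covariant {m : ℕ} (i : IndexA m ⊕ IndexB m) :
    (covariant i).IsHomogeneous (deg i) := by
  rcases i with k | k
  · have := (((isHomogeneous_covD 0).pow (k.1 0)).mul
      (MvPolynomial.isHomogeneous_C (Fin 2) (L3 ^ k.1 1))).mul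
      (isHomogeneous_covL5.pow (k.1 2)) |>.mul (MvPolynomial.isHomogeneous_C (Fin 2) (M8 ^ k.1 3))
    have hd : deg (Sum.inl k : IndexA m ⊕ IndexB m) = 1 * k.1 0 + 0 + 1 * k.1 2 + 0 := by
      simp only [deg, shape]
      omega
    rw [hd]
    exact this
  · have := isHomogeneous_covL7.mul ((((isHomogeneous_covD 0).pow (k.1 0)).mul
      (isHomogeneous_covL5.pow (k.1 1))).mul
      (isHomogeneous_covL7.pow (k.1 2)) |>.mul (MvPolynomial.isHomogeneous_C (Fin 2) (M8 ^ k.1 3)))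
    have hd : deg (Sum.inr k : IndexA m ⊕ IndexB m)
        = 2 + (1 * k.1 0 + 1 * k.1 1 + 2 * k.1 2 + 0) := by
      simp only [deg, shape]
      omega
    rw [hd]
    exact this

/-- The value of a covariant at a vector. -/
def evalVec (v : C2) : MvPolynomial (Fin 2) (JetPoly 4) →+* JetPoly 4 :=
  MvPolynomial.eval fun j => MvPolynomial.C (v j)

theorem evalVec_C (v : C2) (P : JetPoly 4) : evalVec v (MvPolynomial.C P) = P := by
  simp [evalVec]

theorem evalVec_covD (v : C2) (l : Fin 4) :
    evalVec v (covD l) = d1 l * MvPolynomial.C (v 0) + d2 l * MvPolynomial.C (v 1) := by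
  simp [evalVec, covD]

theorem act_d1 (W : Matrix (Fin 2) (Fin 2) ℂ) (l : Fin 4) :
    act W (d1 l) = MvPolynomial.C (W 0 0) * d1 l + MvPolynomial.C (W 0 1) * d2 l := act_X W (0, l)

theorem act_d2 (W : Matrix (Fin 2) (Fin 2) ℂ) (l : Fin 4) :
    act W (d2 l) = MvPolynomial.C (W 1 0) * d1 l + MvPolynomial.C (W 1 1) * d2 l := act_X W (1, l)

theorem act_evalVec_covD (W : Matrix (Fin 2) (Fin 2) ℂ) (v : C2) (l : Fin 4) :
    act W (evalVec v (covD l)) = evalVec (Matrix.vecMul v W) (covD l) := by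
  simp only [evalVec_covD, map_add, map_mul, act_d1, act_d2, act_C, Matrix.vecMul, dotProduct,
    Fin.sum_univ_two]
  ring

theorem act_jetDet (W : Matrix (Fin 2) (Fin 2) ℂ) (α β : Fin 4) :
    act W (jetDet α β) = MvPolynomial.C W.det * jetDet α β := by
  simp only [jetDet, map_sub, map_mul, act_d1, act_d2, Matrix.det_fin_two]
  ring

theorem act_evalVec_covL5 (W : Matrix (Fin 2) (Fin 2) ℂ) (v : C2) :
    act W (evalVec v covL5) = MvPolynomial.C W.det * evalVec (Matrix.vecMul v W) covL5 := by
  simp only [covL5, map_add, map_mul, evalVec_C, act_evalVec_covD, act_jetDet, map_neg, map_ofNat]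
  ring

theorem act_evalVec_covL7 (W : Matrix (Fin 2) (Fin 2) ℂ) (v : C2) :
    act W (evalVec v covL7) = MvPolynomial.C W.det * evalVec (Matrix.vecMul v W) covL7 := by
  simp only [covL7, map_add, map_mul, evalVec_C, act_evalVec_covD, act_jetDet, map_neg, map_ofNat]
  ring

theorem act_L3 (W : Matrix (Fin 2) (Fin 2) ℂ) : act W L3 = MvPolynomial.C W.det * L3 :=
  act_jetDet W 0 1

theorem act_M8 (W : Matrix (Fin 2) (Fin 2) ℂ) : act W M8 = MvPolynomial.C W.det ^ 2 * M8 := by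
  simp only [M8, map_add, map_sub, map_mul, act_jetDet, map_ofNat]
  ring

/-- The covariance property: a substitution in the jet variables amounts to a substitution in `v`,
with one factor of the determinant for each jet determinant. -/
theorem act_evalVec_covariant {m : ℕ} (i : IndexA m ⊕ IndexB m) (W : Matrix (Fin 2) (Fin 2) ℂ)
    (v : C2) : act W (evalVec v (covariant i))
      = W.det ^ (shape i).2 • evalVec (Matrix.vecMul v W) (covariant i) := by
  rw [MvPolynomial.smul_eq_C_mul]
  rcases i with k | k <;>
  simp only [covariant, Sum.elim_inl, Sum.elim_inr, map_mul, map_pow, evalVec_C, act_evalVec_covD,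
    act_evalVec_covL5, act_evalVec_covL7, act_L3, act_M8, shape, mul_pow, pow_add, pow_mul,
    pow_one] <;> ring

theorem evalVec_covariant {m : ℕ} (i : IndexA m ⊕ IndexB m) :
    evalVec ![1, 0] (covariant i) = leading i := by
  have h : ∀ l, evalVec ![1, 0] (covD l) = d1 l := fun l => by simp [evalVec_covD]
  have h5 : evalVec ![1, 0] covL5 = L5 := by
    simp only [covL5, map_add, map_mul, evalVec_C, h, L5]
    ring
  have h7 : evalVec ![1, 0] covL7 = L7 := by
    simp only [covL7, map_add, map_mul, evalVec_C, h, L7]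
    ring
  rcases i with k | k <;>
  simp only [covariant, leading, Sum.elim_inl, Sum.elim_inr, map_mul, map_pow, evalVec_C, h, h5,
    h7, monA, monB]

/-- The coefficients of a covariant. -/
def covCoeff {m : ℕ} (i : IndexA m ⊕ IndexB m) (k : ℕ) : JetPoly 4 :=
  MvPolynomial.coeff (Finsupp.equivFunOnFinite.symm ![deg i - k, k]) (covariant i)

theorem eval_eq_sum_range_of_isHomogeneous {A : Type*} [CommRing A] {n : ℕ}
    {F : MvPolynomial (Fin 2) A} (hF : F.IsHomogeneous n) (x : Fin 2 → A) :
    MvPolynomial.eval x F = ∑ k ∈ Finset.range (n + 1),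
      x 0 ^ (n - k) * x 1 ^ k
        * MvPolynomial.coeff (Finsupp.equivFunOnFinite.symm ![n - k, k]) F := by
  classical
  have hinj : Set.InjOn (fun k => (Finsupp.equivFunOnFinite.symm ![n - k, k] : Fin 2 →₀ ℕ))
      (Finset.range (n + 1) : Set ℕ) := fun k _ l _ h =>
    congrFun (Finsupp.equivFunOnFinite.symm.injective h) 1
  have hsub : F.support ⊆ (Finset.range (n + 1)).image
      fun k => (Finsupp.equivFunOnFinite.symm ![n - k, k] : Fin 2 →₀ ℕ) := by
    intro d hd
    have hdeg : d.degree = n := by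
      rw [Finsupp.degree_eq_weight_one (R := ℕ)]
      exact hF (MvPolynomial.mem_support_iff.1 hd)
    rw [Finsupp.degree_eq_sum, Fin.sum_univ_two] at hdeg
    refine Finset.mem_image.2 ⟨d 1, Finset.mem_range.2 (by omega), ?_⟩
    ext j
    fin_cases j
    · simp
      omega
    · simp
  rw [MvPolynomial.eval_eq', Finset.sum_subset hsub, Finset.sum_image hinj]
  · refine Finset.sum_congr rfl fun k _ => ?_
    simp [Fin.prod_univ_two]
    ring
  · intro d _ hd
    rw [MvPolynomial.notMem_support_iff.1 hd, zero_mul]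

theorem evalVec_eq_sum {m : ℕ} (i : IndexA m ⊕ IndexB m) (v : C2) :
    evalVec v (covariant i) = ∑ k ∈ Finset.range (deg i + 1),
      (v 0 ^ (deg i - k) * v 1 ^ k) • covCoeff i k := by
  rw [evalVec, eval_eq_sum_range_of_isHomogeneous (isHomogeneous_covariant i)]
  refine Finset.sum_congr rfl fun k _ => ?_
  rw [MvPolynomial.smul_eq_C_mul, map_mul, map_pow, map_pow]
  rfl

theorem covCoeff_zero {m : ℕ} (i : IndexA m ⊕ IndexB m) : covCoeff i 0 = leading i := by
  rw [← evalVec_covariant, evalVec_eq_sum, Finset.sum_eq_single 0]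
  · simp
  · intro k _ hk
    simp [hk]
  · simp

/-! ### The bi-invariants of weight `m` -/

theorem isBiInvariant_leading {m : ℕ} (i : IndexA m ⊕ IndexB m) :
    IsBiInvariant 4 m (leading i) := by
  rcases i with k | k
  · have := isBiInvariant_monA k.1
    rwa [k.2] at this
  · have := isBiInvariant_monB k.1
    rwa [k.2] at this

theorem normalFormLin_inl (k : Fin 4 → ℕ) : normalFormLin (LinearMap.inl ℂ _ _
    (MvPolynomial.monomial (Finsupp.equivFunOnFinite.symm k) 1)) = monA k := by
  rw [LinearMap.inl_apply, normalFormLin_apply, normalForm_eq_sum,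
    MvPolynomial.support_monomial, if_neg one_ne_zero]
  simp

theorem normalFormLin_inr (k : Fin 4 → ℕ) : normalFormLin (LinearMap.inr ℂ _ _
    (MvPolynomial.monomial (Finsupp.equivFunOnFinite.symm k) 1)) = monB k := by
  rw [LinearMap.inr_apply, normalFormLin_apply, normalForm_eq_sum,
    MvPolynomial.support_monomial, if_neg one_ne_zero]
  simp

theorem linearIndependent_leading (m : ℕ) :
    LinearIndependent ℂ (leading : IndexA m ⊕ IndexB m → JetPoly 4) := by
  have hmon : ∀ (p : (Fin 4 → ℕ) → Prop), LinearIndependent ℂ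
      fun k : {k : Fin 4 → ℕ // p k} => (MvPolynomial.monomial
        (Finsupp.equivFunOnFinite.symm k.1) 1 : MvPolynomial (Fin 4) ℂ) := by
    intro p
    have := (MvPolynomial.basisMonomials (Fin 4) ℂ).linearIndependent.comp
      (fun k : {k : Fin 4 → ℕ // p k} => Finsupp.equivFunOnFinite.symm k.1)
      (Finsupp.equivFunOnFinite.symm.injective.comp Subtype.val_injective)
    rwa [MvPolynomial.coe_basisMonomials] at this
  have h := (linearIndependent_inl_union_inr' (hmon fun k => k 0 + 3 * k 1 + 5 * k 2 + 8 * k 3 = m)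
    (hmon fun k => 7 + k 0 + 5 * k 1 + 7 * k 2 + 8 * k 3 = m)).map' normalFormLin
      (LinearMap.ker_eq_bot.2 normalFormLin_injective)
  refine Eq.mp (congrArg (fun v => LinearIndependent ℂ v) (funext fun i => ?_)) h
  rcases i with k | k
  · exact normalFormLin_inl k.1
  · exact normalFormLin_inr k.1

theorem mem_span_leading {m : ℕ} {P : JetPoly 4} (hP : IsBiInvariant 4 m P) :
    P ∈ Submodule.span ℂ (Set.range (leading : IndexA m ⊕ IndexB m → JetPoly 4)) := by
  obtain ⟨p, q, rfl⟩ := exists_normalForm hP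
  obtain ⟨hp, hq⟩ := (isBiInvariant_normalForm_iff p q).1 hP
  rw [normalForm_eq_sum]
  exact Submodule.add_mem _
    (Submodule.sum_mem _ fun k hk => Submodule.smul_mem _ _
      (Submodule.subset_span ⟨Sum.inl ⟨k, hp k hk⟩, rfl⟩))
    (Submodule.sum_mem _ fun k hk => Submodule.smul_mem _ _
      (Submodule.subset_span ⟨Sum.inr ⟨k, hq k hk⟩, rfl⟩))

theorem conjPoly_leading {m : ℕ} (i : IndexA m ⊕ IndexB m) : conjPoly (leading i) = leading i := by
  have h1 : ∀ l, conjPoly (d1 l) = d1 l := fun l => by simp [conjPoly, d1]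
  have h2 : ∀ l, conjPoly (d2 l) = d2 l := fun l => by simp [conjPoly, d2]
  have hd : ∀ α β, conjPoly (jetDet α β) = jetDet α β := fun α β => by simp [jetDet, h1, h2]
  rcases i with k | k <;>
  simp only [leading, Sum.elim_inl, Sum.elim_inr, monA, monB, L3, L5, L7, M8, map_mul, map_pow,
    map_add, map_sub, hd, h1, map_ofNat]

/-- The vector `(1, s)` is the image of `(1, 0)` under a matrix of determinant one, so the value is
a translate of the leading bi-invariant. -/
theorem evalVec_covariant_mem {m : ℕ} (i : IndexA m ⊕ IndexB m) (s : ℂ) :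
    evalVec ![1, s] (covariant i) ∈ invariants 4 m := by
  have := act_mem !![1, s; 0, 1] (isBiInvariant_leading i).1
  rw [← evalVec_covariant, act_evalVec_covariant] at this
  simpa [Matrix.vecMul, dotProduct, Matrix.vec2_eq] using this

instance (m : ℕ) : Finite (IndexA m) :=
  Finite.of_injective (β := Fin 4 → Fin (m + 1))
    (fun k i => ⟨k.1 i, by
      have := k.2
      fin_cases i <;> simp <;> omega⟩)
    fun k l h => Subtype.ext (funext fun i => congrArg Fin.val (congrFun h i))

instance (m : ℕ) : Finite (IndexB m) :=
  Finite.of_injective (β := Fin 4 → Fin (m + 1))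
    (fun k i => ⟨k.1 i, by
      have := k.2
      fin_cases i <;> simp <;> omega⟩)
    fun k l h => Subtype.ext (funext fun i => congrArg Fin.val (congrFun h i))

/-! ### The coefficients of the covariants form a basis -/

instance (m : ℕ) : Fintype (IndexA m) := Fintype.ofFinite _

instance (m : ℕ) : Fintype (IndexB m) := Fintype.ofFinite _

theorem conjPoly_mem_span {m : ℕ} {Q : JetPoly 4}
    (hQ : Q ∈ Submodule.span ℂ (Set.range (leading : IndexA m ⊕ IndexB m → JetPoly 4))) :
    conjPoly Q ∈ Submodule.span ℂ (Set.range (leading : IndexA m ⊕ IndexB m → JetPoly 4)) := by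
  induction hQ using Submodule.span_induction with
  | mem x hx =>
    obtain ⟨i, rfl⟩ := hx
    rw [conjPoly_leading]
    exact Submodule.subset_span ⟨i, rfl⟩
  | zero => simp
  | add x y _ _ hx hy => rw [map_add]; exact Submodule.add_mem _ hx hy
  | smul c x _ hx =>
    have : conjPoly (c • x) = starRingEnd ℂ c • conjPoly x := by
      simp [conjPoly, MvPolynomial.smul_eq_C_mul]
    rw [this]
    exact Submodule.smul_mem _ _ hx

/-- The invariants orthogonal to all values of the covariants form a space `N` stable under
matrices. If `N` is nonzero, it contains a nonzero bi-invariant `Q`. The leading coefficients span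
the bi-invariants and have real coefficients, so the conjugate of `Q` lies in their span and is
orthogonal to `Q`, which contradicts positivity. -/
theorem eq_zero_of_apolar_covCoeff {m : ℕ} {P : JetPoly 4} (hP : P ∈ invariants 4 m)
    (h : ∀ (i : IndexA m ⊕ IndexB m) (k : ℕ), k ≤ deg i → apolar (covCoeff i k) P = 0) :
    P = 0 := by
  have hv : ∀ (i : IndexA m ⊕ IndexB m) (v : C2), apolar (evalVec v (covariant i)) P = 0 := by
    intro i v
    rw [evalVec_eq_sum, map_sum, LinearMap.sum_apply]
    refine Finset.sum_eq_zero fun k hk => ?_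
    rw [map_smul, LinearMap.smul_apply, h i k (Nat.lt_succ_iff.1 (Finset.mem_range.1 hk)),
      smul_zero]
  let N : Submodule ℂ (JetPoly 4) := invariants 4 m ⊓ ⨅ (i : IndexA m ⊕ IndexB m) (v : C2),
    LinearMap.ker (apolar (evalVec v (covariant i)))
  have hmem : ∀ Q, Q ∈ N ↔ Q ∈ invariants 4 m ∧
      ∀ (i : IndexA m ⊕ IndexB m) (v : C2), apolar (evalVec v (covariant i)) Q = 0 := by
    intro Q
    simp [N, Submodule.mem_iInf]
  by_contra hne
  have hN : N ≠ ⊥ := fun hN => hne ((Submodule.eq_bot_iff N).1 hN P ((hmem P).2 ⟨hP, hv⟩))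
  obtain ⟨Q, hQ, hQ0, hfix⟩ := exists_fixed_mem hN fun u Q hQ => by
    rw [hmem] at hQ ⊢
    refine ⟨act_mem _ hQ.1, fun i v => ?_⟩
    rw [apolar_act, act_evalVec_covariant, map_smul, LinearMap.smul_apply, hQ.2, smul_zero]
  rw [hmem] at hQ
  refine hQ0 (eq_zero_of_apolar_conj ?_)
  have hspan := mem_span_leading (m := m) ⟨hQ.1, hfix⟩
  have hle : Submodule.span ℂ (Set.range (leading : IndexA m ⊕ IndexB m → JetPoly 4))
      ≤ LinearMap.ker (apolar.flip Q) := by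
    rw [Submodule.span_le]
    rintro _ ⟨i, rfl⟩
    rw [← evalVec_covariant, SetLike.mem_coe, LinearMap.mem_ker, LinearMap.flip_apply]
    exact hQ.2 i _
  have := LinearMap.mem_ker.1 (hle (conjPoly_mem_span hspan))
  rwa [LinearMap.flip_apply] at this

theorem evalVec_one_eq_eval {m : ℕ} (i : IndexA m ⊕ IndexB m) (s : ℂ) :
    evalVec ![1, s] (covariant i) = (∑ k ∈ Finset.range (deg i + 1),
      Polynomial.monomial k (covCoeff i k)).eval (algebraMap ℂ (JetPoly 4) s) := by
  rw [evalVec_eq_sum, Polynomial.eval_finsetSum]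
  refine Finset.sum_congr rfl fun k _ => ?_
  rw [Polynomial.eval_monomial, ← map_pow, mul_comm (covCoeff i k), ← Algebra.smul_def]
  simp

theorem covCoeff_mem {m : ℕ} (i : IndexA m ⊕ IndexB m) {k : ℕ} (hk : k ≤ deg i) :
    covCoeff i k ∈ invariants 4 m := by
  have := coeff_mem_of_forall_eval_mem (fun s => evalVec_one_eq_eval i s ▸
    evalVec_covariant_mem i s) k
  simpa [Polynomial.finsetSum_coeff, Polynomial.coeff_monomial, Nat.lt_succ_iff, hk] using this

theorem coeff_one_add_C_mul_X_pow {A : Type*} [CommRing A] (a : A) (n k : ℕ) :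
    ((1 + Polynomial.C a * Polynomial.X) ^ n).coeff k = n.choose k * a ^ k := by
  have : (1 + Polynomial.C a * Polynomial.X) ^ n
      = ((Polynomial.X + 1) ^ n).comp (Polynomial.C a * Polynomial.X) := by
    simp [add_comm]
  rw [this, Polynomial.comp_C_mul_X_coeff, Polynomial.coeff_X_add_one_pow]

/-- The matrix sends the covariant at `(1, s)` to the covariant at `(1 + s u, s)`; compare the
coefficients of `s ^ k`. -/
theorem act_covCoeff {m : ℕ} (i : IndexA m ⊕ IndexB m) {k : ℕ} (hk : k ≤ deg i) (u : ℂ) :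
    act !![1, 0; u, 1] (covCoeff i k) = ∑ j ∈ Finset.range (k + 1),
      (u ^ (k - j) * (deg i - j).choose (k - j)) • covCoeff i j := by
  have key : ∑ k ∈ Finset.range (deg i + 1),
        Polynomial.monomial k (act !![1, 0; u, 1] (covCoeff i k))
      = ∑ j ∈ Finset.range (deg i + 1), Polynomial.C (covCoeff i j) * (Polynomial.X ^ j
        * (1 + Polynomial.C (algebraMap ℂ (JetPoly 4) u) * Polynomial.X) ^ (deg i - j)) := by
    refine polynomial_eq_of_forall_eval fun s => ?_
    have h1 : act !![1, 0; u, 1] (evalVec ![1, s] (covariant i))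
        = evalVec ![1 + s * u, s] (covariant i) := by
      rw [act_evalVec_covariant]
      simp [Matrix.vec2_eq]
    rw [evalVec_eq_sum, evalVec_eq_sum, map_sum] at h1
    rw [Polynomial.eval_finsetSum, Polynomial.eval_finsetSum]
    convert h1 using 1
    · refine Finset.sum_congr rfl fun k _ => ?_
      rw [Polynomial.eval_monomial, map_smul, ← map_pow, mul_comm _ (algebraMap _ _ _), ← Algebra.smul_def]
      simp
    · refine Finset.sum_congr rfl fun k _ => ?_
      rw [Algebra.smul_def]
      simp
      ring
  have hc := congrArg (fun p => Polynomial.coeff p k) key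
  simp only [Polynomial.finsetSum_coeff, Polynomial.coeff_monomial, Polynomial.coeff_C_mul,
    Polynomial.coeff_X_pow_mul', coeff_one_add_C_mul_X_pow] at hc
  rw [Finset.sum_ite_eq', if_pos (Finset.mem_range.2 (Nat.lt_succ_of_le hk))] at hc
  rw [hc, ← Finset.sum_subset (Finset.range_mono (Nat.succ_le_succ hk))]
  · refine Finset.sum_congr rfl fun j hj => ?_
    rw [if_pos (Nat.lt_succ_iff.1 (Finset.mem_range.1 hj)), Algebra.smul_def]
    simp
    ring
  · intro j _ hj
    rw [if_neg (fun h => hj (Finset.mem_range.2 (Nat.lt_succ_of_le h))), mul_zero]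

/-- Independence of the coefficients reduces to that of the leading ones, eliminating the highest
level `k` first. Apply the unipotent group to a relation with levels at most `n`: the coefficient of
`u ^ n` only sees the terms that fall from level `n` to level 0. -/
theorem eq_zero_of_sum_covCoeff {m : ℕ} (n : ℕ) (c : IndexA m ⊕ IndexB m → ℕ → ℂ)
    (hc : ∀ i k, n ≤ k → c i k = 0)
    (h : ∑ i, ∑ k ∈ Finset.range (deg i + 1), c i k • covCoeff i k = 0) :
    ∀ i k, k ≤ deg i → c i k = 0 := by
  induction n generalizing c with
  | zero => exact fun i k _ => hc i k (Nat.zero_le _)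
  | succ n ih =>
    let q : Polynomial (JetPoly 4) := ∑ i, ∑ k ∈ Finset.range (deg i + 1),
      ∑ j ∈ Finset.range (k + 1), Polynomial.monomial (k - j)
        ((c i k * (deg i - j).choose (k - j)) • covCoeff i j)
    have hq : q = 0 := by
      refine polynomial_eq_of_forall_eval fun u => ?_
      have hu := congrArg (act !![1, 0; u, 1]) h
      rw [map_zero, map_sum] at hu
      rw [Polynomial.eval_zero, ← hu, Polynomial.eval_finsetSum]
      refine Finset.sum_congr rfl fun i _ => ?_
      rw [map_sum, Polynomial.eval_finsetSum]
      refine Finset.sum_congr rfl fun k hk => ?_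
      rw [map_smul, act_covCoeff i (Nat.lt_succ_iff.1 (Finset.mem_range.1 hk)),
        Polynomial.eval_finsetSum, Finset.smul_sum]
      refine Finset.sum_congr rfl fun j _ => ?_
      rw [Polynomial.eval_monomial, ← map_pow, mul_comm _ (algebraMap _ _ _), ← Algebra.smul_def, smul_smul, smul_smul]
      congr 1
      ring
    -- In the coefficient of `u ^ n` one needs `k - j = n`; since levels above `n` carry no
    -- coefficient, only `k = n`, `j = 0` survives.
    have hlead : ∑ i : IndexA m ⊕ IndexB m,
        (if n ≤ deg i then c i n * (deg i).choose n else 0) • leading i = 0 := by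
      have := congrArg (fun p => Polynomial.coeff p n) hq
      simp only [q, Polynomial.finsetSum_coeff, Polynomial.coeff_monomial,
        Polynomial.coeff_zero] at this
      rw [← this]
      refine Finset.sum_congr rfl fun i _ => ?_
      symm
      have hz : ∀ k ∈ Finset.range (deg i + 1), k ≠ n → (∑ j ∈ Finset.range (k + 1),
          if k - j = n then (c i k * ((deg i - j).choose (k - j) : ℂ)) • covCoeff i j else 0) = 0 := by
        intro k _ hkn
        refine Finset.sum_eq_zero fun j _ => ?_
        split_ifs with hj
        · rw [hc i k (by omega), zero_mul, zero_smul]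
        · rfl
      split_ifs with hn
      · rw [Finset.sum_eq_single_of_mem n (Finset.mem_range.2 (Nat.lt_succ_of_le hn)) hz,
          Finset.sum_eq_single_of_mem 0 (Finset.mem_range.2 (Nat.succ_pos _))]
        · simp [covCoeff_zero]
        · intro j hj hj0
          rw [if_neg]
          have := Finset.mem_range.1 hj
          omega
      · rw [zero_smul]
        refine Finset.sum_eq_zero fun k hk => hz k hk ?_
        have := Finset.mem_range.1 hk
        omega
    have hn := Fintype.linearIndependent_iff.1 (linearIndependent_leading m) _ hlead
    have hn' : ∀ i, n ≤ deg i → c i n = 0 := by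
      intro i hi
      have := hn i
      rw [if_pos hi] at this
      refine (mul_eq_zero.1 this).resolve_right ?_
      exact_mod_cast (Nat.choose_pos hi).ne'
    have hge : ∀ i k, k ≤ deg i → n ≤ k → c i k = 0 := by
      intro i k hk hnk
      rcases hnk.eq_or_lt with rfl | hlt
      · exact hn' i hk
      · exact hc i k hlt
    have := ih (fun i k => if n ≤ k then 0 else c i k) (fun i k hk => if_pos hk) (by
      rw [← h]
      refine Finset.sum_congr rfl fun i _ => Finset.sum_congr rfl fun k hk => ?_
      congr 1
      split_ifs with hk'
      · exact (hge i k (Nat.lt_succ_iff.1 (Finset.mem_range.1 hk)) hk').symm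
      · rfl)
    intro i k hk
    by_cases hnk : n ≤ k
    · exact hge i k hk hnk
    · simpa [hnk] using this i k hk

/-- Pairing of an invariant with the coefficients of the covariants. -/
def pairing (m : ℕ) :
    invariants 4 m →ₗ[ℂ] ∀ i : IndexA m ⊕ IndexB m, Fin (deg i + 1) → ℂ :=
  LinearMap.pi fun i => LinearMap.pi fun k =>
    apolar (covCoeff i k) ∘ₗ (invariants 4 m).subtype

theorem pairing_injective (m : ℕ) : Function.Injective (pairing m) := by
  rw [injective_iff_map_eq_zero]
  intro P hP
  exact Subtype.ext (eq_zero_of_apolar_covCoeff P.2 fun i k hk =>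
    congrFun (congrFun hP i) ⟨k, Nat.lt_succ_of_le hk⟩)

/-- Injectivity bounds the dimension of the invariants above by the number of coefficients of
covariants. These are independent invariants, which gives the opposite bound. -/
theorem pairing_bijective (m : ℕ) : Function.Bijective (pairing m) := by
  refine ⟨pairing_injective m, ?_⟩
  have hfin : FiniteDimensional ℂ (invariants 4 m) :=
    FiniteDimensional.of_injective _ (pairing_injective m)
  let Y : (Σ i : IndexA m ⊕ IndexB m, Fin (deg i + 1)) → invariants 4 m :=
    fun q => ⟨covCoeff q.1 q.2, covCoeff_mem q.1 (Nat.lt_succ_iff.1 q.2.2)⟩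
  have hY : LinearIndependent ℂ Y := by
    rw [Fintype.linearIndependent_iff]
    intro g hg
    let c : IndexA m ⊕ IndexB m → ℕ → ℂ :=
      fun i k => if hk : k < deg i + 1 then g ⟨i, ⟨k, hk⟩⟩ else 0
    have hsum : ∑ i, ∑ k ∈ Finset.range (deg i + 1), c i k • covCoeff i k = 0 := by
      have := congrArg Subtype.val hg
      rw [Fintype.sum_sigma] at this
      simp only [AddSubmonoidClass.coe_finsetSum, Submodule.coe_smul, Submodule.coe_zero, Y] at this
      rw [← this]
      refine Finset.sum_congr rfl fun i _ => ?_
      rw [Finset.sum_range]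
      refine Finset.sum_congr rfl fun k _ => ?_
      rw [show c i k = g ⟨i, k⟩ from dif_pos k.2]
    -- A level beyond all degrees, from which the elimination starts.
    let n := ∑ i : IndexA m ⊕ IndexB m, (deg i + 1)
    have h0 := eq_zero_of_sum_covCoeff n c (fun i k hk => dif_neg fun hlt => by
      have : deg i + 1 ≤ n := Finset.single_le_sum (f := fun i : IndexA m ⊕ IndexB m => deg i + 1)
        (fun _ _ => Nat.zero_le _) (Finset.mem_univ i)
      omega) hsum
    rintro ⟨i, k⟩
    exact (dif_pos k.2 : c i k = g ⟨i, k⟩).symm.trans (h0 i k (Nat.lt_succ_iff.1 k.2))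
  have h1 := hY.fintype_card_le_finrank
  have h2 := LinearMap.finrank_le_finrank_of_injective (pairing_injective m)
  have h3 : Module.finrank ℂ (∀ i : IndexA m ⊕ IndexB m, Fin (deg i + 1) → ℂ)
      = Fintype.card (Σ i : IndexA m ⊕ IndexB m, Fin (deg i + 1)) := by
    rw [Module.finrank_pi_fintype, Fintype.card_sigma]
    simp
  exact (LinearMap.injective_iff_surjective_of_finrank_eq_finrank
    (le_antisymm h2 (h3 ▸ h1))).1 (pairing_injective m)

/-! ### Coordinates on the Schur powers -/

/-- The area form on `ℂ²`. -/
def area (u₁ u₂ : C2) : ℂ := u₁ 0 * u₂ 1 - u₁ 1 * u₂ 0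

theorem area_mulVec (W : Matrix (Fin 2) (Fin 2) ℂ) (u₁ u₂ : C2) :
    area (W.mulVec u₁) (W.mulVec u₂) = W.det * area u₁ u₂ := by
  simp only [area, Matrix.mulVec, dotProduct, Fin.sum_univ_two, Matrix.det_fin_two]
  ring

theorem alternating_eq (η : C2 [⋀^Fin 2]→ₗ[ℂ] ℂ) :
    ∃ c : ℂ, ∀ u₁ u₂ : C2, η ![u₁, u₂] = c * area u₁ u₂ := by
  refine ⟨η (Pi.basisFun ℂ (Fin 2)), fun u₁ u₂ => ?_⟩
  conv_lhs => rw [η.eq_smul_basis_det (Pi.basisFun ℂ (Fin 2))]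
  rw [AlternatingMap.smul_apply, Pi.basisFun_det_apply, Matrix.det_fin_two, smul_eq_mul]
  simp [area]

/-- The element of the Schur power with given coefficients. -/
def schurFun (l : ℕ × ℕ) : (Fin (l.1 - l.2 + 1) → ℂ) →ₗ[ℂ] (C2 → C2 → C2 → ℂ) where
  toFun c := fun v u₁ u₂ =>
    (∑ k, c k * (v 0 ^ (l.1 - l.2 - k.val) * v 1 ^ k.val)) * area u₁ u₂ ^ l.2
  map_add' c c' := by
    funext v u₁ u₂
    simp [add_mul, Finset.sum_add_distrib]
  map_smul' c c' := by
    funext v u₁ u₂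
    simp [mul_assoc, Finset.mul_sum, Finset.sum_mul]

theorem schurFun_apply (l : ℕ × ℕ) (c : Fin (l.1 - l.2 + 1) → ℂ) (v u₁ u₂ : C2) :
    schurFun l c v u₁ u₂
      = (∑ k, c k * (v 0 ^ (l.1 - l.2 - k.val) * v 1 ^ k.val)) * area u₁ u₂ ^ l.2 := rfl

theorem schurFun_injective (l : ℕ × ℕ) : Function.Injective (schurFun l) := by
  rw [injective_iff_map_eq_zero]
  intro c hc
  have h : (∑ k : Fin (l.1 - l.2 + 1), Polynomial.monomial k.val (c k)) = 0 := by
    refine Polynomial.funext fun s => ?_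
    -- The area of the standard basis is one, so only the dehomogenized binary form remains.
    have := congrFun (congrFun (congrFun hc ![1, s]) ![1, 0]) ![0, 1]
    rw [schurFun_apply] at this
    simpa [Polynomial.eval_finsetSum, area] using this
  funext k
  have hk := congrArg (fun p => Polynomial.coeff p k.val) h
  simp only [Polynomial.finsetSum_coeff, Polynomial.coeff_monomial, Polynomial.coeff_zero,
    Fin.val_inj] at hk
  rwa [Finset.sum_ite_eq' Finset.univ k, if_pos (Finset.mem_univ _)] at hk

theorem monomial_mem_range_schurFun (l : ℕ × ℕ) {a b : ℕ} (h : a + b = l.1 - l.2) :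
    (fun v u₁ u₂ => v 0 ^ a * v 1 ^ b * area u₁ u₂ ^ l.2 : C2 → C2 → C2 → ℂ)
      ∈ LinearMap.range (schurFun l) := by
  refine ⟨Pi.single ⟨b, by omega⟩ 1, ?_⟩
  funext v u₁ u₂
  rw [schurFun_apply, Finset.sum_eq_single ⟨b, by omega⟩]
  · simp [← h]
  · intro k _ hk
    simp [hk]
  · simp

theorem range_schurFun (l : ℕ × ℕ) : LinearMap.range (schurFun l) = Schur C2 l := by
  apply le_antisymm
  · rintro _ ⟨c, rfl⟩
    have hs : schurFun l c = ∑ k, c k • (fun v u₁ u₂ =>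
        (v 0 ^ (l.1 - l.2 - k.val) * v 1 ^ k.val) * area u₁ u₂ ^ l.2 : C2 → C2 → C2 → ℂ) := by
      funext v u₁ u₂
      simp [schurFun_apply, Finset.sum_apply, Finset.sum_mul, mul_assoc]
    rw [hs]
    refine Submodule.sum_mem _ fun k _ => Submodule.smul_mem _ _ (Submodule.subset_span ?_)
    refine ⟨fun i => if i.val < l.1 - l.2 - k.val then LinearMap.proj 0 else LinearMap.proj 1,
      fun _ => Matrix.detRowAlternating, ?_⟩
    funext v u₁ u₂
    congr 1
    · have hite : ∀ i : Fin (l.1 - l.2), ((if i.val < l.1 - l.2 - k.val then LinearMap.proj 0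
          else LinearMap.proj 1 : C2 →ₗ[ℂ] ℂ) v) = if i.val < l.1 - l.2 - k.val then v 0 else v 1 := by
        intro i
        split_ifs <;> rfl
      have hk := Nat.lt_succ_iff.1 k.2
      simp only [hite]
      rw [← Finset.prod_range (n := l.1 - l.2) (f := fun i => if i < l.1 - l.2 - k.val then v 0
        else v 1), Finset.prod_ite, Finset.prod_const, Finset.prod_const]
      have h1 : (Finset.range (l.1 - l.2)).filter (fun i => i < l.1 - l.2 - k.val)
          = Finset.range (l.1 - l.2 - k.val) := by
        ext i
        simp
        omega
      have h2 := Finset.card_filter_add_card_filter_not (s := Finset.range (l.1 - l.2))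
        (fun i => i < l.1 - l.2 - k.val)
      rw [h1, Finset.card_range, Finset.card_range] at h2
      rw [h1, Finset.card_range]
      congr 2
      omega
    · have hdet : Matrix.detRowAlternating ![u₁, u₂] = area u₁ u₂ := by
        exact (Matrix.det_fin_two (Matrix.of ![u₁, u₂])).trans (by simp [area])
      simp [hdet]
  · refine Submodule.span_le.2 ?_
    rintro F ⟨α, η, rfl⟩
    choose c hc using fun j => alternating_eq (η j)
    obtain ⟨a, b, hα⟩ : ∃ a b : Fin (l.1 - l.2) → ℂ, ∀ i (v : C2),
        α i v = a i * v 0 + b i * v 1 := by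
      refine ⟨fun i => α i (Pi.single 0 1), fun i => α i (Pi.single 1 1), fun i v => ?_⟩
      conv_lhs => rw [LinearMap.pi_apply_eq_sum_univ (α i) v, Fin.sum_univ_two]
      simp only [smul_eq_mul]
      rw [mul_comm, mul_comm (v 1)]
      congr 3 <;> · funext j; fin_cases j <;> rfl
    -- Expanding the product of linear forms: the subset `t` records the factors that contribute `v
    -- 0`.
    have hF : (fun v u₁ u₂ => (∏ i, α i v) * ∏ j, η j ![u₁, u₂] : C2 → C2 → C2 → ℂ)
        = ∑ t ∈ (Finset.univ : Finset (Fin (l.1 - l.2))).powerset,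
          ((∏ i ∈ t, a i) * (∏ i ∈ Finset.univ \ t, b i) * ∏ j, c j)
          • (fun v u₁ u₂ => v 0 ^ t.card * v 1 ^ (Finset.univ \ t).card * area u₁ u₂ ^ l.2 :
            C2 → C2 → C2 → ℂ) := by
      funext v u₁ u₂
      simp only [hα, hc, Finset.prod_add, Finset.sum_apply, Pi.smul_apply, smul_eq_mul,
        Finset.prod_mul_distrib, Finset.prod_const, Finset.sum_mul, Finset.card_univ,
        Fintype.card_fin]
      refine Finset.sum_congr rfl fun t _ => ?_
      ring
    rw [hF]
    refine Submodule.sum_mem _ fun t _ => Submodule.smul_mem _ _ (monomial_mem_range_schurFun l ?_)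
    rw [add_comm, Finset.card_sdiff_add_card_eq_card (Finset.subset_univ t), Finset.card_univ,
      Fintype.card_fin]

/-- Coordinates on the Schur powers of `ℂ²`. -/
def schurEquiv (l : ℕ × ℕ) : (Fin (l.1 - l.2 + 1) → ℂ) ≃ₗ[ℂ] Schur C2 l :=
  (LinearEquiv.ofInjective (schurFun l) (schurFun_injective l)).trans
    (LinearEquiv.ofEq _ _ (range_schurFun l))

/-! ### The decomposition of the space of invariants -/

/-- The decomposition of the space of invariants into Schur powers. -/
def decomp (m : ℕ) : invariants 4 m ≃ₗ[ℂ]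
    ∀ i : IndexA m ⊕ IndexB m, Schur C2 (shape i) :=
  (LinearEquiv.ofBijective (pairing m) (pairing_bijective m)).trans
    (LinearEquiv.piCongrRight fun i => schurEquiv (shape i))

theorem decomp_apply {m : ℕ} (P : invariants 4 m) (i : IndexA m ⊕ IndexB m) (v u₁ u₂ : C2) :
    (decomp m P i).1 v u₁ u₂
      = apolar (evalVec v (covariant i)) P.1 * area u₁ u₂ ^ (shape i).2 := by
  change schurFun (shape i) (pairing m P i) v u₁ u₂ = _
  rw [schurFun_apply, evalVec_eq_sum, map_sum, LinearMap.sum_apply, Finset.sum_range]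
  congr 1
  refine Finset.sum_congr rfl fun k _ => ?_
  rw [map_smul, LinearMap.smul_apply, smul_eq_mul, mul_comm]
  rfl

/-- The adjoint of the action is the action of the transpose, and `vecMul` by the transpose is
`mulVec` by `W`. The power of the determinant left over is absorbed by the area factor. -/
theorem decomp_act {m : ℕ} (W : Matrix (Fin 2) (Fin 2) ℂ) (P : invariants 4 m)
    (i : IndexA m ⊕ IndexB m) (v u₁ u₂ : C2) :
    (decomp m ⟨act W P.1, act_mem W P.2⟩ i).1 v u₁ u₂
      = (decomp m P i).1 (W.mulVec v) (W.mulVec u₁) (W.mulVec u₂) := by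
  rw [decomp_apply, decomp_apply, apolar_act, act_evalVec_covariant, map_smul,
    LinearMap.smul_apply, area_mulVec, Matrix.vecMul_transpose, Matrix.det_transpose, smul_eq_mul]
  ring

theorem exists_decomposition (m : ℕ) :
    ∃ S : invariants 4 m ≃ₗ[ℂ] ⨁ i : IndexA m ⊕ IndexB m, Schur C2 (shape i),
      ∀ (W : GL (Fin 2) ℂ) (P : invariants 4 m) (i : IndexA m ⊕ IndexB m) (v u₁ u₂ : C2),
        (S ⟨act W.1 P.1, act_mem W.1 P.2⟩ i).1 v u₁ u₂
          = (S P i).1 (W.1.mulVec v) (W.1.mulVec u₁) (W.1.mulVec u₂) := by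
  refine ⟨(decomp m).trans (DirectSum.linearEquivFunOnFintype ℂ (IndexA m ⊕ IndexB m)
    fun i => Schur C2 (shape i)).symm, fun W P i v u₁ u₂ => ?_⟩
  have h : ∀ (Q : invariants 4 m), (((decomp m).trans (DirectSum.linearEquivFunOnFintype ℂ
      (IndexA m ⊕ IndexB m) fun i => Schur C2 (shape i)).symm) Q) i = decomp m Q i := by
    intro Q
    rw [LinearEquiv.trans_apply]
    exact congrFun ((DirectSum.linearEquivFunOnFintype ℂ (IndexA m ⊕ IndexB m)
      fun i => Schur C2 (shape i)).apply_symm_apply (decomp m Q)) i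
  rw [h, h, decomp_act]

/-! ### Change of coordinates in jet polynomials -/

section Filtration

variable {κ : ℕ}

/-- The ideal generated by the jet variables. -/
abbrev jetIdeal (κ : ℕ) : Ideal (JetPoly κ) := MvPolynomial.idealOfVars (Fin 2 × Fin κ) ℂ

theorem X_mem_jetIdeal (p : Fin 2 × Fin κ) : (MvPolynomial.X p : JetPoly κ) ∈ jetIdeal κ :=
  Ideal.subset_span ⟨p, rfl⟩

theorem mem_invariantsOfOrder_iff {m p : ℕ} {P : JetPoly κ} :
    P ∈ invariantsOfOrder κ m p ↔ P ∈ invariants κ m ∧ P ∈ jetIdeal κ ^ p := by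
  rw [MvPolynomial.mem_pow_idealOfVars_iff]
  rfl

theorem algHom_mem_pow {g : JetPoly κ →ₐ[ℂ] JetPoly κ}
    (hg : ∀ p, g (MvPolynomial.X p) ∈ jetIdeal κ) {n : ℕ} {P : JetPoly κ}
    (hP : P ∈ jetIdeal κ ^ n) : g P ∈ jetIdeal κ ^ n := by
  have hle : (jetIdeal κ).map g ≤ jetIdeal κ := by
    refine Ideal.map_le_iff_le_comap.2 (Ideal.span_le.2 ?_)
    rintro _ ⟨p, rfl⟩
    exact hg p
  have := Ideal.mem_map_of_mem g hP
  rw [Ideal.map_pow] at this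
  exact Ideal.pow_right_mono hle n this

/-- Two substitutions with the same linear part induce the same map on the associated graded ring.
The products are handled by `g a g b - h a h b = (g a - h a) g b + h a (g b - h b)`. -/
theorem algHom_sub_mem_pow {g h : JetPoly κ →ₐ[ℂ] JetPoly κ}
    (hh : ∀ p, h (MvPolynomial.X p) ∈ jetIdeal κ)
    (hgh : ∀ p, g (MvPolynomial.X p) - h (MvPolynomial.X p) ∈ jetIdeal κ ^ 2) {n : ℕ}
    {P : JetPoly κ} (hP : P ∈ jetIdeal κ ^ n) : g P - h P ∈ jetIdeal κ ^ (n + 1) := by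
  have hg : ∀ p, g (MvPolynomial.X p) ∈ jetIdeal κ := fun p => by
    have := Ideal.add_mem _ (Ideal.pow_le_self two_ne_zero (hgh p)) (hh p)
    rwa [sub_add_cancel] at this
  have h0 : ∀ P : JetPoly κ, g P - h P ∈ jetIdeal κ := by
    intro P
    induction P using MvPolynomial.induction_on with
    | C c =>
      rw [← MvPolynomial.algebraMap_eq, AlgHom.commutes, AlgHom.commutes, sub_self]
      exact Ideal.zero_mem _
    | add P Q hP hQ =>
      rw [map_add, map_add, add_sub_add_comm]
      exact Ideal.add_mem _ hP hQ
    | mul_X P p hP =>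
      rw [map_mul, map_mul]
      exact Ideal.sub_mem _ (Ideal.mul_mem_left _ _ (hg p)) (Ideal.mul_mem_left _ _ (hh p))
  have h1 : ∀ P ∈ jetIdeal κ, g P - h P ∈ jetIdeal κ ^ 2 := by
    intro P hP
    induction hP using Submodule.span_induction with
    | mem x hx =>
      obtain ⟨p, rfl⟩ := hx
      exact hgh p
    | zero => simp
    | add x y _ _ hx hy =>
      rw [map_add, map_add, add_sub_add_comm]
      exact Ideal.add_mem _ hx hy
    | smul a x hx ih =>
      have hx' : g x ∈ jetIdeal κ := by
        have := algHom_mem_pow hg (n := 1) (P := x) (by rwa [pow_one])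
        rwa [pow_one] at this
      have : g (a • x) - h (a • x) = (g a - h a) * g x + h a * (g x - h x) := by
        rw [smul_eq_mul, map_mul, map_mul]
        ring
      rw [this]
      refine Ideal.add_mem _ ?_ (Ideal.mul_mem_left _ _ ih)
      rw [pow_two]
      exact Ideal.mul_mem_mul (h0 a) hx'
  induction n generalizing P with
  | zero => simpa using h0 P
  | succ n ih =>
    rw [pow_succ] at hP
    induction hP using Submodule.mul_induction_on' with
    | mem_mul_mem a ha b hb =>
      have hb' : g b ∈ jetIdeal κ := by
        have := algHom_mem_pow hg (n := 1) (P := b) (by rwa [pow_one])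
        rwa [pow_one] at this
      have : g (a * b) - h (a * b) = (g a - h a) * g b + h a * (g b - h b) := by
        rw [map_mul, map_mul]
        ring
      rw [this]
      refine Ideal.add_mem _ ?_ ?_
      · rw [pow_succ]
        exact Ideal.mul_mem_mul (ih ha) hb'
      · rw [add_assoc, pow_add]
        exact Ideal.mul_mem_mul (algHom_mem_pow hh ha) (h1 b hb)
    | add x _ y _ hx hy =>
      rw [map_add, map_add, add_sub_add_comm]
      exact Ideal.add_mem _ hx hy

theorem act_X_mem_jetIdeal (W : Matrix (Fin 2) (Fin 2) ℂ) (p : Fin 2 × Fin κ) :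
    act W (MvPolynomial.X p) ∈ jetIdeal κ := by
  rw [act_X]
  exact Ideal.add_mem _ (Ideal.mul_mem_left _ _ (X_mem_jetIdeal _))
    (Ideal.mul_mem_left _ _ (X_mem_jetIdeal _))

end Filtration

/-! ### The chain rule for curves, modulo products of jet variables. -/

/-- The partial derivative of a function on `ℂ²`. -/
def partialDeriv (h : C2 → ℂ) (j : Fin 2) (z : C2) : ℂ := fderiv ℂ h z (Pi.single j 1)

theorem analyticAt_partialDeriv {h : C2 → ℂ} {y : C2} (hh : AnalyticAt ℂ h y) (j : Fin 2) :
    AnalyticAt ℂ (partialDeriv h j) y :=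
  (ContinuousLinearMap.apply ℂ ℂ (Pi.single j 1 : C2)).analyticAt _ |>.comp hh.fderiv

theorem analyticAt_component {f : ℂ → C2} {t : ℂ} (hf : AnalyticAt ℂ f t) (j : Fin 2) :
    AnalyticAt ℂ (fun s => f s j) t :=
  (ContinuousLinearMap.proj (R := ℂ) (φ := fun _ : Fin 2 => ℂ) j).analyticAt (f t) |>.comp hf

theorem deriv_comp_curve {h : C2 → ℂ} {f : ℂ → C2} {t : ℂ} (hh : AnalyticAt ℂ h (f t))
    (hf : AnalyticAt ℂ f t) : deriv (h ∘ f) =ᶠ[nhds t]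
      fun s => ∑ j, (partialDeriv h j ∘ f) s * deriv (fun s => f s j) s := by
  filter_upwards [hf.continuousAt.eventually hh.eventually_analyticAt,
    hf.eventually_analyticAt] with s hs hs'
  rw [(hs.differentiableAt.hasFDerivAt.comp_hasDerivAt s hs'.differentiableAt.hasDerivAt).deriv]
  have h1 : deriv f s = fun j => deriv (fun s => f s j) s :=
    deriv_pi fun j => (analyticAt_component hs' j).differentiableAt
  refine (congrArg _ h1).trans ((LinearMap.pi_apply_eq_sum_univ
    (fderiv ℂ h (f s) : C2 →ₗ[ℂ] ℂ) _).trans (Finset.sum_congr rfl fun j _ => ?_))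
  rw [smul_eq_mul, mul_comm]
  have hs : (fun j' => if j = j' then (1 : ℂ) else 0) = Pi.single j 1 := by
    funext i
    simp [Pi.single_apply, eq_comm]
  rw [hs]
  rfl

theorem iteratedDeriv_succ_comp_curve {h : C2 → ℂ} {f : ℂ → C2} {t : ℂ}
    (hh : AnalyticAt ℂ h (f t)) (hf : AnalyticAt ℂ f t) (n : ℕ) :
    iteratedDeriv (n + 1) (h ∘ f) t = ∑ j, ∑ k ∈ Finset.range (n + 1),
      n.choose k * iteratedDeriv k (partialDeriv h j ∘ f) t
        * iteratedDeriv (n - k + 1) (fun s => f s j) t := by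
  have hp : ∀ j, AnalyticAt ℂ (partialDeriv h j ∘ f) t := fun j =>
    (analyticAt_partialDeriv hh j).comp hf
  have hd : ∀ j, AnalyticAt ℂ (deriv fun s => f s j) t := fun j =>
    (analyticAt_component hf j).deriv
  rw [iteratedDeriv_succ', (deriv_comp_curve hh hf).iteratedDeriv_eq,
    iteratedDeriv_fun_sum (f := fun j s => (partialDeriv h j ∘ f) s * deriv (fun s => f s j) s)
      fun j _ => ((hp j).mul (hd j)).contDiffAt]
  refine Finset.sum_congr rfl fun j _ => ?_
  rw [iteratedDeriv_fun_mul (hp j).contDiffAt (hd j).contDiffAt]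
  simp_rw [← iteratedDeriv_succ']

/-- In the Leibniz expansion of `∑ (∂_j h ∘ f) f_j'`, the term that does not differentiate `∂_j h ∘
f` is the linear part. Every other term is, by induction applied to `∂_j h`, an element of the ideal
times a jet variable. -/
theorem exists_chain_poly (y : C2) (n : ℕ) (hn : n < 4) (h : C2 → ℂ) (hh : AnalyticAt ℂ h y) :
    ∃ G ∈ jetIdeal 4, (∀ f : ℂ → C2, AnalyticAt ℂ f 0 → f 0 = y →
      iteratedDeriv (n + 1) (h ∘ f) 0 = MvPolynomial.eval (jet 4 f 0) G) ∧
      G - ∑ j, MvPolynomial.C (partialDeriv h j y) * MvPolynomial.X (j, ⟨n, hn⟩)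
        ∈ jetIdeal 4 ^ 2 := by
  induction n using Nat.strong_induction_on generalizing h with
  | _ n ih =>
    have ih' : ∀ (j : Fin 2) (k : Fin n), ∃ G ∈ jetIdeal 4, ∀ f : ℂ → C2, AnalyticAt ℂ f 0 →
        f 0 = y → iteratedDeriv (k.val + 1) (partialDeriv h j ∘ f) 0
          = MvPolynomial.eval (jet 4 f 0) G := fun j k => by
      obtain ⟨G, h1, h2, -⟩ := ih k.val k.2 (k.2.trans hn) (partialDeriv h j)
        (analyticAt_partialDeriv hh j)
      exact ⟨G, h1, h2⟩
    choose G hG hGe using ih'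
    let R : JetPoly 4 := ∑ j, ∑ k : Fin n, (n.choose (k.val + 1) : JetPoly 4) * (G j k
      * MvPolynomial.X (j, ⟨n - (k.val + 1), by omega⟩))
    have hR : R ∈ jetIdeal 4 ^ 2 := by
      refine Ideal.sum_mem _ fun j _ => Ideal.sum_mem _ fun k _ => Ideal.mul_mem_left _ _ ?_
      rw [pow_two]
      exact Ideal.mul_mem_mul (hG j k) (X_mem_jetIdeal _)
    refine ⟨∑ j, MvPolynomial.C (partialDeriv h j y) * MvPolynomial.X (j, ⟨n, hn⟩) + R,
      Ideal.add_mem _ (Ideal.sum_mem _ fun j _ => Ideal.mul_mem_left _ _ (X_mem_jetIdeal _))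
      (Ideal.pow_le_self two_ne_zero hR), fun f hf hfy => ?_, by rwa [add_sub_cancel_left]⟩
    rw [iteratedDeriv_succ_comp_curve (hfy.symm ▸ hh) hf, map_add, map_sum, map_sum,
      ← Finset.sum_add_distrib]
    refine Finset.sum_congr rfl fun j _ => ?_
    rw [Finset.sum_range_succ', add_comm, map_sum, Finset.sum_range]
    congr 1
    · simp [jet, hfy]
    · refine Finset.sum_congr rfl fun k _ => ?_
      rw [hGe j k f hf hfy]
      simp [jet, mul_assoc]

/-- The Jacobian matrix. -/
def jac (τ : C2 → C2) (y : C2) : Matrix (Fin 2) (Fin 2) ℂ :=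
  LinearMap.toMatrix' (fderiv ℂ τ y : C2 →ₗ[ℂ] C2)

theorem jac_mulVec (τ : C2 → C2) (y v : C2) : (jac τ y).mulVec v = fderiv ℂ τ y v := by
  rw [jac, LinearMap.toMatrix'_mulVec]
  rfl

/-- `T` substitutes the chain rule polynomials for the variables. Their linear parts are those of
the Jacobian action, whence the last claim. Reparametrization commutes with composition by `τ` on
the other side, so invariance is preserved. -/
theorem exists_transition {τ : C2 → C2} {y : C2} (hτ : AnalyticAt ℂ τ y) :
    ∃ T : JetPoly 4 →ₐ[ℂ] JetPoly 4,
      (∀ f : ℂ → C2, AnalyticAt ℂ f 0 → f 0 = y → ∀ P,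
        MvPolynomial.eval (jet 4 f 0) (T P) = MvPolynomial.eval (jet 4 (τ ∘ f) 0) P) ∧
      (∀ m, ∀ P ∈ invariants 4 m, T P ∈ invariants 4 m) ∧
      (∀ n, ∀ P ∈ jetIdeal 4 ^ n, T P ∈ jetIdeal 4 ^ n) ∧
      (∀ n, ∀ P ∈ jetIdeal 4 ^ n, T P - act (jac τ y) P ∈ jetIdeal 4 ^ (n + 1)) := by
  have hτi : ∀ i, AnalyticAt ℂ (fun z => τ z i) y := fun i =>
    (ContinuousLinearMap.proj (R := ℂ) (φ := fun _ : Fin 2 => ℂ) i).analyticAt (τ y) |>.comp hτ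
  choose G hG hGe hGd using fun p : Fin 2 × Fin 4 =>
    exists_chain_poly y p.2.val p.2.2 (fun z => τ z p.1) (hτi p.1)
  have heval : ∀ f : ℂ → C2, AnalyticAt ℂ f 0 → f 0 = y → ∀ P,
      MvPolynomial.eval (jet 4 f 0) (MvPolynomial.aeval G P)
        = MvPolynomial.eval (jet 4 (τ ∘ f) 0) P := by
    intro f hf hfy P
    rw [MvPolynomial.aeval_def, MvPolynomial.eval_eval₂, MvPolynomial.eval,
      MvPolynomial.coe_eval₂Hom]
    congr 1
    · ext x
      simp
    · funext p
      exact (hGe p f hf hfy).symm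
  have hX : ∀ p, MvPolynomial.aeval G (MvPolynomial.X p : JetPoly 4) ∈ jetIdeal 4 := fun p => by
    rw [MvPolynomial.aeval_X]
    exact hG p
  refine ⟨MvPolynomial.aeval G, heval, fun m P hP => ?_, fun n P hP => algHom_mem_pow hX hP,
    fun n P hP => algHom_sub_mem_pow (act_X_mem_jetIdeal _) (fun p => ?_) hP⟩
  -- `T` computes derivatives only for curves through `y`, so invariance has to be tested on those.
  · refine mem_invariants_iff.2 (isReparamInvariant_of_centered y fun f φ h1 h2 h3 h4 h5 => ?_)
    have h6 : AnalyticAt ℂ (f ∘ φ) 0 := AnalyticAt.comp (by rwa [h2]) h1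
    have h7 : AnalyticAt ℂ (τ ∘ f) 0 := AnalyticAt.comp (by rwa [h5]) h4
    rw [heval _ h6 (by rw [Function.comp_apply, h2, h5]), heval f h4 h5]
    have := hP (τ ∘ f) φ 0 h1 h3 (by rwa [h2])
    rwa [h2] at this
  · convert hGd p using 2
    · rw [MvPolynomial.aeval_X]
    · rw [act_X, Fin.sum_univ_two]
      have : ∀ j, jac τ y p.1 j = partialDeriv (fun z => τ z p.1) j y := by
        intro j
        rw [jac, LinearMap.toMatrix'_apply, partialDeriv, fderiv_apply hτ.differentiableAt]
        simp
      rw [this, this]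

/-! ### Homogeneous components of invariants -/

theorem act_smul_one {κ : ℕ} (t : ℂ) (P : JetPoly κ) : act (t • 1) P = rescale t (fun _ => 1) P := by
  have : act (κ := κ) (t • 1) = rescale t fun _ => 1 := by
    ext1 p
    obtain ⟨i, l⟩ := p
    rw [act_X, rescale, MvPolynomial.aeval_X]
    fin_cases i <;> simp
  rw [this]

theorem coeff_act_smul_one {κ : ℕ} (t : ℂ) (P : JetPoly κ) (d : Fin 2 × Fin κ →₀ ℕ) :
    MvPolynomial.coeff d (act (t • 1) P) = t ^ d.degree * MvPolynomial.coeff d P := by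
  rw [act_smul_one, coeff_rescale, Finsupp.degree_eq_weight_one (R := ℕ)]

/-- The homogeneous components are the coefficients of the polynomial in `t` given by the action of
the scalar matrices `t`, which preserves invariants. -/
theorem homogeneousComponent_mem_invariants {κ m : ℕ} {P : JetPoly κ} (hP : P ∈ invariants κ m)
    (n : ℕ) : MvPolynomial.homogeneousComponent n P ∈ invariants κ m := by
  let q : Polynomial (JetPoly κ) := ∑ d ∈ Finset.range (P.totalDegree + 1),
    Polynomial.monomial d (MvPolynomial.homogeneousComponent d P)
  have hq : ∀ t : ℂ, q.eval (algebraMap ℂ (JetPoly κ) t) = act (t • 1) P := by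
    intro t
    ext d
    rw [coeff_act_smul_one, Polynomial.eval_finsetSum, MvPolynomial.coeff_sum]
    simp only [Polynomial.eval_monomial, ← map_pow, MvPolynomial.algebraMap_eq,
      mul_comm _ (MvPolynomial.C _), MvPolynomial.coeff_C_mul,
      MvPolynomial.coeff_homogeneousComponent, mul_ite, mul_zero]
    rw [Finset.sum_ite_eq]
    split_ifs with h
    · rfl
    · rw [MvPolynomial.coeff_eq_zero_of_totalDegree_lt, mul_zero]
      rw [Finset.mem_range] at h
      rw [← Finsupp.degree_apply]
      omega
  have := coeff_mem_of_forall_eval_mem (fun t => hq t ▸ act_mem _ hP) n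
  simp only [q, Polynomial.finsetSum_coeff, Polynomial.coeff_monomial, Finset.sum_ite_eq',
    Finset.mem_range] at this
  split_ifs at this with h
  · exact this
  · rw [MvPolynomial.homogeneousComponent_eq_zero _ _ (by omega)]
    exact Submodule.zero_mem _

theorem shape_le {m : ℕ} (i : IndexA m ⊕ IndexB m) : (shape i).2 ≤ (shape i).1 := by
  rcases i with k | k <;> simp only [shape] <;> omega

/-- The covariants have degree `l₁ + l₂` in the jet variables. -/
theorem degree_of_mem_support_evalVec {m : ℕ} (i : IndexA m ⊕ IndexB m) (v : C2)
    {d : Fin 2 × Fin 4 →₀ ℕ} (hd : d ∈ (evalVec v (covariant i)).support) :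
    d.degree = (shape i).1 + (shape i).2 := by
  -- The scalar matrix 2 multiplies a covariant by `2 ^ (l₁ - l₂)` through `v` and by `2 ^ (2 l₂)`
  -- through the determinant, whereas a jet monomial is multiplied by 2 to its degree.
  have h1 : evalVec (Matrix.vecMul v ((2 : ℂ) • 1)) (covariant i)
      = (2 : ℂ) ^ deg i • evalVec v (covariant i) := by
    rw [evalVec_eq_sum, evalVec_eq_sum, Finset.smul_sum]
    refine Finset.sum_congr rfl fun k hk => ?_
    have hk' := Nat.lt_succ_iff.1 (Finset.mem_range.1 hk)
    have h2 : (2 : ℂ) ^ deg i = 2 ^ (deg i - k) * 2 ^ k := by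
      rw [← pow_add, Nat.sub_add_cancel hk']
    rw [smul_smul, h2]
    simp [Matrix.vecMul_smul, mul_pow]
    congr 1
    ring
  have h2 := act_evalVec_covariant i ((2 : ℂ) • 1) v
  rw [h1, smul_smul, Matrix.det_smul, Matrix.det_one, mul_one, Fintype.card_fin, ← pow_mul,
    ← pow_add] at h2
  have h3 := congrArg (MvPolynomial.coeff d) h2
  rw [coeff_act_smul_one, MvPolynomial.coeff_smul, smul_eq_mul] at h3
  have h4 := two_pow_injective (mul_right_cancel₀ (MvPolynomial.mem_support_iff.1 hd) h3)
  have h5 := shape_le i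
  rw [h4, deg]
  omega

theorem decomp_eq_zero_of_mem_pow {m n : ℕ} {P : invariants 4 m} (hP : P.1 ∈ jetIdeal 4 ^ n)
    {i : IndexA m ⊕ IndexB m} (hi : (shape i).1 + (shape i).2 < n) : decomp m P i = 0 := by
  refine Subtype.ext (funext fun v => funext fun u₁ => funext fun u₂ => ?_)
  rw [decomp_apply, apolar_eq_sum, Finset.sum_eq_zero fun d hd => ?_, zero_mul]
  · rfl
  · rw [(MvPolynomial.mem_pow_idealOfVars_iff' n P.1).1 hP d
      (by rwa [degree_of_mem_support_evalVec i v hd]), mul_zero, mul_zero]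

theorem decomp_homogeneousComponent {m n : ℕ} (P : invariants 4 m) (i : IndexA m ⊕ IndexB m) :
    decomp m ⟨MvPolynomial.homogeneousComponent n P.1, homogeneousComponent_mem_invariants P.2 n⟩ i
      = if (shape i).1 + (shape i).2 = n then decomp m P i else 0 := by
  refine Subtype.ext (funext fun v => funext fun u₁ => funext fun u₂ => ?_)
  rw [decomp_apply, apolar_eq_sum]
  split_ifs with h
  · rw [decomp_apply, apolar_eq_sum]
    congr 1
    refine Finset.sum_congr rfl fun d hd => ?_
    rw [MvPolynomial.coeff_homogeneousComponent,
      if_pos ((degree_of_mem_support_evalVec i v hd).trans h)]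
  · rw [Finset.sum_eq_zero fun d hd => ?_, zero_mul]
    · rfl
    · rw [MvPolynomial.coeff_homogeneousComponent,
        if_neg fun hd' => h ((degree_of_mem_support_evalVec i v hd).symm.trans hd'), mul_zero,
        mul_zero]

/-- The pairing respects degrees, so the components of `decomp` with `l₁ + l₂ = p` determine the
homogeneous part of degree `p`. -/
theorem mem_pow_succ_iff {m p : ℕ} {P : invariants 4 m} (hP : P.1 ∈ jetIdeal 4 ^ p) :
    P.1 ∈ jetIdeal 4 ^ (p + 1) ↔ ∀ i, (shape i).1 + (shape i).2 = p → decomp m P i = 0 := by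
  constructor
  · intro h i hi
    exact decomp_eq_zero_of_mem_pow h (by omega)
  · intro h
    have h0 : (⟨MvPolynomial.homogeneousComponent p P.1,
        homogeneousComponent_mem_invariants P.2 p⟩ : invariants 4 m) = 0 := by
      refine (decomp m).map_eq_zero_iff.1 (funext fun i => ?_)
      rw [decomp_homogeneousComponent]
      split_ifs with hi
      · exact h i hi
      · rfl
    have h1 : MvPolynomial.homogeneousComponent p P.1 = 0 := congrArg Subtype.val h0
    rw [MvPolynomial.mem_pow_idealOfVars_iff'] at hP ⊢
    intro d hd
    rcases (Nat.lt_succ_iff.1 hd).eq_or_lt with he | hlt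
    · have := congrArg (MvPolynomial.coeff d) h1
      rwa [MvPolynomial.coeff_homogeneousComponent, if_pos he, MvPolynomial.coeff_zero] at this
    · exact hP d hlt

theorem mem_pow_of_decomp {m p : ℕ} {P : invariants 4 m}
    (h : ∀ i, (shape i).1 + (shape i).2 ≠ p → decomp m P i = 0) : P.1 ∈ jetIdeal 4 ^ p := by
  have h0 : (⟨MvPolynomial.homogeneousComponent p P.1,
      homogeneousComponent_mem_invariants P.2 p⟩ : invariants 4 m) = P := by
    refine (decomp m).injective (funext fun i => ?_)
    rw [decomp_homogeneousComponent]
    split_ifs with hi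
    · rfl
    · exact (h i hi).symm
  rw [← congrArg Subtype.val h0, MvPolynomial.mem_pow_idealOfVars_iff']
  intro d hd
  rw [MvPolynomial.coeff_homogeneousComponent, if_neg hd.ne]

/-- The degree of a jet monomial never exceeds its weight, so the filtration ends after step `m`. -/
theorem eq_zero_of_mem_pow {m : ℕ} {P : invariants 4 m} (h : P.1 ∈ jetIdeal 4 ^ (m + 1)) :
    P = 0 := by
  refine Subtype.ext (MvPolynomial.ext _ _ fun d => ?_)
  by_contra hd
  have h1 := wt_eq_of_mem_support P.2 (MvPolynomial.mem_support_iff.2 hd)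
  have h2 := (MvPolynomial.mem_pow_idealOfVars_iff (m + 1) P.1).1 h d
    (MvPolynomial.mem_support_iff.2 hd)
  have := degree_le_wt d
  omega

/-- A linear endomorphism of the space of invariants which induces the identity on the graded
pieces of the filtration by the degree is bijective. -/
theorem bijective_of_unipotent {m : ℕ} (N : Module.End ℂ (invariants 4 m))
    (h : ∀ n, ∀ P : invariants 4 m, P.1 ∈ jetIdeal 4 ^ n →
      (N P - P : JetPoly 4) ∈ jetIdeal 4 ^ (n + 1)) : Function.Bijective N := by
  have hpow : ∀ (n : ℕ) (P : invariants 4 m), (((N - 1) ^ n) P : JetPoly 4) ∈ jetIdeal 4 ^ n := by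
    intro n P
    induction n with
    | zero => simp
    | succ n ih =>
      rw [pow_succ' (N - 1), Module.End.mul_apply]
      exact h n _ ih
  have hnil : IsNilpotent (N - 1) := ⟨m + 1, LinearMap.ext fun P => eq_zero_of_mem_pow (hpow _ P)⟩
  have := IsNilpotent.isUnit_one_add (R := Module.End ℂ (invariants 4 m)) hnil
  have h1 : 1 + (N - 1) = N := LinearMap.ext fun P => add_sub_cancel P (N P)
  exact (Module.End.isUnit_iff N).1 (h1 ▸ this)

/-! ### Transport of Schur powers -/

theorem schur_comp_mem {V V' : Type*} [AddCommGroup V] [Module ℂ V] [AddCommGroup V'] [Module ℂ V']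
    (L : V →ₗ[ℂ] V') {l : ℕ × ℕ} {F : V' → V' → V' → ℂ} (hF : F ∈ Schur V' l) :
    (fun v u₁ u₂ => F (L v) (L u₁) (L u₂)) ∈ Schur V l := by
  induction hF using Submodule.span_induction with
  | mem F hF =>
    obtain ⟨α, η, rfl⟩ := hF
    refine Submodule.subset_span ⟨fun i => α i ∘ₗ L, fun j => (η j).compLinearMap L, ?_⟩
    funext v u₁ u₂
    have : ∀ j, (η j).compLinearMap L ![u₁, u₂] = η j ![L u₁, L u₂] := by
      intro j
      rw [AlternatingMap.compLinearMap_apply]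
      congr 1
      funext k
      fin_cases k <;> rfl
    simp [this]
  | zero => exact Submodule.zero_mem _
  | add F G _ _ hF hG => exact Submodule.add_mem _ hF hG
  | smul c F _ hF => exact Submodule.smul_mem _ c hF

/-- Pull-back of Schur powers under a linear isomorphism. -/
def schurCongr {V V' : Type*} [AddCommGroup V] [Module ℂ V] [AddCommGroup V'] [Module ℂ V']
    (L : V ≃ₗ[ℂ] V') (l : ℕ × ℕ) : Schur V' l ≃ₗ[ℂ] Schur V l where
  toFun F := ⟨fun v u₁ u₂ => F.1 (L v) (L u₁) (L u₂), schur_comp_mem L.toLinearMap F.2⟩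
  invFun F := ⟨fun v u₁ u₂ => F.1 (L.symm v) (L.symm u₁) (L.symm u₂),
    schur_comp_mem L.symm.toLinearMap F.2⟩
  map_add' _ _ := rfl
  map_smul' _ _ := rfl
  left_inv F := Subtype.ext (by simp)
  right_inv F := Subtype.ext (by simp)

/-! ### Charts and jets -/

theorem jet_congr {κ : ℕ} {f g : ℂ → C2} {t : ℂ} (h : f =ᶠ[nhds t] g) :
    jet κ f t = jet κ g t := by
  funext p
  refine Filter.EventuallyEq.iteratedDeriv_eq _ ?_
  filter_upwards [h] with s hs
  rw [hs]

/-- Stability of a space of jet polynomials under holomorphic changes of coordinates. -/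
def IsStable (S : Submodule ℂ (JetPoly 4)) : Prop :=
  ∀ (τ : C2 → C2) (y : C2), AnalyticAt ℂ τ y → ∀ P ∈ S, ∃ P' ∈ S, ∀ f : ℂ → C2, AnalyticAt ℂ f 0 →
    f 0 = y → MvPolynomial.eval (jet 4 f 0) P' = MvPolynomial.eval (jet 4 (τ ∘ f) 0) P

theorem isStable_invariants (m : ℕ) : IsStable (invariants 4 m) := by
  intro τ y hτ P hP
  obtain ⟨T, h1, h2, -, -⟩ := exists_transition hτ
  exact ⟨T P, h2 m P hP, fun f hf hy => h1 f hf hy P⟩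

theorem isStable_invariantsOfOrder (m p : ℕ) : IsStable (invariantsOfOrder 4 m p) := by
  intro τ y hτ P hP
  obtain ⟨T, h1, h2, h3, -⟩ := exists_transition hτ
  rw [mem_invariantsOfOrder_iff] at hP
  exact ⟨T P, mem_invariantsOfOrder_iff.2 ⟨h2 m P hP.1, h3 p P hP.2⟩,
    fun f hf hy => h1 f hf hy P⟩

section Surface

variable {X : Type*} [TopologicalSpace X] [ChartedSpace C2 X] [IsManifold 𝓘(ℂ, C2) ω X]
  {e e' : OpenPartialHomeomorph X C2} {x : X}

theorem analyticAt_chart_comp (he : e ∈ atlas C2 X) (hx : x ∈ e.source) (γ : Curve x) :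
    AnalyticAt ℂ (fun t => e (γ.toFun t)) 0 := by
  have h1 : ContMDiffAt 𝓘(ℂ, C2) 𝓘(ℂ, C2) ω e (γ.toFun 0) :=
    contMDiffAt_of_mem_maximalAtlas (IsManifold.subset_maximalAtlas he) (by rwa [γ.base])
  exact (contMDiffAt_iff_contDiffAt.1 (h1.comp 0 γ.holo)).analyticAt

theorem analyticAt_transition (he : e ∈ atlas C2 X) (he' : e' ∈ atlas C2 X) {y : C2}
    (hy : y ∈ e.target) (hy' : e.symm y ∈ e'.source) : AnalyticAt ℂ (e' ∘ e.symm) y := by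
  have h1 : ContMDiffAt 𝓘(ℂ, C2) 𝓘(ℂ, C2) ω e' (e.symm y) :=
    contMDiffAt_of_mem_maximalAtlas (IsManifold.subset_maximalAtlas he') hy'
  have h2 : ContMDiffAt 𝓘(ℂ, C2) 𝓘(ℂ, C2) ω e.symm y :=
    (contMDiffOn_symm_of_mem_maximalAtlas (IsManifold.subset_maximalAtlas he)).contMDiffAt
      (e.open_target.mem_nhds hy)
  exact (contMDiffAt_iff_contDiffAt.1 (h1.comp y h2)).analyticAt

theorem analyticAt_transition' (he : e ∈ atlas C2 X) (he' : e' ∈ atlas C2 X)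
    (hx : x ∈ e.source) (hx' : x ∈ e'.source) : AnalyticAt ℂ (e' ∘ e.symm) (e x) :=
  analyticAt_transition he he' (e.map_source hx) (by rwa [e.left_inv hx])

theorem pull_eq_of_transition (he : e ∈ atlas C2 X) (hx : x ∈ e.source) {P P' : JetPoly 4}
    (h : ∀ f : ℂ → C2, AnalyticAt ℂ f 0 → f 0 = e x →
      MvPolynomial.eval (jet 4 f 0) P' = MvPolynomial.eval (jet 4 ((e' ∘ e.symm) ∘ f) 0) P) :
    (pull e P' : Curve x → ℂ) = pull e' P := by
  funext γ
  rw [pull, h _ (analyticAt_chart_comp he hx γ) (by rw [γ.base]), pull]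
  congr 2
  refine jet_congr ?_
  have hc : ContinuousAt γ.toFun 0 := γ.holo.continuousAt
  filter_upwards [hc.eventually (e.open_source.mem_nhds (by rwa [γ.base]))] with t ht
  simp [e.left_inv ht]

/-- Every jet is the jet in the chart of some curve germ through `x`, namely of a polynomial curve.
-/
theorem pull_injective (he : e ∈ atlas C2 X) (hx : x ∈ e.source) {P P' : JetPoly 4}
    (h : (pull e P : Curve x → ℂ) = pull e P') : P = P' := by
  refine MvPolynomial.funext fun J => ?_
  have hy := e.map_source hx
  have h1 : ContMDiffAt 𝓘(ℂ, C2) 𝓘(ℂ, C2) ω e.symm (polyCurve (e x) J 0) := by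
    rw [polyCurve_zero]
    exact (contMDiffOn_symm_of_mem_maximalAtlas (IsManifold.subset_maximalAtlas he)).contMDiffAt
      (e.open_target.mem_nhds hy)
  let γ : Curve x := ⟨fun t => e.symm (polyCurve (e x) J t), by
    rw [polyCurve_zero, e.left_inv hx], h1.comp 0
    (contMDiffAt_iff_contDiffAt.2 (analyticAt_polyCurve (e x) J 0).contDiffAt)⟩
  have hγ : jet 4 (fun t => e (γ.toFun t)) 0 = J := by
    rw [← jet_polyCurve (e x) J]
    refine jet_congr ?_
    have hc : ContinuousAt (polyCurve (e x) J) 0 := (analyticAt_polyCurve (e x) J 0).continuousAt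
    filter_upwards [hc.eventually (e.open_target.mem_nhds (by rwa [polyCurve_zero]))] with t ht
    exact e.right_inv ht
  have := congrFun h γ
  rwa [pull, pull, hγ] at this

theorem pull_mem_jetFiber {S : Submodule ℂ (JetPoly 4)} (hS : IsStable S) (he : e ∈ atlas C2 X)
    (hx : x ∈ e.source) {P : JetPoly 4} (hP : P ∈ S) : pull e P ∈ jetFiber S x := by
  intro e' he' hx'
  obtain ⟨P', hP', h⟩ := hS _ _ (analyticAt_transition' he' he hx' hx) P hP
  exact ⟨P', hP', (pull_eq_of_transition he' hx' h).symm⟩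

/-- The coordinates given by a chart on a fiber of a bundle of jet polynomials. -/
def pullEquiv {S : Submodule ℂ (JetPoly 4)} (hS : IsStable S) (he : e ∈ atlas C2 X)
    (hx : x ∈ e.source) : S ≃ₗ[ℂ] jetFiber S x :=
  LinearEquiv.ofBijective
    { toFun := fun P => ⟨pull e P.1, pull_mem_jetFiber hS he hx P.2⟩
      map_add' := fun P Q => Subtype.ext (by funext γ; simp [pull])
      map_smul' := fun c P => Subtype.ext (by funext γ; simp [pull]) }
    ⟨fun P Q h => Subtype.ext (pull_injective he hx (congrArg Subtype.val h)), fun Q => by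
      obtain ⟨P, hP, h⟩ := Q.2 e he hx
      exact ⟨⟨P, hP⟩, Subtype.ext h.symm⟩⟩

theorem pullEquiv_symm_apply {S : Submodule ℂ (JetPoly 4)} (hS : IsStable S) (he : e ∈ atlas C2 X)
    (hx : x ∈ e.source) (Q : jetFiber S x) {P : JetPoly 4} (hP : P ∈ S) (h : Q.1 = pull e P) :
    (pullEquiv hS he hx).symm Q = ⟨P, hP⟩ := by
  rw [LinearEquiv.symm_apply_eq]
  exact Subtype.ext h

/-! ### Charts and tangent vectors -/

/-- The coordinates given by a chart on a tangent space. -/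
def tangentEquiv (he : e ∈ atlas C2 X) (hx : x ∈ e.source) : TangentSpace 𝓘(ℂ, C2) x ≃ₗ[ℂ] C2 :=
  ((mdifferentiable_of_mem_atlas (I := 𝓘(ℂ, C2)) he).mfderiv hx).toLinearEquiv

theorem tangentEquiv_apply (he : e ∈ atlas C2 X) (hx : x ∈ e.source)
    (v : TangentSpace 𝓘(ℂ, C2) x) :
    tangentEquiv he hx v = mfderiv 𝓘(ℂ, C2) 𝓘(ℂ, C2) e x v := rfl

theorem tangentEquiv_change (he : e ∈ atlas C2 X) (hx : x ∈ e.source) (he' : e' ∈ atlas C2 X)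
    (hx' : x ∈ e'.source) (v : TangentSpace 𝓘(ℂ, C2) x) :
    tangentEquiv he' hx' v = fderiv ℂ (e' ∘ e.symm) (e x) (tangentEquiv he hx v) := by
  have h1 : e' =ᶠ[nhds x] (e' ∘ e.symm) ∘ e := by
    filter_upwards [e.open_source.mem_nhds hx] with z hz
    simp [e.left_inv hz]
  have h2 := (mdifferentiable_of_mem_atlas (I := 𝓘(ℂ, C2)) he).mdifferentiableAt hx
  have h3 := (analyticAt_transition' he he' hx hx').differentiableAt
  rw [tangentEquiv_apply, h1.mfderiv_eq, mfderiv_comp x h3.mdifferentiableAt h2, mfderiv_eq_fderiv]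
  rfl

theorem tangentEquiv_mfderiv_symm (he : e ∈ atlas C2 X) {y : C2} (hy : y ∈ e.target) (v : C2) :
    tangentEquiv he (e.map_target hy) (mfderiv 𝓘(ℂ, C2) 𝓘(ℂ, C2) e.symm y v) = v :=
  congrArg (fun L => L v)
    ((mdifferentiable_of_mem_atlas (I := 𝓘(ℂ, C2)) he).comp_symm_deriv hy)

/-! ### Local isomorphisms -/

variable {m : ℕ}

/-- The isomorphism given by a chart between a fiber of the Demailly-Semple bundle and the sum of
the fibers of Schur bundles. -/
def localIso (he : e ∈ atlas C2 X) (hx : x ∈ e.source) : dsFiber 4 m x ≃ₗ[ℂ]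
    ∀ i : IndexA m ⊕ IndexB m, schurFiber (shape i) x :=
  (pullEquiv (isStable_invariants m) he hx).symm.trans ((decomp m).trans
    (LinearEquiv.piCongrRight fun i => schurCongr (tangentEquiv he hx) (shape i)))

theorem localIso_apply (he : e ∈ atlas C2 X) (hx : x ∈ e.source) (Q : dsFiber 4 m x)
    {P : JetPoly 4} (hP : P ∈ invariants 4 m) (h : Q.1 = pull e P) (i : IndexA m ⊕ IndexB m)
    (v u₁ u₂ : TangentSpace 𝓘(ℂ, C2) x) :
    (localIso he hx Q i).1 v u₁ u₂ = (decomp m ⟨P, hP⟩ i).1 (tangentEquiv he hx v)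
      (tangentEquiv he hx u₁) (tangentEquiv he hx u₂) := by
  rw [localIso, LinearEquiv.trans_apply, pullEquiv_symm_apply _ he hx Q hP h]
  rfl

theorem mem_pow_of_pull_eq (he : e ∈ atlas C2 X) (hx : x ∈ e.source) (he' : e' ∈ atlas C2 X)
    (hx' : x ∈ e'.source) {P P' : JetPoly 4} (h : (pull e P : Curve x → ℂ) = pull e' P') {n : ℕ}
    (hP : P ∈ jetIdeal 4 ^ n) : P' ∈ jetIdeal 4 ^ n ∧
      P - act (jac (e' ∘ e.symm) (e x)) P' ∈ jetIdeal 4 ^ (n + 1) := by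
  obtain ⟨T, h1, -, -, h4⟩ := exists_transition (analyticAt_transition' he he' hx hx')
  obtain ⟨T', h1', -, h3', -⟩ := exists_transition (analyticAt_transition' he' he hx' hx)
  have hP' : P' = T' P := pull_injective he' hx' (h.symm.trans
    (pull_eq_of_transition he' hx' fun f hf hy => h1' f hf hy P).symm)
  have hPT : P = T P' := pull_injective he hx (h.trans
    (pull_eq_of_transition he hx fun f hf hy => h1 f hf hy P').symm)
  have hmem : P' ∈ jetIdeal 4 ^ n := hP' ▸ h3' n P hP
  refine ⟨hmem, ?_⟩
  have := h4 n P' hmem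
  rwa [← hPT] at this

/-- Equivariance of `decomp` absorbs the Jacobian of the change of chart exactly. The two local
isomorphisms therefore differ only by the higher degree terms of the transition. -/
theorem exists_localIso_eq (he : e ∈ atlas C2 X) (hx : x ∈ e.source) (he' : e' ∈ atlas C2 X)
    (hx' : x ∈ e'.source) (P : invariants 4 m) : ∃ P' : invariants 4 m,
      localIso he' hx' (pullEquiv (isStable_invariants m) he hx P)
        = localIso he hx (pullEquiv (isStable_invariants m) he hx P') ∧
      ∀ n, P.1 ∈ jetIdeal 4 ^ n → P'.1 - P.1 ∈ jetIdeal 4 ^ (n + 1) := by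
  obtain ⟨R, hR, h⟩ := (pullEquiv (isStable_invariants m) he hx P).2 e' he' hx'
  refine ⟨⟨act (jac (e' ∘ e.symm) (e x)) R, act_mem _ hR⟩, ?_, fun n hn => ?_⟩
  · refine funext fun i => Subtype.ext (funext fun v => funext fun u₁ => funext fun u₂ => ?_)
    rw [localIso_apply he' hx' _ hR h, localIso_apply he hx _ (act_mem _ hR) rfl,
      decomp_act _ ⟨R, hR⟩, jac_mulVec, jac_mulVec, jac_mulVec, tangentEquiv_change he hx he' hx',
      tangentEquiv_change he hx he' hx', tangentEquiv_change he hx he' hx']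
  · rw [← Ideal.neg_mem_iff, neg_sub]
    exact (mem_pow_of_pull_eq he hx he' hx' h hn).2

/-- The unipotent discrepancy has degree greater than `n` and is invisible to the components with
`l₁ + l₂ = n`. This is why the isomorphism on graded pieces is canonical. -/
theorem localIso_eq_of_mem_pow (he : e ∈ atlas C2 X) (hx : x ∈ e.source) (he' : e' ∈ atlas C2 X)
    (hx' : x ∈ e'.source) (Q : dsFiber 4 m x) {P : JetPoly 4} (h : Q.1 = pull e P)
    {n : ℕ} (hP : P ∈ invariants 4 m) (hPn : P ∈ jetIdeal 4 ^ n) {i : IndexA m ⊕ IndexB m}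
    (hi : (shape i).1 + (shape i).2 = n) : localIso he' hx' Q i = localIso he hx Q i := by
  have hQ : Q = pullEquiv (isStable_invariants m) he hx ⟨P, hP⟩ := Subtype.ext h
  obtain ⟨P', h1, h2⟩ := exists_localIso_eq he hx he' hx' ⟨P, hP⟩
  rw [hQ, h1]
  simp only [localIso, LinearEquiv.trans_apply, LinearEquiv.symm_apply_apply]
  have : decomp m P' i = decomp m ⟨P, hP⟩ i := by
    rw [← sub_eq_zero, ← Pi.sub_apply, ← map_sub]
    exact decomp_eq_zero_of_mem_pow (h2 n hPn) (by omega)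
  exact congrArg (fun F => schurCongr (tangentEquiv he hx) (shape i) F) this

end Surface

/-! ### The smooth isomorphism -/

section Regularity

variable {𝕜 : Type} [NontriviallyNormedField 𝕜] [NormedAlgebra 𝕜 ℂ] {m : ℕ}

theorem contDiffAt_apply {w : C2 → C2} {y : C2} (hw : ContDiffAt 𝕜 ∞ w y) (k : Fin 2) :
    ContDiffAt 𝕜 ∞ (fun z => w z k) y :=
  contDiffAt_pi.1 hw k

/-- The pairing is summed over the support of the fixed polynomials `covCoeff i k`, so only finitely
many coefficients of `c` enter, independently of the point. -/
theorem contDiffAt_pairing {c : C2 → JetPoly 4} {w w₁ w₂ : C2 → C2} {y : C2}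
    (hc : ∀ d, ContDiffAt 𝕜 ∞ (fun z => MvPolynomial.coeff d (c z)) y) (hw : ContDiffAt 𝕜 ∞ w y)
    (hw₁ : ContDiffAt 𝕜 ∞ w₁ y) (hw₂ : ContDiffAt 𝕜 ∞ w₂ y) (i : IndexA m ⊕ IndexB m) :
    ContDiffAt 𝕜 ∞ (fun z => apolar (evalVec (w z) (covariant i)) (c z)
      * area (w₁ z) (w₂ z) ^ (shape i).2) y := by
  simp only [evalVec_eq_sum, map_sum, map_smul, LinearMap.sum_apply, LinearMap.smul_apply,
    smul_eq_mul, apolar_eq_sum, area]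
  refine ContDiffAt.mul (ContDiffAt.sum fun k _ => ContDiffAt.mul (ContDiffAt.mul
    ((contDiffAt_apply hw 0).pow _) ((contDiffAt_apply hw 1).pow _)) (ContDiffAt.sum fun d _ =>
    contDiffAt_const.mul (contDiffAt_const.mul (hc d)))) (ContDiffAt.pow (ContDiffAt.sub
    ((contDiffAt_apply hw₁ 0).mul (contDiffAt_apply hw₂ 1))
    ((contDiffAt_apply hw₁ 1).mul (contDiffAt_apply hw₂ 0))) _)

end Regularity

section Surface

variable {X : Type*} [TopologicalSpace X] [ChartedSpace C2 X] [IsManifold 𝓘(ℂ, C2) ω X]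
  {e e' : OpenPartialHomeomorph X C2} {x : X} {m : ℕ}

variable (X) in
theorem isManifold_real : IsManifold 𝓘(ℝ, C2) ∞ X := by
  refine isManifold_of_contDiffOn _ _ _ fun e e' he he' y hy => ?_
  simp only [mfld_simps] at hy
  have h := analyticAt_transition he he' hy.1 hy.2
  exact ((h.contDiffAt (n := ∞)).restrict_scalars ℝ).contDiffWithinAt

/-- The map given by a chart from a fiber of the Demailly-Semple bundle to the sum of the fibers of
Schur bundles, extended by zero outside the domain of the chart. -/
def localMap (he : e ∈ atlas C2 X) (x : X) : dsFiber 4 m x →ₗ[ℂ]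
    ∀ i : IndexA m ⊕ IndexB m, schurFiber (shape i) x :=
  open Classical in if hx : x ∈ e.source then (localIso he hx).toLinearMap else 0

theorem localMap_apply (he : e ∈ atlas C2 X) (hx : x ∈ e.source) (Q : dsFiber 4 m x) :
    localMap he x Q = localIso he hx Q := by
  rw [localMap, dif_pos hx]
  rfl

/-- The values of a section of a Schur bundle on constant vector fields in a chart. -/
def frameValue (e : OpenPartialHomeomorph X C2) {l : ℕ × ℕ} {y : C2} (F : schurFiber l (e.symm y))
    (v u₁ u₂ : C2) : ℂ :=
  F.1 (mfderiv 𝓘(ℂ, C2) 𝓘(ℂ, C2) e.symm y v) (mfderiv 𝓘(ℂ, C2) 𝓘(ℂ, C2) e.symm y u₁)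
    (mfderiv 𝓘(ℂ, C2) 𝓘(ℂ, C2) e.symm y u₂)

theorem tangentEquiv_frame (he : e ∈ atlas C2 X) (he' : e' ∈ atlas C2 X) {y : C2}
    (hy : y ∈ e.target) (hy' : e.symm y ∈ e'.source) (v : C2) :
    tangentEquiv he' hy' (mfderiv 𝓘(ℂ, C2) 𝓘(ℂ, C2) e.symm y v)
      = fderiv ℂ (e' ∘ e.symm) y v := by
  rw [tangentEquiv_change he (e.map_target hy) he' hy', tangentEquiv_mfderiv_symm he hy,
    e.right_inv hy]

theorem frameValue_localIso (he : e ∈ atlas C2 X) (he' : e' ∈ atlas C2 X) {y : C2}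
    (hy : y ∈ e.target) (hy' : e.symm y ∈ e'.source) (Q : dsFiber 4 m (e.symm y))
    {P : JetPoly 4} (hP : P ∈ invariants 4 m) (h : Q.1 = pull e' P) (i : IndexA m ⊕ IndexB m)
    (v u₁ u₂ : C2) :
    frameValue e (localIso he' hy' Q i) v u₁ u₂
      = apolar (evalVec (fderiv ℂ (e' ∘ e.symm) y v) (covariant i)) P
        * area (fderiv ℂ (e' ∘ e.symm) y u₁) (fderiv ℂ (e' ∘ e.symm) y u₂) ^ (shape i).2 := by
  rw [frameValue, localIso_apply he' hy' Q hP h, decomp_apply, tangentEquiv_frame he he' hy,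
    tangentEquiv_frame he he' hy, tangentEquiv_frame he he' hy]

/-- The isomorphism comes from `e'` while the frame comes from `e`. The transition map and its
derivative, both holomorphic, mediate between the two. -/
theorem contDiffAt_frameValue_localMap {U : Set X} (hU : IsOpen U)
    {s : ∀ x : X, dsFiber 4 m x} (hs : IsJetSection ℝ (invariants 4 m) U s) (he : e ∈ atlas C2 X)
    (he' : e' ∈ atlas C2 X) {y : C2} (hy : y ∈ e.target) (hy' : e.symm y ∈ e'.source)
    (hyU : e.symm y ∈ U) (i : IndexA m ⊕ IndexB m) (v u₁ u₂ : C2) :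
    ContDiffAt ℝ ∞ (fun z => frameValue e (localMap he' (e.symm z) (s (e.symm z)) i) v u₁ u₂) y := by
  obtain ⟨c, hc, hcd⟩ := hs e' he'
  have hτ := analyticAt_transition he he' hy hy'
  have hτr : ContDiffAt ℝ ∞ (e' ∘ e.symm) y := hτ.contDiffAt.restrict_scalars ℝ
  have hd : ∀ w : C2, ContDiffAt ℝ ∞ (fun z => fderiv ℂ (e' ∘ e.symm) z w) y := fun w =>
    ((hτ.fderiv.contDiffAt (n := ∞)).clm_apply contDiffAt_const).restrict_scalars ℝ
  have hopen := e'.isOpen_inter_preimage_symm hU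
  have hmem : (e' ∘ e.symm) y ∈ e'.target ∩ e'.symm ⁻¹' U :=
    ⟨e'.map_source hy', by simpa [e'.left_inv hy'] using hyU⟩
  have hcoeff : ∀ d, ContDiffAt ℝ ∞
      (fun z => MvPolynomial.coeff d (c ((e' ∘ e.symm) z))) y := fun d =>
    ContDiffAt.comp y ((hcd d).contDiffAt (hopen.mem_nhds hmem)) hτr
  refine (contDiffAt_pairing hcoeff (hd v) (hd u₁) (hd u₂) i).congr_of_eventuallyEq ?_
  filter_upwards [(e.isOpen_inter_preimage_symm (e'.open_source.inter hU)).mem_nhds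
    ⟨hy, hy', hyU⟩] with z hz
  have hz' : (e' ∘ e.symm) z ∈ e'.target ∩ e'.symm ⁻¹' U :=
    ⟨e'.map_source hz.2.1, by simpa [e'.left_inv hz.2.1] using hz.2.2⟩
  obtain ⟨h1, h2⟩ := hc _ hz'
  rw [localMap_apply he' hz.2.1]
  refine frameValue_localIso he he' hz.1 hz.2.1 _ h1 ?_ i v u₁ u₂
  have h3 : e'.symm ((e' ∘ e.symm) z) = e.symm z := e'.left_inv hz.2.1
  rwa [h3] at h2

variable (ρ : SmoothPartitionOfUnity X 𝓘(ℝ, C2) X Set.univ)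

/-- The local isomorphisms glued by a partition of unity. -/
def globalMap (x : X) : dsFiber 4 m x →ₗ[ℂ]
    ∀ i : IndexA m ⊕ IndexB m, schurFiber (shape i) x :=
  ∑ α ∈ ρ.finsupport x, (ρ α x : ℂ) • localMap (chart_mem_atlas C2 α) x

theorem globalMap_eq_sum {x : X} {t : Finset X} (h : ρ.finsupport x ⊆ t) :
    (globalMap ρ x : dsFiber 4 m x →ₗ[ℂ] _)
      = ∑ α ∈ t, (ρ α x : ℂ) • localMap (chart_mem_atlas C2 α) x := by
  refine Finset.sum_subset h fun α _ hα => ?_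
  have : ρ α x = 0 := by simpa using hα
  simp [this]

variable {ρ}

theorem bijective_globalMap (hρ : ρ.IsSubordinate fun α => (chartAt C2 α).source) (x : X) :
    Function.Bijective (globalMap ρ x : dsFiber 4 m x →ₗ[ℂ] _) := by
  have he := chart_mem_atlas C2 x
  have hx := mem_chart_source C2 x
  let D := pullEquiv (isStable_invariants m) he hx
  let L := localIso (m := m) he hx
  let N : Module.End ℂ (invariants 4 m) :=
    (D.trans L).symm.toLinearMap ∘ₗ globalMap ρ x ∘ₗ D.toLinearMap
  have hN : Function.Bijective N := by
    -- Compared with one chosen chart, each local isomorphism changes `P` only in higher degree. The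
    -- weights of the partition add up to one, so their average does the same.
    refine bijective_of_unipotent N fun n P hP => ?_
    choose P' h1 h2 using fun α (hα : x ∈ (chartAt C2 α).source) =>
      exists_localIso_eq he hx (chart_mem_atlas C2 α) hα P
    have hsrc : ∀ α ∈ ρ.finsupport x, x ∈ (chartAt C2 α).source := fun α hα =>
      hρ α (subset_tsupport _ ((ρ.mem_finsupport x).1 hα))
    have hNP : N P = ∑ α ∈ (ρ.finsupport x).attach,
        (ρ α.1 x : ℂ) • P' α.1 (hsrc α.1 α.2) := by
      refine (LinearEquiv.symm_apply_eq _).2 ?_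
      rw [map_sum]
      change globalMap ρ x (D P) = _
      rw [globalMap, LinearMap.sum_apply, ← Finset.sum_attach]
      refine Finset.sum_congr rfl fun α _ => ?_
      rw [LinearMap.smul_apply, localMap_apply _ (hsrc α.1 α.2), h1, map_smul]
      rfl
    have hsum : ∑ α ∈ (ρ.finsupport x).attach, (ρ α.1 x : ℂ) = 1 := by
      rw [Finset.sum_attach (ρ.finsupport x) fun α => (ρ α x : ℂ), ← Complex.ofReal_sum,
        ρ.sum_finsupport x (Set.mem_univ x), Complex.ofReal_one]
    have hdiff : (N P - P : JetPoly 4) = ∑ α ∈ (ρ.finsupport x).attach,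
        (ρ α.1 x : ℂ) • ((P' α.1 (hsrc α.1 α.2)).1 - P.1) := by
      simp_rw [smul_sub]
      rw [Finset.sum_sub_distrib, ← Finset.sum_smul, hsum, one_smul, hNP]
      simp
    rw [hdiff]
    refine Ideal.sum_mem _ fun α _ => ?_
    rw [MvPolynomial.smul_eq_C_mul]
    exact Ideal.mul_mem_left _ _ (h2 _ _ n hP)
  have hcomp : (globalMap ρ x : dsFiber 4 m x → _)
      = (D.trans L) ∘ N ∘ D.symm := by
    funext Q
    simp [N]
  rw [hcomp]
  exact (D.trans L).bijective.comp (hN.comp D.symm.bijective)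

theorem isSchurSection_globalMap (hρ : ρ.IsSubordinate fun α => (chartAt C2 α).source)
    {U : Set X} (hU : IsOpen U) {s : ∀ x : X, dsFiber 4 m x}
    (hs : IsJetSection ℝ (invariants 4 m) U s) (i : IndexA m ⊕ IndexB m) :
    IsSchurSection ℝ (shape i) U fun x => globalMap ρ x (s x) i := by
  have := isManifold_real X
  intro e he v u₁ u₂ y hy
  refine ContDiffAt.contDiffWithinAt ?_
  have hsymm : ContMDiffAt 𝓘(ℝ, C2) 𝓘(ℝ, C2) ∞ e.symm y :=
    (contMDiffOn_symm_of_mem_maximalAtlas (IsManifold.subset_maximalAtlas he)).contMDiffAt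
      (e.open_target.mem_nhds hy.1)
  have hcont : ContinuousAt e.symm y := hsymm.continuousAt
  -- Summing over the indices whose closed support contains the point keeps the index set constant
  -- near `y`, and for these indices the point lies in the domain of the chart.
  have hsum : ContDiffAt ℝ ∞ (fun z => ∑ α ∈ ρ.fintsupport (e.symm y), (ρ α (e.symm z) : ℂ)
      * frameValue e (localMap (chart_mem_atlas C2 α) (e.symm z) (s (e.symm z)) i) v u₁ u₂) y := by
    refine ContDiffAt.sum fun α hα => ContDiffAt.mul ?_ ?_
    · have h1 : ContDiffAt ℝ ∞ (fun z => ρ α (e.symm z)) y :=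
        contMDiffAt_iff_contDiffAt.1 (((ρ α).contMDiff (e.symm y)).comp y hsymm)
      exact Complex.ofRealCLM.contDiff.contDiffAt.comp y h1
    · exact contDiffAt_frameValue_localMap hU hs he _ hy.1
        (hρ α ((ρ.mem_fintsupport_iff _ α).1 hα)) hy.2 i v u₁ u₂
  refine hsum.congr_of_eventuallyEq ?_
  filter_upwards [hcont.eventually (ρ.eventually_finsupport_subset (e.symm y))] with z hz
  rw [globalMap_eq_sum ρ hz, LinearMap.sum_apply, Finset.sum_apply]
  simp [frameValue, Finset.sum_apply]

variable (X m) in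
theorem exists_smooth_isomorphism [T2Space X] [SigmaCompactSpace X] :
    ∃ Φ : ∀ x : X, dsFiber 4 m x ≃ₗ[ℂ]
        ⨁ i : IndexA m ⊕ IndexB m, schurFiber (shape i) x,
      ∀ (U : Set X), IsOpen U → ∀ s : ∀ x : X, dsFiber 4 m x,
        IsJetSection ℝ (invariants 4 m) U s →
        ∀ i, IsSchurSection ℝ (shape i) U fun x => Φ x (s x) i := by
  have := isManifold_real X
  obtain ⟨ρ, hρ⟩ := SmoothPartitionOfUnity.exists_isSubordinate_chartAt_source 𝓘(ℝ, C2) X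
  refine ⟨fun x => (LinearEquiv.ofBijective (globalMap ρ x) (bijective_globalMap hρ x)).trans
    (DirectSum.linearEquivFunOnFintype ℂ (IndexA m ⊕ IndexB m)
      fun i => schurFiber (shape i) x).symm, fun U hU s hs i => ?_⟩
  convert isSchurSection_globalMap hρ hU hs i using 2 with x
  exact congrFun (LinearEquiv.apply_symm_apply (DirectSum.linearEquivFunOnFintype ℂ _ _) _) i

end Surface

/-! ### The holomorphic isomorphism on graded pieces -/

theorem dsFil_le {X : Type*} [TopologicalSpace X] [ChartedSpace C2 X] (m p : ℕ) (x : X) :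
    dsFil 4 m p x ≤ dsFiber 4 m x := fun Q hQ e he hx => by
  obtain ⟨P, hP, h⟩ := hQ e he hx
  exact ⟨P, hP.1, h⟩

section Surface

variable {X : Type*} [TopologicalSpace X] [ChartedSpace C2 X] [IsManifold 𝓘(ℂ, C2) ω X]
  {e e' : OpenPartialHomeomorph X C2} {x : X} {m p : ℕ}

/-- The indices of the summands of the graded piece of degree `p`. -/
abbrev GradedIndex (m p : ℕ) : Type :=
  {i : IndexA m ⊕ IndexB m // (shape i).1 + (shape i).2 = p}

/-- The map given by a chart from a fiber of `F^p` to the sum of the fibers of the Schur bundles of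
degree `p`. -/
def gradedMap (p : ℕ) (he : e ∈ atlas C2 X) (hx : x ∈ e.source) : dsFil 4 m p x →ₗ[ℂ]
    ∀ i : GradedIndex m p, schurFiber (shape i.1) x :=
  LinearMap.pi fun i => LinearMap.proj i.1 ∘ₗ (localIso he hx).toLinearMap ∘ₗ
    Submodule.inclusion (dsFil_le m p x)

theorem gradedMap_apply (he : e ∈ atlas C2 X) (hx : x ∈ e.source) (Q : dsFil 4 m p x)
    (i : GradedIndex m p) :
    gradedMap p he hx Q i = localIso he hx (Submodule.inclusion (dsFil_le m p x) Q) i.1 := rfl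

theorem localIso_pullEquiv (he : e ∈ atlas C2 X) (hx : x ∈ e.source) (P : invariants 4 m)
    (i : IndexA m ⊕ IndexB m) :
    localIso he hx (pullEquiv (isStable_invariants m) he hx P) i
      = schurCongr (tangentEquiv he hx) (shape i) (decomp m P i) := by
  simp only [localIso, LinearEquiv.trans_apply, LinearEquiv.symm_apply_apply]
  rfl

/-- Extend the given components by zero. An invariant whose only components have `l₁ + l₂ = p` is
homogeneous of degree `p` and so lies in `F^p`. -/
theorem gradedMap_surjective (he : e ∈ atlas C2 X) (hx : x ∈ e.source) :
    Function.Surjective (gradedMap (m := m) p he hx) := by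
  classical
  intro F
  let G : ∀ i : IndexA m ⊕ IndexB m, Schur C2 (shape i) := fun i =>
    if h : (shape i).1 + (shape i).2 = p then
      (schurCongr (tangentEquiv he hx) (shape i)).symm (F ⟨i, h⟩) else 0
  have hP : ((decomp m).symm G).1 ∈ jetIdeal 4 ^ p := mem_pow_of_decomp fun i hi => by
    rw [LinearEquiv.apply_symm_apply]
    exact dif_neg hi
  refine ⟨pullEquiv (isStable_invariantsOfOrder m p) he hx
    ⟨_, mem_invariantsOfOrder_iff.2 ⟨((decomp m).symm G).2, hP⟩⟩, funext fun i => ?_⟩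
  rw [gradedMap_apply]
  refine (localIso_pullEquiv he hx ((decomp m).symm G) i.1).trans ?_
  rw [LinearEquiv.apply_symm_apply, show G i.1 = _ from dif_pos i.2, LinearEquiv.apply_symm_apply]

theorem ker_gradedMap (he : e ∈ atlas C2 X) (hx : x ∈ e.source) :
    LinearMap.ker (gradedMap (m := m) p he hx)
      = (dsFil 4 m (p + 1) x).submoduleOf (dsFil 4 m p x) := by
  ext Q
  obtain ⟨P, hP, h⟩ := Q.2 e he hx
  obtain ⟨hP1, hP2⟩ := mem_invariantsOfOrder_iff.1 hP
  have hQ : Submodule.inclusion (dsFil_le m p x) Q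
      = pullEquiv (isStable_invariants m) he hx ⟨P, hP1⟩ := Subtype.ext h
  have h1 : Q ∈ LinearMap.ker (gradedMap (m := m) p he hx) ↔
      ∀ i, (shape i).1 + (shape i).2 = p → decomp m ⟨P, hP1⟩ i = 0 := by
    rw [LinearMap.mem_ker, funext_iff, Subtype.forall]
    refine forall_congr' fun i => forall_congr' fun hi => ?_
    rw [gradedMap_apply, hQ, localIso_pullEquiv]
    exact LinearEquiv.map_eq_zero_iff _
  rw [h1, ← mem_pow_succ_iff hP2]
  change P ∈ _ ↔ Q.1 ∈ dsFil 4 m (p + 1) x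
  constructor
  · intro h2
    rw [h]
    exact pull_mem_jetFiber (isStable_invariantsOfOrder m (p + 1)) he hx
      (mem_invariantsOfOrder_iff.2 ⟨hP1, h2⟩)
  · intro h2
    obtain ⟨P', hP', h'⟩ := h2 e he hx
    have : P = P' := pull_injective he hx (h.symm.trans h')
    exact (mem_invariantsOfOrder_iff.1 (this ▸ hP')).2

/-- The isomorphism given by a chart between a fiber of a graded piece and the sum of the fibers of
the Schur bundles of degree `p`. -/
def gradedEquiv (p : ℕ) (he : e ∈ atlas C2 X) (hx : x ∈ e.source) : dsGr 4 m p x ≃ₗ[ℂ]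
    ∀ i : GradedIndex m p, schurFiber (shape i.1) x :=
  (Submodule.quotEquivOfEq _ _ (ker_gradedMap he hx).symm).trans
    (LinearMap.quotKerEquivOfSurjective _ (gradedMap_surjective he hx))

/-- The preferred chart at `x` jumps with `x`, but on `F^p` the components of degree `p` do not
depend on the chart. Over the domain of `e` the preferred chart can thus be replaced by `e`, where
the value is a fixed linear expression in the coefficients. -/
theorem isSchurSection_gradedMap {U : Set X} (hU : IsOpen U) {s : ∀ x : X, dsFil 4 m p x}
    (hs : IsJetSection ℂ (invariantsOfOrder 4 m p) U s) (i : GradedIndex m p) :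
    IsSchurSection ℂ (shape i.1) U fun x =>
      gradedMap p (chart_mem_atlas C2 x) (mem_chart_source C2 x) (s x) i := by
  intro e he v u₁ u₂
  obtain ⟨c, hc, hcd⟩ := hs e he
  have h : ContDiffOn ℂ ∞ (fun y => apolar (evalVec v (covariant i.1)) (c y)
      * area u₁ u₂ ^ (shape i.1).2) (e.target ∩ e.symm ⁻¹' U) := fun y hy =>
    (contDiffAt_pairing (fun d => (hcd d).contDiffAt ((e.isOpen_inter_preimage_symm hU).mem_nhds hy))
      contDiffAt_const contDiffAt_const contDiffAt_const i.1).contDiffWithinAt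
  refine h.congr fun y hy => ?_
  obtain ⟨h1, h2⟩ := hc y hy
  obtain ⟨hP, hPp⟩ := mem_invariantsOfOrder_iff.1 h1
  have hy' := e.map_target hy.1
  change frameValue e (localIso _ (mem_chart_source C2 _)
    (Submodule.inclusion (dsFil_le m p _) (s (e.symm y))) i.1) v u₁ u₂ = _
  rw [localIso_eq_of_mem_pow he hy' (chart_mem_atlas C2 _) _ _ h2 hP hPp i.2, frameValue,
    localIso_apply he hy' _ hP h2, decomp_apply, tangentEquiv_mfderiv_symm he hy.1,
    tangentEquiv_mfderiv_symm he hy.1, tangentEquiv_mfderiv_symm he hy.1]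

variable (X m p) in
theorem exists_graded_isomorphism :
    ∃ Ψ : ∀ x : X, dsGr 4 m p x ≃ₗ[ℂ]
        ⨁ i : {i : IndexA m ⊕ IndexB m // (shape i).1 + (shape i).2 = p},
          schurFiber (shape i.1) x,
      ∀ (U : Set X), IsOpen U → ∀ s : ∀ x : X, dsFil 4 m p x,
        IsJetSection ℂ (invariantsOfOrder 4 m p) U s →
        ∀ i : {i : IndexA m ⊕ IndexB m // (shape i).1 + (shape i).2 = p},
          IsSchurSection ℂ (shape i.1) U fun x => Ψ x (grMk (s x)) i := by
  refine ⟨fun x => (gradedEquiv p (chart_mem_atlas C2 x) (mem_chart_source C2 x)).trans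
    (DirectSum.linearEquivFunOnFintype ℂ (GradedIndex m p)
      fun i => schurFiber (shape i.1) x).symm, fun U hU s hs i => ?_⟩
  convert isSchurSection_gradedMap hU hs i using 2 with x
  exact congrFun (LinearEquiv.apply_symm_apply (DirectSum.linearEquivFunOnFintype ℂ _ _) _) i

end Surface

end DemaillySemple

end

theorem mainTheorem10 (m : ℕ) :
    -- every bi-invariant of weight `m` is uniquely written in normal form
    (∀ P : DemaillySemple.JetPoly 4, DemaillySemple.IsBiInvariant 4 m P →
      ∃! pq : MvPolynomial (Fin 4) ℂ × MvPolynomial (Fin 4) ℂ,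
        P = DemaillySemple.normalForm pq.1 pq.2) ∧
    -- the normal forms of weight `m` are those with the stated exponents, the coefficients being
    -- arbitrary
    (∀ p q : MvPolynomial (Fin 4) ℂ,
      DemaillySemple.IsBiInvariant 4 m (DemaillySemple.normalForm p q) ↔
        (∀ k ∈ p.support, k 0 + 3 * k 1 + 5 * k 2 + 8 * k 3 = m) ∧
        (∀ k ∈ q.support, 7 + k 0 + 5 * k 1 + 7 * k 2 + 8 * k 3 = m)) ∧
    -- decomposition of the fiber as a representation of `GL₂(ℂ)`
    (∃ S : DemaillySemple.invariants 4 m ≃ₗ[ℂ]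
        ⨁ i : DemaillySemple.IndexA m ⊕ DemaillySemple.IndexB m,
          DemaillySemple.Schur DemaillySemple.C2 (DemaillySemple.shape i),
      ∀ (W : GL (Fin 2) ℂ) (P : DemaillySemple.invariants 4 m)
        (i : DemaillySemple.IndexA m ⊕ DemaillySemple.IndexB m) (v u₁ u₂ : DemaillySemple.C2),
        (S ⟨DemaillySemple.act W.1 P.1, DemaillySemple.act_mem W.1 P.2⟩ i).1 v u₁ u₂
          = (S P i).1 (W.1.mulVec v) (W.1.mulVec u₁) (W.1.mulVec u₂)) ∧
    -- the bundles on a complex surface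
    (∀ (X : Type u) [TopologicalSpace X] [T2Space X] [SigmaCompactSpace X]
        [ChartedSpace DemaillySemple.C2 X] [IsManifold 𝓘(ℂ, DemaillySemple.C2) ω X],
      -- isomorphism of smooth complex vector bundles
      (∃ Φ : ∀ x : X, DemaillySemple.dsFiber 4 m x ≃ₗ[ℂ]
          ⨁ i : DemaillySemple.IndexA m ⊕ DemaillySemple.IndexB m,
            DemaillySemple.schurFiber (DemaillySemple.shape i) x,
        ∀ (U : Set X), IsOpen U → ∀ s : ∀ x : X, DemaillySemple.dsFiber 4 m x,
          DemaillySemple.IsJetSection ℝ (DemaillySemple.invariants 4 m) U s →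
          ∀ i, DemaillySemple.IsSchurSection ℝ (DemaillySemple.shape i) U
            fun x => Φ x (s x) i) ∧
      -- isomorphism of holomorphic vector bundles on the graded pieces
      (∀ p : ℕ, ∃ Ψ : ∀ x : X, DemaillySemple.dsGr 4 m p x ≃ₗ[ℂ]
          ⨁ i : {i : DemaillySemple.IndexA m ⊕ DemaillySemple.IndexB m //
              (DemaillySemple.shape i).1 + (DemaillySemple.shape i).2 = p},
            DemaillySemple.schurFiber (DemaillySemple.shape i.1) x,
        ∀ (U : Set X), IsOpen U → ∀ s : ∀ x : X, DemaillySemple.dsFil 4 m p x,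
          DemaillySemple.IsJetSection ℂ (DemaillySemple.invariantsOfOrder 4 m p) U s →
          ∀ i : {i : DemaillySemple.IndexA m ⊕ DemaillySemple.IndexB m //
              (DemaillySemple.shape i).1 + (DemaillySemple.shape i).2 = p},
            DemaillySemple.IsSchurSection ℂ (DemaillySemple.shape i.1) U
              fun x => Ψ x (DemaillySemple.grMk (s x)) i)) := by
  refine ⟨fun P hP => DemaillySemple.existsUnique_normalForm hP,
    DemaillySemple.isBiInvariant_normalForm_iff, DemaillySemple.exists_decomposition m,
    fun X _ _ _ _ _ => ⟨DemaillySemple.exists_smooth_isomorphism X m,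
      DemaillySemple.exists_graded_isomorphism X m⟩⟩
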